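/- Let $\mathfrak A$ be an essentially small Karoubian $\mathbb Q$-linear tensor category, that is, an additive $\mathbb Q$-linear category with finite direct sums in which every idempotent splits, with a $\mathbb Q$-bilinear symmetric monoidal structure $(\otimes,\mathbb 1)$. Let $K_0(\mathfrak A)$ be its Grothendieck ring: the abelian group generated by the classes $\mathrm{cl}(X)$ of objects with the relations $\mathrm{cl}(X\oplus Y)=\mathrm{cl}(X)+\mathrm{cl}(Y)$, with product $\mathrm{cl}(X)\,\mathrm{cl}(Y)=\mathrm{cl}(X\otimes Y)$. Let $R=\bigoplus_{n\ge 0}R_n$, where $R_n$ is the Grothendieck group of finite-dimensional $\mathbb Q$-representations of the symmetric group $\Sigma_n$, with the commutative ring structure $\mathrm{cl}(V)\,\mathrm{cl}(W)=\mathrm{cl}\bigl(\mathrm{Ind}_{\Sigma_p\times\Sigma_q}^{\Sigma_{p+q}}(V\otimes W)\bigr)$. For a partition $\mu$ of $n=|\mu|$ let $V_\mu$ be the corresponding irreducible $\mathbb Q\Sigma_n$-module (the left ideal generated by a Young symmetrizer of shape $\mu$, so that $V_{(n)}$ is trivial), let $e_\mu\in\mathbb Q\Sigma_n$ be an idempotent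 with $V_\mu=\mathbb Q\Sigma_n e_\mu$, and for an object $X$ let $S_\mu(X)$ be the image of $e_\mu$ acting on $X^{\otimes n}$, where $\Sigma_n$ acts through the commutativity constraint. Put $$\lambda_\Sigma(X)=\sum_{\mu}\mathrm{cl}\bigl(S_\mu(X)\bigr)\otimes\mathrm{cl}(V_\mu)\,t^{|\mu|}\in\bigl(K_0(\mathfrak A)\otimes_{\mathbb Z}R\bigr)[[t]],$$ the sum being over all partitions $\mu$ of all integers $|\mu|\ge 0$. For partitions $\mu$ of $p$, $\eta$ of $q$ and $\pi$ of $p+q$ let $c^\pi_{\mu\eta}=\dim_{\mathbb Q}\mathrm{Hom}_{\Sigma_{p+q}}\bigl(V_\pi,\mathrm{Ind}_{\Sigma_p\times\Sigma_q}^{\Sigma_{p+q}}(V_\mu\otimes V_\eta)\bigr)$ (the Littlewood--Richardson coefficient). Then: 1. There is an injective homomorphism of abelian groups from $K_0(\mathfrak A)$ to the multiplicative group $1+t\,\bigl(K_0(\mathfrak A)\otimes_{\mathbb Z}R\bigr)[[t]]$ that sends $\mathrm{cl}(X)$ to $\lambda_\Sigma(X)$ for every object $X$; that is, $\lambda_\Sigma$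 is a well-defined monomorphism of abelian groups on $K_0(\mathfrak A)$. 2. For all $p,q\ge 0$ and all partitions $\mu$ of $p$ and $\eta$ of $q$, $\ \mathrm{Ind}_{\Sigma_p\times\Sigma_q}^{\Sigma_{p+q}}(V_\mu\otimes V_\eta)\cong\bigoplus_{|\pi|=p+q}V_\pi^{\oplus c^\pi_{\mu\eta}}$. 3. For every partition $\pi$ and all objects $X,Y$ of $\mathfrak A$, $$S_\pi(X\oplus Y)\cong\bigoplus_{|\mu|+|\eta|=|\pi|}\bigl(S_\mu(X)\otimes S_\eta(Y)\bigr)^{\oplus c^\pi_{\mu\eta}}.$$ -/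

import Mathlib

set_option linter.unusedSectionVars false

open CategoryTheory MonoidalCategory Limits
open scoped TensorProduct
universe v u

namespace GLR

noncomputable section

section SymmetricGroup

/-- The embedding `Σ_n → Σ_{n+1}` as the stabilizer of the first letter. -/
def permLift (n : ℕ) : Equiv.Perm (Fin n) →* Equiv.Perm (Fin (n + 1)) where
  toFun τ :=
    { toFun := Fin.cases 0 fun j => (τ j).succ
      invFun := Fin.cases 0 fun j => (τ.symm j).succ
      left_inv := fun x => by induction x using Fin.cases <;> simp
      right_inv := fun x => by induction x using Fin.cases <;> simp }
  map_one' := by ext x; induction x using Fin.cases <;> simp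
  map_mul' σ τ := by ext x; induction x using Fin.cases <;> simp

@[simp] theorem permLift_zero (n : ℕ) (τ : Equiv.Perm (Fin n)) : permLift n τ 0 = 0 := rfl

@[simp] theorem permLift_succ (n : ℕ) (τ : Equiv.Perm (Fin n)) (j : Fin n) :
    permLift n τ j.succ = (τ j).succ := rfl

/-- A permutation of `Fin (n + 1)` that fixes `0`, restricted to the remaining letters
(the value on other permutations is irrelevant). -/
def permRest (n : ℕ) (σ : Equiv.Perm (Fin (n + 1))) : Equiv.Perm (Fin n) :=
  (Equiv.Perm.decomposeFin σ).2

theorem permLift_eq (n : ℕ) (τ : Equiv.Perm (Fin n)) :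
    permLift n τ = Equiv.Perm.decomposeFin.symm (0, τ) := by
  ext x; induction x using Fin.cases <;> simp

theorem permRest_lift (n : ℕ) (τ : Equiv.Perm (Fin n)) : permRest n (permLift n τ) = τ := by
  simp [permRest, permLift_eq]

theorem permLift_rest (n : ℕ) (σ : Equiv.Perm (Fin (n + 1))) (h : σ 0 = 0) :
    permLift n (permRest n σ) = σ := by
  rw [permLift_eq, permRest, Equiv.symm_apply_eq]
  have h1 : (Equiv.Perm.decomposeFin σ).1 = 0 := by
    have := Equiv.Perm.decomposeFin_symm_apply_zero (Equiv.Perm.decomposeFin σ).1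
      (Equiv.Perm.decomposeFin σ).2
    rw [Prod.mk.eta, Equiv.symm_apply_apply] at this
    rw [← this, h]
  ext1
  · exact h1.symm
  · rfl

/- A sequence of monoids `M n` with maps `L : M n → M (n+1)` and elements `t n : M (n+2)` that
satisfy the relations of the first transposition. -/

section Tower

variable {M : ℕ → Type*} [∀ n, Monoid (M n)] (L : ∀ n, M n →* M (n + 1)) (t : ∀ n, M (n + 2))

/-- The image of the transposition of the `i`-th and the `(i+1)`-st letter
(and `1` if `n ≤ i + 1`). -/
def towerSwap : ∀ n : ℕ, ℕ → M n
  | 0, _ => 1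
  | 1, 0 => 1
  | n + 2, 0 => t n
  | n + 1, i + 1 => L n (towerSwap n i)

/-- The image of the cycle that moves the first letter to position `k`. -/
def towerCycle : ∀ n : ℕ, Fin (n + 1) → M (n + 1)
  | 0, _ => 1
  | n + 1, k => Fin.cases 1 (fun j => L (n + 1) (towerCycle n j) * t n) k

/-- The image of a permutation, written as a cycle moving the first letter to its place
after a permutation of the other letters. -/
def towerAct : ∀ n : ℕ, Equiv.Perm (Fin n) → M n
  | 0, _ => 1
  | n + 1, σ => towerCycle L t n (σ 0) *
      L n (towerAct n (permRest n
        ((towerCycle permLift (fun _ => Equiv.swap 0 1) n (σ 0))⁻¹ * σ)))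

theorem towerSwap_succ (n i : ℕ) : towerSwap L t (n + 1) (i + 1) = L n (towerSwap L t n i) := by
  cases n <;> rfl

theorem towerSwap_self (n : ℕ) : towerSwap L t n n = 1 := by
  induction n with
  | zero => rfl
  | succ n ih => rw [towerSwap_succ, ih, map_one]

theorem towerCycle_zero (n : ℕ) : towerCycle L t n 0 = 1 := by
  cases n <;> rfl

theorem towerCycle_succ (n : ℕ) (j : Fin (n + 1)) :
    towerCycle L t (n + 1) j.succ = L (n + 1) (towerCycle L t n j) * t n := rfl

theorem towerSwap_mul_towerCycle
    (hsq : ∀ n, t n * t n = 1)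
    (hcomm : ∀ n x, t n * L (n + 1) (L n x) = L (n + 1) (L n x) * t n)
    (hbraid : ∀ n, t (n + 1) * L (n + 2) (t n) * t (n + 1) =
      L (n + 2) (t n) * t (n + 1) * L (n + 2) (t n))
    : ∀ (n i : ℕ) (k : Fin (n + 1)), ∃ (k' : Fin (n + 1)) (j : ℕ),
    towerSwap L t (n + 1) i * towerCycle L t n k =
      towerCycle L t n k' * L n (towerSwap L t n j) := by
  intro n
  induction n with
  | zero =>
    intro i k
    refine ⟨0, 0, ?_⟩
    obtain rfl : k = 0 := Fin.fin_one_eq_zero k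
    cases i <;> simp [towerCycle_zero, towerSwap]
  | succ n ih =>
    intro i k
    cases i with
    | zero =>
      induction k using Fin.cases with
      | zero =>
        refine ⟨Fin.succ 0, n + 1, ?_⟩
        rw [towerSwap_self, towerCycle_succ, towerCycle_zero, towerCycle_zero]
        simp [towerSwap]
      | succ k =>
        cases n with
        | zero =>
          obtain rfl : k = 0 := Fin.fin_one_eq_zero k
          refine ⟨0, 1, ?_⟩
          rw [towerSwap_self, towerCycle_succ, towerCycle_zero, towerCycle_zero]
          simp [towerSwap, hsq]
        | succ n =>
          induction k using Fin.cases with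
          | zero =>
            refine ⟨0, n + 2, ?_⟩
            rw [towerSwap_self, towerCycle_succ, towerCycle_zero, towerCycle_zero]
            simp [towerSwap, hsq]
          | succ k =>
            refine ⟨k.succ.succ, 0, ?_⟩
            have hb := hbraid n
            simp only [towerCycle_succ, map_mul, towerSwap]
            rw [mul_assoc, mul_assoc, mul_assoc, ← mul_assoc (t (n + 1)) (L _ (L _ _)), hcomm,
              mul_assoc, ← mul_assoc (t (n + 1)), hb, mul_assoc]
    | succ i =>
      rw [towerSwap_succ]
      induction k using Fin.cases with
      | zero => exact ⟨0, i, by simp [towerCycle_zero]⟩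
      | succ k =>
        obtain ⟨k', j, h⟩ := ih i k
        refine ⟨k'.succ, j + 1, ?_⟩
        rw [towerCycle_succ, towerCycle_succ, ← mul_assoc, ← map_mul, h, map_mul, mul_assoc,
          ← hcomm, towerSwap_succ, mul_assoc]

theorem permSwap_sq (n : ℕ) :
    (Equiv.swap 0 1 : Equiv.Perm (Fin (n + 2))) * Equiv.swap 0 1 = 1 :=
  Equiv.swap_mul_self _ _

theorem permSwap_comm (n : ℕ) (x : Equiv.Perm (Fin n)) :
    (Equiv.swap 0 1 : Equiv.Perm (Fin (n + 2))) * permLift (n + 1) (permLift n x) =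
      permLift (n + 1) (permLift n x) * Equiv.swap 0 1 := by
  have h0 : permLift (n + 1) (permLift n x) 0 = 0 := rfl
  have h1 : permLift (n + 1) (permLift n x) 1 = 1 := rfl
  rw [Equiv.mul_swap_eq_swap_mul, h0, h1]

theorem permSwap_braid (n : ℕ) :
    (Equiv.swap 0 1 : Equiv.Perm (Fin (n + 3))) * permLift (n + 2) (Equiv.swap 0 1) *
      Equiv.swap 0 1 =
    permLift (n + 2) (Equiv.swap 0 1) * Equiv.swap 0 1 * permLift (n + 2) (Equiv.swap 0 1) := by
  have h : permLift (n + 2) (Equiv.swap 0 1) = Equiv.swap (Fin.succ 0) (Fin.succ 1) := by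
    ext x
    induction x using Fin.cases with
    | zero => rw [Equiv.swap_apply_of_ne_of_ne (by simp) (Fin.succ_ne_zero _).symm]; rfl
    | succ x =>
      rw [permLift_succ, ← (Fin.succ_injective _).swap_apply]
  have h01 : (0 : Fin (n + 3)) ≠ Fin.succ 0 := (Fin.succ_ne_zero _).symm
  have h02 : (0 : Fin (n + 3)) ≠ Fin.succ 1 := (Fin.succ_ne_zero _).symm
  have h12 : (Fin.succ 0 : Fin (n + 3)) ≠ Fin.succ 1 :=
    fun h => absurd (Fin.succ_injective _ h) (Fin.succ_ne_zero (0 : Fin (n + 1))).symm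
  have e1 := Equiv.swap_mul_swap_mul_swap h12.symm h02.symm
  have e2 := Equiv.swap_mul_swap_mul_swap h01 h02
  rw [Equiv.swap_comm (Fin.succ 0) 0, Equiv.swap_comm (Fin.succ 1) (Fin.succ 0)] at e1
  rw [Equiv.swap_comm (Fin.succ 1) 0] at e2
  rw [h]
  exact e1.trans e2.symm

theorem permCycle_apply_zero (n : ℕ) (k : Fin (n + 1)) :
    towerCycle permLift (fun _ => Equiv.swap 0 1) n k 0 = k := by
  induction n with
  | zero => exact (Fin.fin_one_eq_zero k).symm
  | succ n ih =>
    induction k using Fin.cases with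
    | zero => rfl
    | succ k =>
      rw [towerCycle_succ, Equiv.Perm.mul_apply, Equiv.swap_apply_left]
      change permLift (n + 1) _ (Fin.succ 0) = _
      rw [permLift_succ, ih]

theorem exists_eq_cycle_mul_lift (n : ℕ) (σ : Equiv.Perm (Fin (n + 1))) :
    ∃ τ, σ = towerCycle permLift (fun _ => Equiv.swap 0 1) n (σ 0) * permLift n τ := by
  refine ⟨permRest n ((towerCycle permLift (fun _ => Equiv.swap 0 1) n (σ 0))⁻¹ * σ), ?_⟩
  rw [permLift_rest, mul_inv_cancel_left]
  rw [Equiv.Perm.mul_apply, Equiv.Perm.inv_eq_iff_eq, permCycle_apply_zero]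

theorem towerAct_cycle_mul_lift (n : ℕ) (k : Fin (n + 1)) (τ : Equiv.Perm (Fin n)) :
    towerAct L t (n + 1) (towerCycle permLift (fun _ => Equiv.swap 0 1) n k * permLift n τ) =
      towerCycle L t n k * L n (towerAct L t n τ) := by
  have h0 : (towerCycle permLift (fun _ => Equiv.swap 0 1) n k * permLift n τ) 0 = k := by
    rw [Equiv.Perm.mul_apply, permLift_zero, permCycle_apply_zero]
  rw [towerAct, h0, inv_mul_cancel_left, permRest_lift]

theorem towerAct_one (n : ℕ) : towerAct L t n 1 = 1 := by
  induction n with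
  | zero => rfl
  | succ n ih =>
    have := towerAct_cycle_mul_lift L t n 0 1
    rwa [towerCycle_zero, towerCycle_zero, map_one, mul_one, one_mul, ih, map_one] at this

theorem towerAct_swap_mul
    (hsq : ∀ n, t n * t n = 1)
    (hcomm : ∀ n x, t n * L (n + 1) (L n x) = L (n + 1) (L n x) * t n)
    (hbraid : ∀ n, t (n + 1) * L (n + 2) (t n) * t (n + 1) =
      L (n + 2) (t n) * t (n + 1) * L (n + 2) (t n))
    (n i : ℕ) (σ : Equiv.Perm (Fin n)) :
    towerAct L t n (towerSwap permLift (fun _ => Equiv.swap 0 1) n i * σ) =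
      towerSwap L t n i * towerAct L t n σ := by
  induction n generalizing i with
  | zero => cases i <;> simp [towerAct, towerSwap]
  | succ n ih =>
    obtain ⟨k', j, h⟩ := towerSwap_mul_towerCycle
      (M := fun n => Equiv.Perm (Fin n) × M n)
      (fun n => (permLift n).prodMap (L n)) (fun n => (Equiv.swap 0 1, t n))
      (fun n => Prod.ext (permSwap_sq n) (hsq n))
      (fun n x => Prod.ext (permSwap_comm n x.1) (hcomm n x.2))
      (fun n => Prod.ext (permSwap_braid n) (hbraid n)) n i (σ 0)
    have sw : ∀ n i, towerSwap (M := fun n => Equiv.Perm (Fin n) × M n)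
        (fun n => (permLift n).prodMap (L n)) (fun n => (Equiv.swap 0 1, t n)) n i =
        (towerSwap permLift (fun _ => Equiv.swap 0 1) n i, towerSwap L t n i) := by
      intro n
      induction n with
      | zero => intro i; rfl
      | succ n ih =>
        intro i
        cases i with
        | zero => cases n <;> rfl
        | succ i => rw [towerSwap_succ, towerSwap_succ, towerSwap_succ, ih]; rfl
    have cy : ∀ n k, towerCycle (M := fun n => Equiv.Perm (Fin n) × M n)
        (fun n => (permLift n).prodMap (L n)) (fun n => (Equiv.swap 0 1, t n)) n k =
        (towerCycle permLift (fun _ => Equiv.swap 0 1) n k, towerCycle L t n k) := by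
      intro n
      induction n with
      | zero => intro i; rfl
      | succ n ih =>
        intro k
        induction k using Fin.cases with
        | zero => rfl
        | succ k => rw [towerCycle_succ, towerCycle_succ, towerCycle_succ, ih]; rfl
    rw [sw, sw, cy, cy, Prod.ext_iff] at h
    obtain ⟨hp, hm⟩ := h
    simp only [Prod.fst_mul, Prod.snd_mul, MonoidHom.prodMap_def, MonoidHom.prod_apply,
      MonoidHom.comp_apply, MonoidHom.coe_fst, MonoidHom.coe_snd] at hp hm
    obtain ⟨τ, hτ⟩ := exists_eq_cycle_mul_lift n σ
    conv_lhs => rw [hτ, ← mul_assoc, hp, mul_assoc, ← map_mul, towerAct_cycle_mul_lift, ih,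
      map_mul, ← mul_assoc, ← hm, mul_assoc, ← towerAct_cycle_mul_lift, ← hτ]

theorem permSwap_closure (n : ℕ) : Submonoid.closure
    (Set.range (towerSwap permLift (fun _ => Equiv.swap 0 1) n)) = ⊤ := by
  induction n with
  | zero => exact Subsingleton.elim _ _
  | succ n ih =>
    have hl : ∀ n, Submonoid.closure
        (Set.range (towerSwap permLift (fun _ => Equiv.swap 0 1) n)) = ⊤ → ∀ τ, permLift n τ ∈ 
        Submonoid.closure
          (Set.range (towerSwap permLift (fun _ => Equiv.swap 0 1) (n + 1))) := by
      intro n hn τ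
      have : τ ∈ Submonoid.closure
        (Set.range (towerSwap permLift (fun _ => Equiv.swap 0 1) n)) := hn ▸ Submonoid.mem_top τ
      induction this using Submonoid.closure_induction with
      | mem x hx =>
        obtain ⟨i, rfl⟩ := hx
        exact Submonoid.subset_closure ⟨i + 1, towerSwap_succ _ _ _ _⟩
      | one => rw [map_one]; exact one_mem _
      | mul x y _ _ hx hy => rw [map_mul]; exact mul_mem hx hy
    rw [eq_top_iff]
    intro σ _
    obtain ⟨τ, hτ⟩ := exists_eq_cycle_mul_lift n σ
    rw [hτ]
    refine mul_mem ?_ (hl n ih τ)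
    generalize σ 0 = k
    cases n with
    | zero => exact one_mem _
    | succ n =>
      induction k using Fin.cases with
      | zero => rw [towerCycle_zero]; exact one_mem _
      | succ k =>
        rw [towerCycle_succ]
        exact mul_mem (hl _ ih _) (Submonoid.subset_closure ⟨0, rfl⟩)

/-- The homomorphism from the symmetric group to `M n` that sends the transposition of the `i`-th
and the `(i+1)`-st letter to `towerSwap L t n i`. -/
def towerHom
    (hsq : ∀ n, t n * t n = 1)
    (hcomm : ∀ n x, t n * L (n + 1) (L n x) = L (n + 1) (L n x) * t n)
    (hbraid : ∀ n, t (n + 1) * L (n + 2) (t n) * t (n + 1) =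
      L (n + 2) (t n) * t (n + 1) * L (n + 2) (t n))
    (n : ℕ) : Equiv.Perm (Fin n) →* M n where
  toFun := towerAct L t n
  map_one' := towerAct_one L t n
  map_mul' g σ := by
    have : g ∈ Submonoid.closure
        (Set.range (towerSwap permLift (fun _ => Equiv.swap 0 1) n)) :=
      permSwap_closure n ▸ Submonoid.mem_top g
    induction this using Submonoid.closure_induction generalizing σ with
    | mem x hx =>
      obtain ⟨i, rfl⟩ := hx
      have h1 := towerAct_swap_mul L t hsq hcomm hbraid n i 1
      rw [mul_one, towerAct_one, mul_one] at h1
      rw [towerAct_swap_mul L t hsq hcomm hbraid, h1]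
    | one => rw [one_mul, towerAct_one, one_mul]
    | mul x y _ _ hx hy => rw [mul_assoc, hx, hy, hx y, mul_assoc]

theorem towerHom_swap
    (hsq : ∀ n, t n * t n = 1)
    (hcomm : ∀ n x, t n * L (n + 1) (L n x) = L (n + 1) (L n x) * t n)
    (hbraid : ∀ n, t (n + 1) * L (n + 2) (t n) * t (n + 1) =
      L (n + 2) (t n) * t (n + 1) * L (n + 2) (t n))
    (n i : ℕ) :
    towerHom L t hsq hcomm hbraid n (towerSwap permLift (fun _ => Equiv.swap 0 1) n i) =
      towerSwap L t n i := by
  have h1 := towerAct_swap_mul L t hsq hcomm hbraid n i 1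
  rwa [mul_one, towerAct_one, mul_one] at h1

end Tower

end SymmetricGroup

section TensorPower

variable {A : Type u} [Category.{v} A] [MonoidalCategory A] [SymmetricCategory A]

/-- `X^{⊗ n} = X ⊗ (X ⊗ (⋯ ⊗ (X ⊗ 𝟙)))`. -/
def tensorPow (X : A) : ℕ → A
  | 0 => 𝟙_ A
  | n + 1 => X ⊗ tensorPow X n

/-- The commutativity constraint on the first two factors of `X ⊗ (X ⊗ P)`. -/
def swapFirst (X P : A) : X ⊗ (X ⊗ P) ⟶ X ⊗ (X ⊗ P) :=
  (α_ X X P).inv ≫ (β_ X X).hom ▷ P ≫ (α_ X X P).hom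

theorem swapFirst_sq (X P : A) : swapFirst X P ≫ swapFirst X P = 𝟙 _ := by
  simp [swapFirst, ← comp_whiskerRight_assoc]

theorem swapFirst_natural (X : A) {P Q : A} (f : P ⟶ Q) :
    X ◁ X ◁ f ≫ swapFirst X Q = swapFirst X P ≫ X ◁ X ◁ f := by
  simp only [swapFirst, Category.assoc]
  rw [associator_inv_naturality_right_assoc, whisker_exchange_assoc,
    associator_naturality_right]

theorem swapFirst_braid (X P : A) :
    swapFirst X (X ⊗ P) ≫ X ◁ swapFirst X P ≫ swapFirst X (X ⊗ P) =
      X ◁ swapFirst X P ≫ swapFirst X (X ⊗ P) ≫ X ◁ swapFirst X P := by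
  have h := congrArg (fun f => X ◁ (α_ X X P).inv ≫ (α_ X (X ⊗ X) P).inv ≫ (α_ X X X).inv ▷ P ≫
    f ▷ P ≫ (α_ (X ⊗ X) X P).hom ≫ (α_ X X (X ⊗ P)).hom)
    (BraidedCategory.yang_baxter' X X X)
  convert! h using 1
  all_goals simp only [swapFirst, monoidalComp]; monoidal


/-- `X ◁ -` on endomorphisms, as a homomorphism of monoids. -/
def whiskerLeftEnd (X P : A) : End P →* End (X ⊗ P) where
  toFun f := X ◁ f
  map_one' := whiskerLeft_id X P
  map_mul' f g := whiskerLeft_comp X g f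

/-- The action of `Σ_n` on `X^{⊗ n}` through the commutativity constraint: the transposition of two
neighbouring letters acts by the commutativity constraint of the two corresponding factors. -/
def tensorPowAction (X : A) (n : ℕ) : Equiv.Perm (Fin n) →* End (tensorPow X n) :=
  towerHom (M := fun n => End (tensorPow X n)) (fun n => whiskerLeftEnd X (tensorPow X n))
    (fun n => swapFirst X (tensorPow X n))
    (fun n => swapFirst_sq X (tensorPow X n))
    (fun _ f => swapFirst_natural X f)
    (fun n => by
      have h := swapFirst_braid X (tensorPow X n)
      exact h) n

end TensorPower

section GrothendieckGroup

attribute [instance] hasBinaryBiproducts_of_finite_biproducts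

variable (A : Type u) [Category.{v} A] [Preadditive A] [HasFiniteBiproducts A]

/-- The relations `[Z] = [X] + [Y]` for `Z ≅ X ⊕ Y`; they include `[Z] = [X]` for `Z ≅ X`. -/
def K0Relations : AddSubgroup (FreeAbelianGroup A) :=
  AddSubgroup.closure {r | ∃ X Y Z : A, Nonempty (Z ≅ X ⊞ Y) ∧
    r = FreeAbelianGroup.of Z - FreeAbelianGroup.of X - FreeAbelianGroup.of Y}

/-- The Grothendieck group of an additive category. -/
def K0 : Type u := FreeAbelianGroup A ⧸ K0Relations A

instance : AddCommGroup (K0 A) :=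
  inferInstanceAs (AddCommGroup (FreeAbelianGroup A ⧸ K0Relations A))

variable {A}

/-- The class of an object. -/
def cl (X : A) : K0 A := QuotientAddGroup.mk' (K0Relations A) (FreeAbelianGroup.of X)

theorem cl_of_iso_biprod {X Y Z : A} (e : Z ≅ X ⊞ Y) : cl Z = cl X + cl Y := by
  have h : QuotientAddGroup.mk' (K0Relations A) (FreeAbelianGroup.of Z - FreeAbelianGroup.of X -
      FreeAbelianGroup.of Y) = 0 :=
    (QuotientAddGroup.eq_zero_iff _).2 (AddSubgroup.subset_closure ⟨X, Y, Z, ⟨e⟩, rfl⟩)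
  rw [map_sub, map_sub, sub_sub, sub_eq_zero] at h
  exact h

theorem cl_biprod (X Y : A) : cl (X ⊞ Y) = cl X + cl Y := cl_of_iso_biprod (Iso.refl _)

theorem cl_eq_of_iso {X Y : A} (e : X ≅ Y) : cl X = cl Y := by
  have h : Y ⊞ Y ≅ X ⊞ Y := biprod.mapIso e.symm (Iso.refl Y)
  have h1 := cl_of_iso_biprod h
  rw [cl_biprod] at h1
  exact (add_right_cancel h1).symm

/-- The homomorphism on `K_0` given by a function on objects that is additive on direct sums. -/
def K0.lift {G : Type*} [AddCommGroup G] (f : A → G)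
    (h : ∀ X Y Z : A, Nonempty (Z ≅ X ⊞ Y) → f Z = f X + f Y) : K0 A →+ G :=
  QuotientAddGroup.lift _ (FreeAbelianGroup.lift f) (by
    intro x hx
    induction hx using AddSubgroup.closure_induction with
    | mem x hx =>
      obtain ⟨X, Y, Z, e, rfl⟩ := hx
      simp [h X Y Z e]
    | zero => exact zero_mem _
    | add x y _ _ hx hy => exact add_mem hx hy
    | neg x _ hx => exact neg_mem hx)

@[simp] theorem K0.lift_cl {G : Type*} [AddCommGroup G] (f : A → G)
    (h : ∀ X Y Z : A, Nonempty (Z ≅ X ⊞ Y) → f Z = f X + f Y) (X : A) :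
    K0.lift f h (cl X) = f X :=
  FreeAbelianGroup.lift_apply_of f X

theorem K0.hom_ext {G : Type*} [AddCommGroup G] {f g : K0 A →+ G} (h : ∀ X, f (cl X) = g (cl X)) :
    f = g :=
  QuotientAddGroup.addMonoidHom_ext _ (FreeAbelianGroup.lift_ext _ _ fun X => h X)

theorem K0.induction {p : K0 A → Prop} (x : K0 A) (h0 : ∀ X, p (cl X))
    (hadd : ∀ x y, p x → p y → p (x + y)) (hneg : ∀ x, p x → p (-x)) : p x := by
  obtain ⟨y, rfl⟩ := QuotientAddGroup.mk'_surjective _ x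
  induction y using FreeAbelianGroup.induction_on with
  | zero =>
    have X : A := ⨁ (PEmpty.elim : PEmpty.{1} → A)
    have := hadd _ _ (h0 X) (hneg _ (h0 X))
    rwa [add_neg_cancel] at this
  | of X => exact h0 X
  | neg X h => rw [map_neg]; exact hneg _ h
  | add x y hx hy => rw [map_add]; exact hadd _ _ hx hy

/-- The biadditive map on Grothendieck groups given by a biadditive operation on objects. -/
def K0.lift₂ {B : Type*} [Category* B] [Preadditive B] [HasFiniteBiproducts B]
    {G : Type*} [AddCommGroup G] (f : A → B → G)
    (h₁ : ∀ (X Y Z : A) (W : B), Nonempty (Z ≅ X ⊞ Y) → f Z W = f X W + f Y W)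
    (h₂ : ∀ (W : A) (X Y Z : B), Nonempty (Z ≅ X ⊞ Y) → f W Z = f W X + f W Y) :
    K0 A →+ K0 B →+ G :=
  K0.lift (fun X => K0.lift (f X) (h₂ X)) fun X Y Z e => K0.hom_ext fun W => by
    simp [h₁ X Y Z W e]

@[simp] theorem K0.lift₂_cl {B : Type*} [Category* B] [Preadditive B] [HasFiniteBiproducts B]
    {G : Type*} [AddCommGroup G] (f : A → B → G)
    (h₁ : ∀ (X Y Z : A) (W : B), Nonempty (Z ≅ X ⊞ Y) → f Z W = f X W + f Y W)
    (h₂ : ∀ (W : A) (X Y Z : B), Nonempty (Z ≅ X ⊞ Y) → f W Z = f W X + f W Y) (X : A) (Y : B) :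
    K0.lift₂ f h₁ h₂ (cl X) (cl Y) = f X Y := by
  simp [K0.lift₂]

/-- A function on objects that is the class of an additive functor is additive on direct sums. -/
theorem cl_functor_biprod {B : Type*} [Category* B] [Preadditive B] [HasFiniteBiproducts B]
    (F : A ⥤ B) [F.Additive] (X Y Z : A) (e : Nonempty (Z ≅ X ⊞ Y)) :
    cl (F.obj Z) = cl (F.obj X) + cl (F.obj Y) :=
  haveI := Limits.preservesBinaryBiproducts_of_preservesBiproducts F
  cl_of_iso_biprod (F.mapIso e.some ≪≫ F.mapBiprod X Y)

end GrothendieckGroup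

section GrothendieckRing

variable (A : Type u) [Category.{v} A] [Preadditive A] [HasFiniteBiproducts A]
  [MonoidalCategory A] [MonoidalPreadditive A] [SymmetricCategory A]

/-- The product `[X] [Y] = [X ⊗ Y]` on the Grothendieck group. -/
def K0.mulHom : K0 A →+ K0 A →+ K0 A :=
  K0.lift₂ (fun X Y => cl (X ⊗ Y))
    (fun X Y Z W e => cl_functor_biprod (tensorRight W) X Y Z e)
    (fun W X Y Z e => cl_functor_biprod (tensorLeft W) X Y Z e)

instance : Mul (K0 A) := ⟨fun x y => K0.mulHom A x y⟩

instance : One (K0 A) := ⟨cl (𝟙_ A)⟩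

variable {A}

theorem K0.one_def : (1 : K0 A) = cl (𝟙_ A) := rfl

theorem K0.mul_def (x y : K0 A) : x * y = K0.mulHom A x y := rfl

theorem K0.cl_mul_cl (X Y : A) : cl X * cl Y = cl (X ⊗ Y) := by
  rw [K0.mul_def, K0.mulHom, K0.lift₂_cl]

theorem K0.mul_comm' (x y : K0 A) : x * y = y * x := by
  refine DFunLike.congr_fun (DFunLike.congr_fun (?_ : K0.mulHom A = (K0.mulHom A).flip) x) y
  refine K0.hom_ext fun X => K0.hom_ext fun Y => ?_
  rw [AddMonoidHom.flip_apply, ← K0.mul_def, ← K0.mul_def, K0.cl_mul_cl, K0.cl_mul_cl]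
  exact cl_eq_of_iso (β_ X Y)

theorem K0.add_mul' (x y z : K0 A) : (x + y) * z = x * z + y * z := by
  simp [K0.mul_def]

theorem K0.mul_add' (x y z : K0 A) : x * (y + z) = x * y + x * z := by
  simp [K0.mul_def]

theorem K0.neg_mul' (x y : K0 A) : -x * y = -(x * y) := by
  simp [K0.mul_def]

theorem K0.mul_neg' (x y : K0 A) : x * -y = -(x * y) := by
  simp [K0.mul_def]

theorem K0.mul_assoc' (x y z : K0 A) : x * y * z = x * (y * z) := by
  induction x using K0.induction with
  | hadd a b ha hb => simp only [K0.add_mul', ha, hb]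
  | hneg a ha => simp only [K0.neg_mul', ha]
  | h0 X =>
    induction y using K0.induction with
    | hadd a b ha hb => simp only [K0.mul_add', K0.add_mul', ha, hb]
    | hneg a ha => simp only [K0.mul_neg', K0.neg_mul', ha]
    | h0 Y =>
      induction z using K0.induction with
      | hadd a b ha hb => simp only [K0.mul_add', ha, hb]
      | hneg a ha => simp only [K0.mul_neg', ha]
      | h0 Z =>
        rw [K0.cl_mul_cl, K0.cl_mul_cl, K0.cl_mul_cl, K0.cl_mul_cl]
        exact cl_eq_of_iso (α_ X Y Z)

theorem K0.one_mul' (x : K0 A) : 1 * x = x := by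
  induction x using K0.induction with
  | h0 X => rw [K0.one_def, K0.cl_mul_cl]; exact cl_eq_of_iso (λ_ X)
  | hadd a b ha hb => rw [K0.mul_add', ha, hb]
  | hneg a ha => rw [K0.mul_neg', ha]

/-- The Grothendieck ring of an additive tensor category. -/
instance : CommRing (K0 A) where
  __ := (inferInstance : AddCommGroup (K0 A))
  mul_assoc := K0.mul_assoc'
  one_mul := K0.one_mul'
  mul_one x := by rw [K0.mul_comm', K0.one_mul']
  left_distrib := K0.mul_add'
  right_distrib := K0.add_mul'
  zero_mul x := by simp [K0.mul_def]
  mul_zero x := by simp [K0.mul_def]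
  mul_comm := K0.mul_comm'

end GrothendieckRing

section Induction

/-- The block embedding `Σ_p × Σ_q → Σ_n` for `p + q = n`. -/
def youngEmb {p q n : ℕ} (h : p + q = n) :
    Equiv.Perm (Fin p) × Equiv.Perm (Fin q) →* Equiv.Perm (Fin n) :=
  (finSumFinEquiv.trans (finCongr h)).permCongrHom.toMonoidHom.comp
    (Equiv.Perm.sumCongrHom (Fin p) (Fin q))

/-- The position of a letter of the first block. -/
def blockL {p q n : ℕ} (h : p + q = n) (i : Fin p) : Fin n := ⟨i, by omega⟩

/-- The position of a letter of the second block. -/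
def blockR {p q n : ℕ} (h : p + q = n) (i : Fin q) : Fin n := ⟨p + i, by omega⟩

theorem youngEmb_blockL {p q n : ℕ} (h : p + q = n) (a : Equiv.Perm (Fin p))
    (b : Equiv.Perm (Fin q)) (i : Fin p) : youngEmb h (a, b) (blockL h i) = blockL h (a i) := by
  have e : ∀ i, blockL h i = (finSumFinEquiv.trans (finCongr h)) (Sum.inl i) := fun i => by
    ext; simp [blockL]
  rw [e, e]
  simp [youngEmb, Equiv.permCongrHom, Equiv.permCongr_apply]

theorem youngEmb_blockR {p q n : ℕ} (h : p + q = n) (a : Equiv.Perm (Fin p))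
    (b : Equiv.Perm (Fin q)) (i : Fin q) : youngEmb h (a, b) (blockR h i) = blockR h (b i) := by
  have e : ∀ i, blockR h i = (finSumFinEquiv.trans (finCongr h)) (Sum.inr i) := fun i => by
    ext; simp [blockR]
  rw [e, e]
  simp [youngEmb, Equiv.permCongrHom, Equiv.permCongr_apply]

theorem block_cases {p q n : ℕ} (h : p + q = n) (x : Fin n) :
    (∃ i, x = blockL h i) ∨ ∃ i, x = blockR h i := by
  by_cases hx : (x : ℕ) < p
  · exact Or.inl ⟨⟨x, hx⟩, rfl⟩
  · exact Or.inr ⟨⟨x - p, by omega⟩, by ext; simp [blockR]; omega⟩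

theorem youngEmb_assoc {p q r m l n : ℕ} (h₁ : p + q = m) (h₂ : m + r = n) (h₃ : q + r = l)
    (h₄ : p + l = n) (a : Equiv.Perm (Fin p)) (b : Equiv.Perm (Fin q)) (c : Equiv.Perm (Fin r)) :
    youngEmb h₂ (youngEmb h₁ (a, b), c) = youngEmb h₄ (a, youngEmb h₃ (b, c)) := by
  have eL : ∀ i, blockL h₂ (blockL h₁ i) = blockL h₄ i := fun i => rfl
  have eM : ∀ i, blockL h₂ (blockR h₁ i) = blockR h₄ (blockL h₃ i) := fun i => rfl
  have eR : ∀ i, blockR h₂ i = blockR h₄ (blockR h₃ i) := fun i => by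
    ext; simp [blockR]; omega
  ext1 x
  rcases block_cases h₂ x with ⟨y, rfl⟩ | ⟨z, rfl⟩
  · rcases block_cases h₁ y with ⟨y, rfl⟩ | ⟨z, rfl⟩
    · rw [youngEmb_blockL, youngEmb_blockL, eL, eL, youngEmb_blockL]
    · rw [youngEmb_blockL, youngEmb_blockR, eM, eM, youngEmb_blockR, youngEmb_blockL]
  · rw [youngEmb_blockR, eR, eR, youngEmb_blockR, youngEmb_blockR]

theorem youngEmb_zero {n : ℕ} (h : 0 + n = n) (a : Equiv.Perm (Fin 0)) (b : Equiv.Perm (Fin n)) :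
    youngEmb h (a, b) = b := by
  have e : ∀ i, blockR h i = i := fun i => by ext; simp [blockR]
  ext1 x
  conv_lhs => rw [← e x, youngEmb_blockR, e]

theorem exists_youngEmb_comm {p q n : ℕ} (h : p + q = n) (h' : q + p = n) :
    ∃ τ : Equiv.Perm (Fin n), ∀ a b, youngEmb h (a, b) * τ = τ * youngEmb h' (b, a) := by
  let e := finSumFinEquiv.trans (finCongr h)
  let e' := finSumFinEquiv.trans (finCongr h')
  have hL : ∀ i, e (Sum.inl i) = blockL h i := fun i => by ext; simp [e, blockL]
  have hR : ∀ i, e (Sum.inr i) = blockR h i := fun i => by ext; simp [e, blockR]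
  have hL' : ∀ i, e' (Sum.inl i) = blockL h' i := fun i => by ext; simp [e', blockL]
  have hR' : ∀ i, e' (Sum.inr i) = blockR h' i := fun i => by ext; simp [e', blockR]
  let τ : Equiv.Perm (Fin n) := (e'.symm.trans (Equiv.sumComm _ _)).trans e
  have tL : ∀ i, τ (blockL h' i) = blockR h i := fun i => by rw [← hL', ← hR]; simp [τ]
  have tR : ∀ i, τ (blockR h' i) = blockL h i := fun i => by rw [← hR', ← hL]; simp [τ]
  refine ⟨τ, fun a b => ?_⟩
  ext1 x
  rcases block_cases h' x with ⟨y, rfl⟩ | ⟨z, rfl⟩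
  · rw [Equiv.Perm.mul_apply, Equiv.Perm.mul_apply, tL, youngEmb_blockL, youngEmb_blockR, tL]
  · rw [Equiv.Perm.mul_apply, Equiv.Perm.mul_apply, tR, youngEmb_blockL, youngEmb_blockR, tR]

section Unbundled

variable {p q n : ℕ} (h : p + q = n) {V W : Type} [AddCommGroup V] [Module ℚ V]
  [AddCommGroup W] [Module ℚ W] (ρ : Representation ℚ (Equiv.Perm (Fin p)) V)
  (σ : Representation ℚ (Equiv.Perm (Fin q)) W)

/-- The representation `V ⊗ W` of `Σ_p × Σ_q`. -/
noncomputable def extTensor :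
    Representation ℚ (Equiv.Perm (Fin p) × Equiv.Perm (Fin q)) (V ⊗[ℚ] W) :=
  Representation.tprod (MonoidHom.comp ρ (MonoidHom.fst _ _)) (MonoidHom.comp σ (MonoidHom.snd _ _))

/-- The representation of `Σ_n` induced from the representation `V ⊗ W` of `Σ_p × Σ_q`. -/
noncomputable def indRep : Representation ℚ (Equiv.Perm (Fin n))
    (Representation.IndV (youngEmb h) (extTensor ρ σ)) :=
  Representation.ind (youngEmb h) (extTensor ρ σ)

/-- The universal bilinear map to the induced representation. -/
noncomputable def indMk :
    V →ₗ[ℚ] W →ₗ[ℚ] Representation.IndV (youngEmb h) (extTensor ρ σ) :=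
  (TensorProduct.mk ℚ V W).compr₂ (Representation.IndV.mk (youngEmb h) (extTensor ρ σ) 1)

theorem extTensor_tmul (a : Equiv.Perm (Fin p)) (b : Equiv.Perm (Fin q)) (v : V) (w : W) :
    extTensor ρ σ (a, b) (v ⊗ₜ w) = ρ a v ⊗ₜ σ b w := rfl

theorem indRep_mk (x : Equiv.Perm (Fin n)) (v : V ⊗[ℚ] W) :
    indRep h ρ σ x (Representation.IndV.mk (youngEmb h) (extTensor ρ σ) 1 v) =
      Representation.IndV.mk (youngEmb h) (extTensor ρ σ) x⁻¹ v := by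
  rw [indRep, Representation.ind_mk, one_mul]

theorem indRep_indMk (a : Equiv.Perm (Fin p)) (b : Equiv.Perm (Fin q)) (v : V) (w : W) :
    indRep h ρ σ (youngEmb h (a, b)) (indMk h ρ σ v w) = indMk h ρ σ (ρ a v) (σ b w) := by
  have := Representation.Coinvariants.mk_self_apply
    ((Representation.tprod (MonoidHom.comp (Representation.leftRegular ℚ _) (youngEmb h))
      (extTensor ρ σ)))
    (a, b) ((MonoidAlgebra.single (youngEmb h (a, b))⁻¹ 1) ⊗ₜ (v ⊗ₜ w))
  rw [Representation.tprod_apply, TensorProduct.map_tmul, extTensor_tmul] at this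
  refine (indRep_mk h ρ σ _ _).trans (this.symm.trans ?_)
  simp [indMk]

variable {T : Type} [AddCommGroup T] [Module ℚ T] (θ : Representation ℚ (Equiv.Perm (Fin n)) T)

theorem ind_hom_ext {f g : Representation.IndV (youngEmb h) (extTensor ρ σ) →ₗ[ℚ] T}
    (hf : ∀ x v, f (indRep h ρ σ x v) = θ x (f v)) (hg : ∀ x v, g (indRep h ρ σ x v) = θ x (g v))
    (hfg : ∀ v w, f (indMk h ρ σ v w) = g (indMk h ρ σ v w)) : f = g := by
  refine Representation.IndV.hom_ext _ _ fun x => TensorProduct.ext' fun v w => ?_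
  have e := indRep_mk h ρ σ x⁻¹ (v ⊗ₜ w)
  rw [inv_inv] at e
  change f (Representation.IndV.mk (youngEmb h) (extTensor ρ σ) x (v ⊗ₜ w)) =
    g (Representation.IndV.mk (youngEmb h) (extTensor ρ σ) x (v ⊗ₜ w))
  rw [← e, hf, hg]
  exact congrArg _ (hfg v w)

/-- The universal property of the induced representation. -/
theorem exists_ind_lift (β : V →ₗ[ℚ] W →ₗ[ℚ] T)
    (hβ : ∀ a b v w, β (ρ a v) (σ b w) = θ (youngEmb h (a, b)) (β v w)) :
    ∃ f : Representation.IndV (youngEmb h) (extTensor ρ σ) →ₗ[ℚ] T,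
      (∀ x v, f (indRep h ρ σ x v) = θ x (f v)) ∧ ∀ v w, f (indMk h ρ σ v w) = β v w := by
  let F : Rep.of (extTensor ρ σ) ⟶ Rep.res (youngEmb h) (Rep.of θ) :=
    Rep.ofHom ⟨TensorProduct.lift β, fun g => TensorProduct.ext' fun v w => hβ g.1 g.2 v w⟩
  let f := (Rep.indResHomEquiv (youngEmb h) (Rep.of (extTensor ρ σ)) (Rep.of θ)).symm F
  refine ⟨f.hom.toLinearMap, fun x v => Rep.hom_comm_apply f x v, fun v w => ?_⟩
  have e := (Rep.indResHomEquiv (youngEmb h) (Rep.of (extTensor ρ σ))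
    (Rep.of θ)).apply_symm_apply F
  have e2 := congrArg (fun G => G.hom.toLinearMap (v ⊗ₜ w)) e
  exact e2

end Unbundled
end Induction

section RepresentationRing

section FDRepHom

variable {G : Type} [Group G]

/-- A morphism of finite-dimensional representations, from an equivariant linear map. -/
def repHom {V W : FDRep ℚ G} (f : V →ₗ[ℚ] W) (hf : ∀ g v, f (V.ρ g v) = W.ρ g (f v)) : V ⟶ W :=
  ⟨FGModuleCat.ofHom f, fun g => by ext v; exact hf g v⟩

/-- The linear map underlying a morphism of representations. -/
def repLin {V W : FDRep ℚ G} (f : V ⟶ W) : V →ₗ[ℚ] W := f.hom.hom.hom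

theorem repLin_equivariant {V W : FDRep ℚ G} (f : V ⟶ W) (g : G) (v : V) :
    repLin f (V.ρ g v) = W.ρ g (repLin f v) := by
  have := congrArg (fun k => k.hom.hom v) (f.comm g)
  exact this

theorem repLin_comp {U V W : FDRep ℚ G} (f : U ⟶ V) (g : V ⟶ W) (u : U) :
    repLin (f ≫ g) u = repLin g (repLin f u) := rfl

theorem rep_ext {V W : FDRep ℚ G} {f g : V ⟶ W} (h : repLin f = repLin g) : f = g := by
  ext v
  exact DFunLike.congr_fun h v

theorem repLin_repHom {V W : FDRep ℚ G} (f : V →ₗ[ℚ] W)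
    (hf : ∀ g v, f (V.ρ g v) = W.ρ g (f v)) : repLin (repHom f hf) = f := rfl

theorem repLin_add {V W : FDRep ℚ G} (f g : V ⟶ W) : repLin (f + g) = repLin f + repLin g := rfl

/-- An isomorphism of representations from mutually inverse equivariant linear maps. -/
def repIso {V W : FDRep ℚ G} (f : V →ₗ[ℚ] W) (f' : W →ₗ[ℚ] V)
    (hf : ∀ g v, f (V.ρ g v) = W.ρ g (f v)) (hf' : ∀ g v, f' (W.ρ g v) = V.ρ g (f' v))
    (h : f' ∘ₗ f = LinearMap.id) (h' : f ∘ₗ f' = LinearMap.id) : V ≅ W where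
  hom := repHom f hf
  inv := repHom f' hf'
  hom_inv_id := rep_ext h
  inv_hom_id := rep_ext h'

instance : HasFiniteBiproducts (FDRep ℚ G) := HasFiniteBiproducts.of_hasFiniteProducts

end FDRepHom

/-- `R_n`: the Grothendieck group of the semisimple category of finite-dimensional
representations of `Σ_n` over `ℚ`. -/
def RepGroup (n : ℕ) : Type 1 := K0 (FDRep ℚ (Equiv.Perm (Fin n)))

instance (n : ℕ) : AddCommGroup (RepGroup n) :=
  inferInstanceAs (AddCommGroup (K0 (FDRep ℚ (Equiv.Perm (Fin n)))))

/-- `R = ⨁_n R_n`. -/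
def RepRing : Type 1 := DirectSum ℕ RepGroup

instance : AddCommGroup RepRing := inferInstanceAs (AddCommGroup (DirectSum ℕ RepGroup))

/-- The inclusion of `R_n` into `R`. -/
def RepRing.of (n : ℕ) : K0 (FDRep ℚ (Equiv.Perm (Fin n))) →+ RepRing :=
  DirectSum.of RepGroup n

/-- The homomorphism from `R` given by homomorphisms from the `R_n`. -/
def RepRing.lift {G : Type*} [AddCommGroup G]
    (f : ∀ n : ℕ, K0 (FDRep ℚ (Equiv.Perm (Fin n))) →+ G) : RepRing →+ G :=
  DirectSum.toAddMonoid (β := RepGroup) f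

theorem RepRing.lift_of {G : Type*} [AddCommGroup G]
    (f : ∀ n : ℕ, K0 (FDRep ℚ (Equiv.Perm (Fin n))) →+ G) (n : ℕ)
    (x : K0 (FDRep ℚ (Equiv.Perm (Fin n)))) : RepRing.lift f (RepRing.of n x) = f n x :=
  DirectSum.toAddMonoid_of (β := RepGroup) f n x

/-- The class in `R` of a representation of `Σ_n`. -/
def repCl {n : ℕ} (V : FDRep ℚ (Equiv.Perm (Fin n))) : RepRing :=
  RepRing.of n (cl V)

/-- The representation of `Σ_n` induced from the representation `V ⊗ W` of `Σ_p × Σ_q`, where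
`p + q = n`. -/
def indProd {p q n : ℕ} (h : p + q = n) (V : FDRep ℚ (Equiv.Perm (Fin p)))
    (W : FDRep ℚ (Equiv.Perm (Fin q))) : FDRep ℚ (Equiv.Perm (Fin n)) :=
  FDRep.of (indRep h V.ρ W.ρ)

section IndProd

variable {p q n : ℕ} (h : p + q = n)

theorem indProd_rho (V : FDRep ℚ (Equiv.Perm (Fin p))) (W : FDRep ℚ (Equiv.Perm (Fin q))) :
    (indProd h V W).ρ = indRep h V.ρ W.ρ := rfl

/-- The universal bilinear map. -/
def indι (V : FDRep ℚ (Equiv.Perm (Fin p))) (W : FDRep ℚ (Equiv.Perm (Fin q))) :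
    V →ₗ[ℚ] W →ₗ[ℚ] (indProd h V W) := indMk h V.ρ W.ρ

variable {V : FDRep ℚ (Equiv.Perm (Fin p))} {W : FDRep ℚ (Equiv.Perm (Fin q))}

theorem rho_indι (a : Equiv.Perm (Fin p)) (b : Equiv.Perm (Fin q)) (v : V) (w : W) :
    (indProd h V W).ρ (youngEmb h (a, b)) (indι h V W v w) =
      indι h V W (V.ρ a v) (W.ρ b w) := indRep_indMk h V.ρ W.ρ a b v w

theorem indProd_hom_ext {T : FDRep ℚ (Equiv.Perm (Fin n))} {f g : indProd h V W ⟶ T}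
    (hfg : ∀ v w, repLin f (indι h V W v w) = repLin g (indι h V W v w)) : f = g :=
  rep_ext (ind_hom_ext h V.ρ W.ρ T.ρ (repLin_equivariant f) (repLin_equivariant g) hfg)

theorem exists_indProd_lift {T : FDRep ℚ (Equiv.Perm (Fin n))} (β : V →ₗ[ℚ] W →ₗ[ℚ] T)
    (hβ : ∀ a b v w, β (V.ρ a v) (W.ρ b w) = T.ρ (youngEmb h (a, b)) (β v w)) :
    ∃ f : indProd h V W ⟶ T, ∀ v w, repLin f (indι h V W v w) = β v w := by
  obtain ⟨f, hf, hf'⟩ := exists_ind_lift h V.ρ W.ρ T.ρ β hβ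
  exact ⟨repHom f hf, hf'⟩

theorem exists_indMap {V' : FDRep ℚ (Equiv.Perm (Fin p))} (f : V ⟶ V')
    (W : FDRep ℚ (Equiv.Perm (Fin q))) : ∃ F : indProd h V W ⟶ indProd h V' W,
      ∀ v w, repLin F (indι h V W v w) = indι h V' W (repLin f v) w :=
  exists_indProd_lift h ((indι h V' W).comp (repLin f)) fun a b v w => by
    rw [LinearMap.comp_apply, LinearMap.comp_apply, rho_indι, repLin_equivariant]

/-- Induction as a functor in the first variable. -/
def indFunctorLeft (W : FDRep ℚ (Equiv.Perm (Fin q))) :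
    FDRep ℚ (Equiv.Perm (Fin p)) ⥤ FDRep ℚ (Equiv.Perm (Fin n)) where
  obj V := indProd h V W
  map f := (exists_indMap h f W).choose
  map_id V := indProd_hom_ext h fun v w => (exists_indMap h (𝟙 V) W).choose_spec v w
  map_comp {U V T} f g := indProd_hom_ext h fun v w => by
    rw [(exists_indMap h (f ≫ g) W).choose_spec, repLin_comp, repLin_comp,
      (exists_indMap h f W).choose_spec, (exists_indMap h g W).choose_spec]

instance (W : FDRep ℚ (Equiv.Perm (Fin q))) : (indFunctorLeft h W).Additive where
  map_add {U V f g} := indProd_hom_ext h fun v w => by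
    refine ((exists_indMap h (f + g) W).choose_spec v w).trans ?_
    rw [repLin_add, LinearMap.add_apply, map_add, LinearMap.add_apply]
    exact (congrArg₂ (· + ·) ((exists_indMap h f W).choose_spec v w)
      ((exists_indMap h g W).choose_spec v w)).symm

theorem cl_indProd_comm (h' : q + p = n) (V : FDRep ℚ (Equiv.Perm (Fin p)))
    (W : FDRep ℚ (Equiv.Perm (Fin q))) : cl (indProd h V W) = cl (indProd h' W V) := by
  obtain ⟨τ, hτ⟩ := exists_youngEmb_comm h h'
  obtain ⟨f, hf⟩ := exists_indProd_lift h (V := V) (W := W) (T := indProd h' W V)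
    ((indι h' W V).flip.compr₂ ((indProd h' W V).ρ τ)) (fun a b v w => by
      simp only [LinearMap.compr₂_apply, LinearMap.flip_apply]
      rw [← rho_indι, ← Module.End.mul_apply, ← Module.End.mul_apply, ← map_mul, ← map_mul, hτ])
  have hτ' : ∀ a b, youngEmb h' (b, a) * τ⁻¹ = τ⁻¹ * youngEmb h (a, b) := fun a b => by
    rw [mul_inv_eq_iff_eq_mul, mul_assoc, hτ, inv_mul_cancel_left]
  obtain ⟨g, hg⟩ := exists_indProd_lift h' (V := W) (W := V) (T := indProd h V W)
    ((indι h V W).flip.compr₂ ((indProd h V W).ρ τ⁻¹)) (fun a b v w => by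
      simp only [LinearMap.compr₂_apply, LinearMap.flip_apply]
      rw [← rho_indι, ← Module.End.mul_apply, ← Module.End.mul_apply, ← map_mul, ← map_mul, hτ'])
  refine cl_eq_of_iso ⟨f, g, indProd_hom_ext h fun v w => ?_, indProd_hom_ext h' fun v w => ?_⟩
  · rw [repLin_comp, hf, LinearMap.compr₂_apply, repLin_equivariant, LinearMap.flip_apply, hg,
      LinearMap.compr₂_apply, LinearMap.flip_apply, ← Module.End.mul_apply, ← map_mul,
      mul_inv_cancel, map_one]
    rfl
  · rw [repLin_comp, hg, LinearMap.compr₂_apply, repLin_equivariant, LinearMap.flip_apply, hf,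
      LinearMap.compr₂_apply, LinearMap.flip_apply, ← Module.End.mul_apply, ← map_mul,
      inv_mul_cancel, map_one]
    rfl

/-- The universal property of induction, with a further representation as parameter. -/
theorem exists_indProd_lift_param {r m n : ℕ} (h : p + q = m)
    (j : Equiv.Perm (Fin m) →* Equiv.Perm (Fin n)) (k : Equiv.Perm (Fin r) →* Equiv.Perm (Fin n))
    (hjk : ∀ x c, k c * j x = j x * k c) {P : FDRep ℚ (Equiv.Perm (Fin r))}
    {T : FDRep ℚ (Equiv.Perm (Fin n))} (γ : P →ₗ[ℚ] V →ₗ[ℚ] W →ₗ[ℚ] T)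
    (hγ : ∀ c a b w u v, γ (P.ρ c w) (V.ρ a u) (W.ρ b v) =
      T.ρ (j (youngEmb h (a, b)) * k c) (γ w u v)) :
    ∃ Γ : P →ₗ[ℚ] (indProd h V W) →ₗ[ℚ] T,
      (∀ c x w y, Γ (P.ρ c w) ((indProd h V W).ρ x y) = T.ρ (j x * k c) (Γ w y)) ∧
      ∀ w u v, Γ w (indι h V W u v) = γ w u v := by
  let θ : Representation ℚ (Equiv.Perm (Fin m)) T := MonoidHom.comp T.ρ j
  have hθ : ∀ x y, θ x y = T.ρ (j x) y := fun _ _ => rfl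
  have key := fun w : P => exists_ind_lift h V.ρ W.ρ θ (γ w) (fun a b u v => by
    have := hγ 1 a b w u v
    rw [map_one, map_one, mul_one] at this
    exact this)
  choose Γ hΓ hΓ' using key
  have hadd : ∀ w w', Γ (w + w') = Γ w + Γ w' := fun w w' =>
    ind_hom_ext h V.ρ W.ρ θ (hΓ _) (fun x y => by
      rw [LinearMap.add_apply, LinearMap.add_apply, hΓ, hΓ, map_add]) fun u v => by
      rw [LinearMap.add_apply, hΓ', hΓ', hΓ', map_add, LinearMap.add_apply, LinearMap.add_apply]
  have hsmul : ∀ (s : ℚ) w, Γ (s • w) = s • Γ w := fun s w =>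
    ind_hom_ext h V.ρ W.ρ θ (hΓ _) (fun x y => by
      rw [LinearMap.smul_apply, LinearMap.smul_apply, hΓ, map_smul]) fun u v => by
      rw [LinearMap.smul_apply, hΓ', hΓ', map_smul, LinearMap.smul_apply, LinearMap.smul_apply]
  refine ⟨⟨⟨Γ, hadd⟩, hsmul⟩, fun c x w y => ?_, hΓ'⟩
  have e : Γ (P.ρ c w) = (T.ρ (k c)).comp (Γ w) :=
    ind_hom_ext h V.ρ W.ρ θ (hΓ _) (fun x y => by
      rw [LinearMap.comp_apply, LinearMap.comp_apply, hΓ, hθ, hθ, ← Module.End.mul_apply,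
        ← Module.End.mul_apply, ← map_mul, ← map_mul, hjk]) fun u v => by
      have := hγ c 1 1 w u v
      rw [map_one, map_one, ← Prod.one_eq_mk, map_one, map_one, one_mul] at this
      rw [LinearMap.comp_apply, hΓ', hΓ']
      exact this
  refine (hΓ (P.ρ c w) x y).trans ?_
  rw [e, hθ, map_mul]
  rfl

theorem cl_indProd_assoc {r m l n : ℕ} (h₁ : p + q = m) (h₂ : m + r = n) (h₃ : q + r = l)
    (h₄ : p + l = n) (U : FDRep ℚ (Equiv.Perm (Fin p))) (V : FDRep ℚ (Equiv.Perm (Fin q)))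
    (W : FDRep ℚ (Equiv.Perm (Fin r))) :
    cl (indProd h₂ (indProd h₁ U V) W) = cl (indProd h₄ U (indProd h₃ V W)) := by
  have hsplit : ∀ {a b c : ℕ} (h : a + b = c) (x : Equiv.Perm (Fin a)) (y : Equiv.Perm (Fin b)),
      youngEmb h (x, 1) * youngEmb h (1, y) = youngEmb h (x, y) := fun h x y => by
    rw [← map_mul, Prod.mk_mul_mk, mul_one, one_mul]
  have hsplit' : ∀ {a b c : ℕ} (h : a + b = c) (x : Equiv.Perm (Fin a)) (y : Equiv.Perm (Fin b)),
      youngEmb h (1, y) * youngEmb h (x, 1) = youngEmb h (x, y) := fun h x y => by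
    rw [← map_mul, Prod.mk_mul_mk, mul_one, one_mul]
  let T := indProd h₄ U (indProd h₃ V W)
  let T' := indProd h₂ (indProd h₁ U V) W
  let γ : W →ₗ[ℚ] U →ₗ[ℚ] V →ₗ[ℚ] T :=
    { toFun := fun w => (indι h₄ U (indProd h₃ V W)).compl₂ ((indι h₃ V W).flip w)
      map_add' := fun w w' => LinearMap.ext₂ fun u v => by
        simp only [LinearMap.compl₂_apply, LinearMap.add_apply, map_add]
      map_smul' := fun s w => LinearMap.ext₂ fun u v => by
        simp only [LinearMap.compl₂_apply, LinearMap.smul_apply, map_smul, RingHom.id_apply] }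
  have hγ : ∀ w u v, γ w u v = indι h₄ U (indProd h₃ V W) u (indι h₃ V W v w) :=
    fun _ _ _ => rfl
  let γ' : U →ₗ[ℚ] V →ₗ[ℚ] W →ₗ[ℚ] T' :=
    { toFun := fun u => (indι h₂ (indProd h₁ U V) W).comp (indι h₁ U V u)
      map_add' := fun w w' => LinearMap.ext₂ fun u v => by
        simp only [LinearMap.comp_apply, LinearMap.add_apply, map_add]
      map_smul' := fun s w => LinearMap.ext₂ fun u v => by
        simp only [LinearMap.comp_apply, LinearMap.smul_apply, map_smul, RingHom.id_apply] }
  have hγ' : ∀ u v w, γ' u v w = indι h₂ (indProd h₁ U V) W (indι h₁ U V u v) w :=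
    fun _ _ _ => rfl
  obtain ⟨Γ, hΓ, hΓι⟩ := exists_indProd_lift_param h₁ (V := U) (W := V) (P := W) (T := T)
    ((youngEmb h₂).comp (MonoidHom.inl _ _)) ((youngEmb h₂).comp (MonoidHom.inr _ _))
    (fun x c => (hsplit' h₂ x c).trans (hsplit h₂ x c).symm) γ
    (fun c a b w u v => by
      rw [hγ, hγ, ← rho_indι, ← rho_indι, ← youngEmb_assoc h₁ h₂ h₃ h₄]
      exact congrArg (fun g => T.ρ g _) (hsplit h₂ _ c).symm)
  obtain ⟨Γ', hΓ', hΓι'⟩ := exists_indProd_lift_param h₃ (V := V) (W := W) (P := U) (T := T')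
    ((youngEmb h₄).comp (MonoidHom.inr _ _)) ((youngEmb h₄).comp (MonoidHom.inl _ _))
    (fun x c => (hsplit h₄ c x).trans (hsplit' h₄ c x).symm) γ'
    (fun c a b w u v => by
      rw [hγ', hγ', ← rho_indι, ← rho_indι, youngEmb_assoc h₁ h₂ h₃ h₄]
      exact congrArg (fun g => T'.ρ g _) (hsplit' h₄ c _).symm)
  obtain ⟨f, hf⟩ := exists_indProd_lift h₂ (V := indProd h₁ U V) (W := W) (T := T) Γ.flip
    (fun x c y w => (hΓ c x w y).trans (congrArg (fun g => T.ρ g _) (hsplit h₂ x c)))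
  obtain ⟨f', hf'⟩ := exists_indProd_lift h₄ (V := U) (W := indProd h₃ V W) (T := T') Γ'
    (fun c x u y => (hΓ' c x u y).trans (congrArg (fun g => T'.ρ g _) (hsplit' h₄ c x)))
  have hff : ∀ u v w, repLin f (indι h₂ (indProd h₁ U V) W (indι h₁ U V u v) w) =
      indι h₄ U (indProd h₃ V W) u (indι h₃ V W v w) := fun u v w =>
    (hf _ _).trans (hΓι w u v)
  have hff' : ∀ u v w, repLin f' (indι h₄ U (indProd h₃ V W) u (indι h₃ V W v w)) =
      indι h₂ (indProd h₁ U V) W (indι h₁ U V u v) w := fun u v w =>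
    (hf' _ _).trans (hΓι' u v w)
  have hT' : ∀ k : T' ⟶ T', (∀ u v w,
      repLin k (indι h₂ (indProd h₁ U V) W (indι h₁ U V u v) w) =
        indι h₂ (indProd h₁ U V) W (indι h₁ U V u v) w) → k = 𝟙 _ := by
    intro k hk
    refine indProd_hom_ext h₂ fun y w => ?_
    let θ : Representation ℚ (Equiv.Perm (Fin m)) T' :=
      MonoidHom.comp T'.ρ ((youngEmb h₂).comp (MonoidHom.inl _ _))
    have hθ : ∀ x y, indι h₂ (indProd h₁ U V) W ((indProd h₁ U V).ρ x y) w =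
        θ x (indι h₂ (indProd h₁ U V) W y w) := fun x y => by
      have := rho_indι h₂ (V := indProd h₁ U V) (W := W) x 1 y w
      rw [map_one] at this
      exact this.symm
    have e := ind_hom_ext h₁ U.ρ V.ρ θ
      (f := (repLin k).comp ((indι h₂ (indProd h₁ U V) W).flip w))
      (g := (indι h₂ (indProd h₁ U V) W).flip w)
      (fun x y => (congrArg (repLin k) (hθ x y)).trans (repLin_equivariant k _ _))
      (fun x y => hθ x y) (fun u v => hk u v w)
    exact DFunLike.congr_fun e y
  have hT : ∀ k : T ⟶ T, (∀ u v w,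
      repLin k (indι h₄ U (indProd h₃ V W) u (indι h₃ V W v w)) =
        indι h₄ U (indProd h₃ V W) u (indι h₃ V W v w)) → k = 𝟙 _ := by
    intro k hk
    refine indProd_hom_ext h₄ fun u y => ?_
    let θ : Representation ℚ (Equiv.Perm (Fin l)) T :=
      MonoidHom.comp T.ρ ((youngEmb h₄).comp (MonoidHom.inr _ _))
    have hθ : ∀ x y, indι h₄ U (indProd h₃ V W) u ((indProd h₃ V W).ρ x y) =
        θ x (indι h₄ U (indProd h₃ V W) u y) := fun x y => by
      have := rho_indι h₄ (V := U) (W := indProd h₃ V W) 1 x u y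
      rw [map_one] at this
      exact this.symm
    have e := ind_hom_ext h₃ V.ρ W.ρ θ
      (f := (repLin k).comp (indι h₄ U (indProd h₃ V W) u))
      (g := indι h₄ U (indProd h₃ V W) u)
      (fun x y => (congrArg (repLin k) (hθ x y)).trans (repLin_equivariant k _ _))
      (fun x y => hθ x y) (fun v w => hk u v w)
    exact DFunLike.congr_fun e y
  exact cl_eq_of_iso ⟨f, f', hT' _ fun u v w => by rw [repLin_comp, hff, hff'],
    hT _ fun u v w => by rw [repLin_comp, hff', hff]⟩

theorem cl_indProd_one (h : 0 + n = n) (V : FDRep ℚ (Equiv.Perm (Fin n))) :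
    cl (indProd h (FDRep.of (Representation.trivial ℚ (Equiv.Perm (Fin 0)) ℚ)) V) = cl V := by
  have hid : ∀ (a : Equiv.Perm (Fin 0)) (b : Equiv.Perm (Fin n)), youngEmb h (a, b) = b :=
    youngEmb_zero h
  let I := FDRep.of (Representation.trivial ℚ (Equiv.Perm (Fin 0)) ℚ)
  obtain ⟨f, hf⟩ := exists_indProd_lift h (V := I) (W := V) (T := V)
    (LinearMap.lsmul ℚ V) (fun a b v w => by
      rw [hid]
      exact (map_smul (V.ρ b) v w).symm)
  let g : V ⟶ indProd h I V := repHom (indι h I V (1 : ℚ)) fun b v => by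
    have := rho_indι h (V := I) (W := V) 1 b (1 : ℚ) v
    rw [hid] at this
    exact this.symm
  refine cl_eq_of_iso ⟨f, g, indProd_hom_ext h fun v w => ?_, rep_ext (LinearMap.ext fun w => ?_)⟩
  · rw [repLin_comp, hf]
    change indι h I V (1 : ℚ) ((v : ℚ) • w) = indι h I V v w
    rw [map_smul, ← LinearMap.smul_apply, ← map_smul]
    congr 2
    exact mul_one (v : ℚ)
  · rw [repLin_comp]
    refine (hf (1 : ℚ) w).trans ?_
    exact one_smul ℚ w

end IndProd


/-- The product of classes of representations, `[V] [W] = [Ind (V ⊗ W)]`. -/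
def repMulHom (p q : ℕ) : K0 (FDRep ℚ (Equiv.Perm (Fin p))) →+
    K0 (FDRep ℚ (Equiv.Perm (Fin q))) →+ RepRing :=
  K0.lift₂ (fun V W => repCl (indProd (rfl : p + q = p + q) V W))
    (fun X Y Z W e => by
      rw [repCl, repCl, repCl, ← map_add]
      exact congrArg (RepRing.of _) (cl_functor_biprod (indFunctorLeft rfl W) X Y Z e))
    (fun W X Y Z e => by
      rw [repCl, repCl, repCl, ← map_add]
      rw [cl_indProd_comm rfl (Nat.add_comm q p) W Z, cl_indProd_comm rfl (Nat.add_comm q p) W X,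
        cl_indProd_comm rfl (Nat.add_comm q p) W Y]
      exact congrArg (RepRing.of _) (cl_functor_biprod (indFunctorLeft (Nat.add_comm q p) W) X Y Z e))

/-- The product of `R`, extended biadditively from the classes of representations. -/
def RepRing.mulHom : RepRing →+ RepRing →+ RepRing :=
  RepRing.lift fun p => (RepRing.lift fun q => (repMulHom p q).flip).flip

instance : Mul RepRing := ⟨fun x y => RepRing.mulHom x y⟩

instance : One RepRing := ⟨repCl (FDRep.of (Representation.trivial ℚ (Equiv.Perm (Fin 0)) ℚ))⟩

theorem RepRing.one_def :
    (1 : RepRing) = repCl (FDRep.of (Representation.trivial ℚ (Equiv.Perm (Fin 0)) ℚ)) := rfl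

theorem RepRing.mul_def (x y : RepRing) : x * y = RepRing.mulHom x y := rfl

theorem repCl_mul_repCl {p q n : ℕ} (h : p + q = n) (V : FDRep ℚ (Equiv.Perm (Fin p)))
    (W : FDRep ℚ (Equiv.Perm (Fin q))) : repCl V * repCl W = repCl (indProd h V W) := by
  subst h
  rw [RepRing.mul_def, RepRing.mulHom, repCl, repCl]
  rw [RepRing.lift_of, AddMonoidHom.flip_apply, RepRing.lift_of, AddMonoidHom.flip_apply,
    repMulHom, K0.lift₂_cl]

theorem RepRing.induction {P : RepRing → Prop} (x : RepRing)
    (h0 : ∀ (n : ℕ) (V : FDRep ℚ (Equiv.Perm (Fin n))), P (repCl V))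
    (hadd : ∀ x y, P x → P y → P (x + y)) (hneg : ∀ x, P x → P (-x)) : P x := by
  induction x using DirectSum.induction_on with
  | zero =>
    have := hadd _ _ (h0 0 (FDRep.of (Representation.trivial ℚ _ ℚ)))
      (hneg _ (h0 0 (FDRep.of (Representation.trivial ℚ _ ℚ))))
    rwa [add_neg_cancel] at this
  | of n x =>
    refine K0.induction (p := fun x => P (RepRing.of n x)) x (h0 n)
      (fun x y hx hy => ?_) (fun x hx => ?_)
    · rw [map_add]; exact hadd _ _ hx hy
    · rw [map_neg]; exact hneg _ hx
  | add x y hx hy => exact hadd _ _ hx hy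

theorem RepRing.add_mul' (x y z : RepRing) : (x + y) * z = x * z + y * z := by
  simp [RepRing.mul_def]

theorem RepRing.mul_add' (x y z : RepRing) : x * (y + z) = x * y + x * z := by
  simp [RepRing.mul_def]

theorem RepRing.neg_mul' (x y : RepRing) : -x * y = -(x * y) := by
  simp [RepRing.mul_def]

theorem RepRing.mul_neg' (x y : RepRing) : x * -y = -(x * y) := by
  simp [RepRing.mul_def]

theorem RepRing.mul_comm' (x y : RepRing) : x * y = y * x := by
  induction x using RepRing.induction with
  | hadd a b ha hb => simp only [RepRing.add_mul', RepRing.mul_add', ha, hb]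
  | hneg a ha => simp only [RepRing.neg_mul', RepRing.mul_neg', ha]
  | h0 p V =>
    induction y using RepRing.induction with
    | hadd a b ha hb => simp only [RepRing.add_mul', RepRing.mul_add', ha, hb]
    | hneg a ha => simp only [RepRing.neg_mul', RepRing.mul_neg', ha]
    | h0 q W =>
      rw [repCl_mul_repCl rfl, repCl_mul_repCl (Nat.add_comm q p)]
      exact congrArg (RepRing.of _) (cl_indProd_comm _ _ V W)

theorem RepRing.mul_assoc' (x y z : RepRing) : x * y * z = x * (y * z) := by
  induction x using RepRing.induction with
  | hadd a b ha hb => simp only [RepRing.add_mul', ha, hb]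
  | hneg a ha => simp only [RepRing.neg_mul', ha]
  | h0 p U =>
    induction y using RepRing.induction with
    | hadd a b ha hb => simp only [RepRing.mul_add', RepRing.add_mul', ha, hb]
    | hneg a ha => simp only [RepRing.mul_neg', RepRing.neg_mul', ha]
    | h0 q V =>
      induction z using RepRing.induction with
      | hadd a b ha hb => simp only [RepRing.mul_add', ha, hb]
      | hneg a ha => simp only [RepRing.mul_neg', ha]
      | h0 r W =>
        rw [repCl_mul_repCl rfl, repCl_mul_repCl rfl, repCl_mul_repCl rfl,
          repCl_mul_repCl (Nat.add_assoc p q r).symm]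
        exact congrArg (RepRing.of _) (cl_indProd_assoc _ _ _ _ U V W)

theorem RepRing.one_mul' (x : RepRing) : 1 * x = x := by
  induction x using RepRing.induction with
  | hadd a b ha hb => rw [RepRing.mul_add', ha, hb]
  | hneg a ha => rw [RepRing.mul_neg', ha]
  | h0 n V =>
    rw [RepRing.one_def, repCl_mul_repCl (Nat.zero_add n)]
    exact congrArg (RepRing.of _) (cl_indProd_one _ V)

/-- The ring of representations of the symmetric groups. -/
instance : CommRing RepRing where
  __ := (inferInstance : AddCommGroup RepRing)
  mul_assoc := RepRing.mul_assoc'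
  one_mul := RepRing.one_mul'
  mul_one x := by rw [RepRing.mul_comm', RepRing.one_mul']
  left_distrib := RepRing.mul_add'
  right_distrib := RepRing.add_mul'
  zero_mul x := by simp [RepRing.mul_def]
  mul_zero x := by simp [RepRing.mul_def]
  mul_comm := RepRing.mul_comm'

end RepresentationRing

section Specht

variable {n : ℕ}

/-- The group algebra `ℚ Σ_n`. -/
abbrev PermAlg (n : ℕ) : Type := MonoidAlgebra ℚ (Equiv.Perm (Fin n))

/-- The row lengths of the Young diagram of a partition, in decreasing order. -/
def rowLengths (μ : n.Partition) : List ℕ := μ.parts.sort (· ≥ ·)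

theorem sum_rowLengths (μ : n.Partition) :
    ∑ i : Fin (rowLengths μ).length, (rowLengths μ).get i = n := by
  have h : (rowLengths μ).sum = n := by
    rw [← Multiset.sum_coe, rowLengths, Multiset.sort_eq, μ.parts_sum]
  conv_rhs => rw [← h]
  exact Fin.sum_univ_getElem (rowLengths μ)

/-- The tableau of shape `μ` whose boxes are numbered row by row: the box (row and column) that
carries a given number. -/
def tableau (μ : n.Partition) :
    Fin n ≃ Σ i : Fin (rowLengths μ).length, Fin ((rowLengths μ).get i) :=
  (finCongr (sum_rowLengths μ).symm).trans finSigmaFinEquiv.symm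

/-- The index of the row of the tableau that contains `x`. -/
def tableauRow (μ : n.Partition) (x : Fin n) : ℕ := (tableau μ x).1

/-- The index of the column of the tableau that contains `x`. -/
def tableauCol (μ : n.Partition) (x : Fin n) : ℕ := (tableau μ x).2

open Classical in
/-- The sum of the permutations that preserve the rows of the tableau. -/
def rowSymmetrizer (μ : n.Partition) : PermAlg n :=
  ∑ σ : Equiv.Perm (Fin n) with ∀ x, tableauRow μ (σ x) = tableauRow μ x,
    MonoidAlgebra.single σ (1 : ℚ)

open Classical in
/-- The signed sum of the permutations that preserve the columns of the tableau. -/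
def colAntisymmetrizer (μ : n.Partition) : PermAlg n :=
  ∑ σ : Equiv.Perm (Fin n) with ∀ x, tableauCol μ (σ x) = tableauCol μ x,
    MonoidAlgebra.single σ ((Equiv.Perm.sign σ : ℤ) : ℚ)

/-- The Young symmetrizer of a partition. -/
def youngSymmetrizer (μ : n.Partition) : PermAlg n := rowSymmetrizer μ * colAntisymmetrizer μ

/-- The left ideal of `ℚ Σ_n` generated by the Young symmetrizer. -/
def spechtIdeal (μ : n.Partition) : Ideal (PermAlg n) := Ideal.span {youngSymmetrizer μ}

/-- The action of `Σ_n` on a left ideal of `ℚ Σ_n` by multiplication. -/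
def idealRep (I : Ideal (PermAlg n)) : Representation ℚ (Equiv.Perm (Fin n)) I where
  toFun g :=
    { toFun := fun x => ⟨MonoidAlgebra.single g 1 * (x : PermAlg n), I.mul_mem_left _ x.2⟩
      map_add' := fun x y => Subtype.ext (mul_add _ _ _)
      map_smul' := fun s x => Subtype.ext (mul_smul_comm s _ _) }
  map_one' := LinearMap.ext fun x => Subtype.ext (one_mul (x : PermAlg n))
  map_mul' g g' := LinearMap.ext fun x => Subtype.ext (by
    change MonoidAlgebra.single (g * g') 1 * (x : PermAlg n) =
      MonoidAlgebra.single g 1 * (MonoidAlgebra.single g' 1 * (x : PermAlg n))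
    rw [← mul_assoc, MonoidAlgebra.single_mul_single, one_mul])

instance (I : Ideal (PermAlg n)) : Module.Finite ℚ I :=
  inferInstanceAs (Module.Finite ℚ (I.restrictScalars ℚ))

/-- The irreducible representation `V_μ` of `Σ_n` over `ℚ` that belongs to a partition `μ` of `n`
(`V_(n)` is the trivial representation). -/
def specht (μ : n.Partition) : FDRep ℚ (Equiv.Perm (Fin n)) := FDRep.of (idealRep (spechtIdeal μ))

theorem exists_schurIdempotent (μ : n.Partition) :
    ∃ e : PermAlg n, IsIdempotentElem e ∧ spechtIdeal μ = Ideal.span {e} :=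
  IsSemisimpleRing.ideal_eq_span_idempotent _

/-- An idempotent `e` of `ℚ Σ_n` with `V_μ = ℚ Σ_n e`. -/
def schurIdempotent (μ : n.Partition) : PermAlg n := (exists_schurIdempotent μ).choose

theorem schurIdempotent_mul_self (μ : n.Partition) :
    schurIdempotent μ * schurIdempotent μ = schurIdempotent μ :=
  (exists_schurIdempotent μ).choose_spec.1

theorem spechtIdeal_eq (μ : n.Partition) : spechtIdeal μ = Ideal.span {schurIdempotent μ} :=
  (exists_schurIdempotent μ).choose_spec.2

/-- The Littlewood–Richardson coefficient `c^π_{μ,η}`: the multiplicity of `V_π` in the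
representation of `Σ_n` induced from the representation `V_μ ⊗ V_η` of `Σ_p × Σ_q`. -/
def lrCoeff {p q n : ℕ} (h : p + q = n) (μ : p.Partition) (η : q.Partition) (π : n.Partition) : ℕ :=
  Module.finrank ℚ (specht π ⟶ indProd h (specht μ) (specht η))

end Specht

section SchurFunctor

variable {A : Type u} [Category.{v} A] [Preadditive A] [Linear ℚ A] [IsIdempotentComplete A]

/-- The action of the group algebra on an object with an action of `Σ_n`. -/
def permAlgAction {n : ℕ} {M : A} (ξ : Equiv.Perm (Fin n) →* End M) : PermAlg n →ₐ[ℚ] End M :=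
  MonoidAlgebra.lift ℚ (End M) (Equiv.Perm (Fin n)) ξ

theorem exists_schurImage {n : ℕ} {M : A} (ξ : Equiv.Perm (Fin n) →* End M) (μ : n.Partition) :
    ∃ (S : A) (i : S ⟶ M) (e : M ⟶ S),
      i ≫ e = 𝟙 S ∧ e ≫ i = permAlgAction ξ (schurIdempotent μ) :=
  IsIdempotentComplete.idempotents_split M (permAlgAction ξ (schurIdempotent μ)) (by
    have h := map_mul (permAlgAction ξ) (schurIdempotent μ) (schurIdempotent μ)
    rw [schurIdempotent_mul_self] at h
    exact h.symm)

/-- The image of the idempotent of a partition `μ` on an object with an action of `Σ_n`. -/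
def schurImage {n : ℕ} {M : A} (ξ : Equiv.Perm (Fin n) →* End M) (μ : n.Partition) : A :=
  (exists_schurImage ξ μ).choose

theorem schurImage_spec {n : ℕ} {M : A} (ξ : Equiv.Perm (Fin n) →* End M) (μ : n.Partition) :
    ∃ (i : schurImage ξ μ ⟶ M) (e : M ⟶ schurImage ξ μ),
      i ≫ e = 𝟙 _ ∧ e ≫ i = permAlgAction ξ (schurIdempotent μ) :=
  (exists_schurImage ξ μ).choose_spec

variable [MonoidalCategory A] [SymmetricCategory A]

/-- The Schur functor `S_μ` on objects. -/
def schurObj {n : ℕ} (μ : n.Partition) (X : A) : A := schurImage (tensorPowAction X n) μ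

end SchurFunctor

section LambdaSigma

/-- The multiplicative group `1 + t S[[t]]` of a commutative ring `S`. -/
def oneUnits (S : Type*) [CommRing S] : Subgroup (PowerSeries S)ˣ :=
  (Units.map (PowerSeries.constantCoeff (R := S)).toMonoidHom).ker

variable {A : Type u} [Category.{v} A] [Preadditive A] [Linear ℚ A] [HasFiniteBiproducts A]
  [IsIdempotentComplete A] [MonoidalCategory A] [MonoidalPreadditive A] [SymmetricCategory A]

/-- `λ_Σ(X) = ∑_μ [S_μ X] ⊗ [V_μ] t^{|μ|}`. -/
def lambdaSigma (X : A) : PowerSeries (K0 A ⊗[ℤ] RepRing) :=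
  PowerSeries.mk fun n => ∑ μ : n.Partition, cl (schurObj μ X) ⊗ₜ[ℤ] repCl (specht μ)

end LambdaSigma

end

end GLR

/-! Both decompositions are computed inside group algebras. The idempotents `schurIdempotent μ` form
a complete system for ℚΣ_n: they are nonzero, distinct ones are orthogonal in the strong sense e_μ x
e_ν = 0, each corner e_μ ℚΣ_n e_μ is the line ℚ e_μ, and together they generate the unit two-sided
ideal (`isCompleteSystem_schurIdempotent`). The vanishing and scalar properties come from the
combinatorics of row and column groups. Fullness comes from counting: the space of trace functionals
has dimension at most the number of conjugacy classes, so a trace functional vanishing at every e_μ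
is zero, and the character of the quotient by the generated ideal is such a functional.

The coefficient at the unit is a nondegenerate trace form, so it pairs e ℚG f perfectly with f ℚG e.
Dual bases v, w of these corners, with f taken from a complete system of a subgroup H, decompose the
restriction of ℚG e to H (`IsCompleteSystem.exists_restriction`). For H = G this decomposes the left
ideal ℚG e itself. The representation induced from V_μ ⊗ V_η is the left ideal generated by the
image of e_μ ⊗ e_η, so the Littlewood–Richardson coefficients are dimensions of corners
(`lrCoeff_eq`), and the second claim follows.

For the third claim, (X ⊞ Y)^{⊗n} splits over words in two letters. Compressing the action of x ∈
ℚΣ_n to the block X^{⊗p} ⊗ Y^{⊗q} keeps only the part of x supported on Σ_p × Σ_q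
(`blockIncl_powAct_blockProj`). The algebraic identities for v and w thus become the identities of a
direct sum of objects S_μ X ⊗ S_η Y with image S_π(X ⊞ Y) (`nonempty_schurObj_biprod_iso`).

The two decompositions have the same structure constants, which makes λ_Σ multiplicative on direct
sums. Its linear coefficient is cl(X) ⊗ cl(V_(1)), and taking dimensions in R recovers cl(X); this
is a left inverse, hence injectivity (`exists_lambdaSigma_hom`). -/

namespace GLR

noncomputable section

/-! ### Perfect pairings and dual bases. -/

section DualBases

variable {K U V : Type*} [Field K] [AddCommGroup U] [Module K U] [AddCommGroup V] [Module K V]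
  [FiniteDimensional K U] [FiniteDimensional K V]

/-- Nondegeneracy on each side embeds each space into the dual of the other. -/
theorem finrank_eq_of_separating (P : U →ₗ[K] V →ₗ[K] K) (h₁ : ∀ u, (∀ v, P u v = 0) → u = 0)
    (h₂ : ∀ v, (∀ u, P u v = 0) → v = 0) : Module.finrank K U = Module.finrank K V := by
  apply le_antisymm
  · rw [← Subspace.dual_finrank_eq (V := V)]
    exact LinearMap.finrank_le_finrank_of_injective (f := P)
      ((injective_iff_map_eq_zero P).2 fun u hu => h₁ u fun v => by rw [hu]; rfl)
  · rw [← Subspace.dual_finrank_eq (V := U)]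
    exact LinearMap.finrank_le_finrank_of_injective (f := P.flip)
      ((injective_iff_map_eq_zero _).2 fun v hv => h₂ v fun u => DFunLike.congr_fun hv u)

/-- A perfect pairing identifies V with the dual of U; the family v is the dual basis of w
transported along this identification. -/
theorem exists_dual_bases (P : U →ₗ[K] V →ₗ[K] K) (h₁ : ∀ u, (∀ v, P u v = 0) → u = 0)
    (h₂ : ∀ v, (∀ u, P u v = 0) → v = 0) :
    ∃ (w : Fin (Module.finrank K U) → U) (v : Fin (Module.finrank K U) → V),
      (∀ a b, P (w b) (v a) = if a = b then 1 else 0) ∧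
      ∀ x : V, x = ∑ a, P (w a) x • v a := by
  let w := Module.finBasis K U
  have hf : Module.finrank K V = Module.finrank K (Module.Dual K U) := by
    rw [Subspace.dual_finrank_eq, finrank_eq_of_separating P h₁ h₂]
  let F : V ≃ₗ[K] Module.Dual K U := LinearEquiv.ofInjectiveOfFinrankEq P.flip
    ((injective_iff_map_eq_zero _).2 fun v hv => h₂ v fun u => DFunLike.congr_fun hv u) hf
  have hF : ∀ u v, F v u = P u v := fun _ _ => rfl
  refine ⟨w, fun a => F.symm (w.dualBasis a), fun a b => ?_, fun x => F.injective ?_⟩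
  · rw [← hF, LinearEquiv.apply_symm_apply, Module.Basis.dualBasis_apply_self]
    simp [eq_comm]
  · refine w.ext fun b => ?_
    simp only [map_sum, map_smul, LinearEquiv.apply_symm_apply, LinearMap.sum_apply,
      LinearMap.smul_apply, Module.Basis.dualBasis_apply_self, hF]
    simp

end DualBases

/-! ### Trace form, corners and complete systems of idempotents in group algebras. -/

section GroupAlgebra

variable {G H : Type*} [Group G] [Group H]

/-- The coefficient of an element of a group algebra at the unit of the group. -/
def unitCoeff : MonoidAlgebra ℚ G →ₗ[ℚ] ℚ where
  toFun x := x.coeff 1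
  map_add' _ _ := rfl
  map_smul' _ _ := rfl

theorem unitCoeff_single (g : G) (r : ℚ) [Decidable (g = 1)] :
    unitCoeff (MonoidAlgebra.single g r) = if g = 1 then r else 0 := by
  classical
  exact (Finsupp.single_apply (a := g) (a' := 1) (b := r)).trans (by congr)

theorem unitCoeff_mul_single_inv (x : MonoidAlgebra ℚ G) (g : G) :
    unitCoeff (x * MonoidAlgebra.single g⁻¹ 1) = x.coeff g := by
  change (x * MonoidAlgebra.single g⁻¹ 1).coeff 1 = _
  rw [MonoidAlgebra.coeff_mul_single_apply]
  simp

/-- On group elements this says that gh = 1 exactly when hg = 1; so the unit coefficient is a trace.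
-/
theorem unitCoeff_mul_comm (x y : MonoidAlgebra ℚ G) : unitCoeff (x * y) = unitCoeff (y * x) := by
  classical
  induction x using MonoidAlgebra.induction_linear with
  | zero => simp
  | add a b ha hb => simp [add_mul, mul_add, ha, hb]
  | single g r =>
    induction y using MonoidAlgebra.induction_linear with
    | zero => simp
    | add a b ha hb => simp [add_mul, mul_add, ha, hb]
    | single h s =>
      rw [MonoidAlgebra.single_mul_single, MonoidAlgebra.single_mul_single, unitCoeff_single,
        unitCoeff_single, mul_comm r s]
      simp only [mul_eq_one_iff_eq_inv, eq_comm (a := g), inv_eq_iff_eq_inv]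

/-- The trace form is nondegenerate because testing against g⁻¹ reads off the coefficient at g. -/
theorem eq_zero_of_unitCoeff (x : MonoidAlgebra ℚ G) (h : ∀ y, unitCoeff (x * y) = 0) : x = 0 := by
  ext g
  rw [← unitCoeff_mul_single_inv, h]
  rfl

/-- The elements `x` with `e x = x = x f`. -/
def corner {B : Type*} [Ring B] [Algebra ℚ B] (e f : B) : Submodule ℚ B where
  carrier := {x | e * x = x ∧ x * f = x}
  add_mem' := fun ⟨h₁, h₂⟩ ⟨h₃, h₄⟩ => ⟨by rw [mul_add, h₁, h₃], by rw [add_mul, h₂, h₄]⟩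
  zero_mem' := ⟨mul_zero _, zero_mul _⟩
  smul_mem' c x := fun ⟨h₁, h₂⟩ => ⟨by rw [mul_smul_comm, h₁], by rw [smul_mul_assoc, h₂]⟩

theorem mul_mul_mem_corner {B : Type*} [Ring B] [Algebra ℚ B] {e f : B} (he : e * e = e)
    (hf : f * f = f) (x : B) : e * x * f ∈ corner e f :=
  ⟨by rw [← mul_assoc, ← mul_assoc, he], by rw [mul_assoc, hf]⟩

/-- The pairing of `e ℚG f` and `f ℚG e` given by the coefficient of the product at the unit. -/
def cornerPairing (e f : MonoidAlgebra ℚ G) : corner e f →ₗ[ℚ] corner f e →ₗ[ℚ] ℚ :=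
  ((LinearMap.mul ℚ (MonoidAlgebra ℚ G)).compr₂ unitCoeff).compl₁₂
    (corner e f).subtype (corner f e).subtype

theorem cornerPairing_apply (e f : MonoidAlgebra ℚ G) (x : corner e f) (y : corner f e) :
    cornerPairing e f x y = unitCoeff ((x : MonoidAlgebra ℚ G) * (y : MonoidAlgebra ℚ G)) := rfl

theorem cornerPairing_separating {e f : MonoidAlgebra ℚ G} (he : e * e = e) (hf : f * f = f)
    (x : corner e f) (h : ∀ y, cornerPairing e f x y = 0) : x = 0 := by
  refine Subtype.ext (eq_zero_of_unitCoeff _ fun y => ?_)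
  -- An arbitrary test element y may be replaced by f y e: x absorbs f on its right, and e returns
  -- to the left of x by cyclicity.
  rw [← h ⟨f * y * e, mul_mul_mem_corner hf he y⟩, cornerPairing_apply]
  simp only [← mul_assoc]
  rw [x.2.2, unitCoeff_mul_comm _ e, ← mul_assoc, x.2.1]

theorem cornerPairing_separating' {e f : MonoidAlgebra ℚ G} (he : e * e = e) (hf : f * f = f)
    (y : corner f e) (h : ∀ x, cornerPairing e f x y = 0) : y = 0 :=
  cornerPairing_separating hf he y fun x => by
    rw [cornerPairing_apply, unitCoeff_mul_comm]
    exact h x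

/-- This is the symmetry dim Hom(V, W) = dim Hom(W, V) for V = ℚG e and W = ℚG f. It lets
multiplicities and vanishing be read in either order. -/
theorem finrank_corner_comm [Finite G] {e f : MonoidAlgebra ℚ G} (he : e * e = e)
    (hf : f * f = f) : Module.finrank ℚ (corner e f) = Module.finrank ℚ (corner f e) :=
  finrank_eq_of_separating (cornerPairing e f) (cornerPairing_separating he hf)
    (cornerPairing_separating' he hf)

/-- A system of idempotents that represents every simple module exactly once, for an algebra that
is a product of matrix algebras over `ℚ`. -/
structure IsCompleteSystem {B I : Type*} [Ring B] [Algebra ℚ B] (f : I → B) : Prop where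
  ne_zero : ∀ i, f i ≠ 0
  idem : ∀ i, f i * f i = f i
  scalar : ∀ i x, ∃ c : ℚ, f i * x * f i = c • f i
  orth : ∀ i j x, i ≠ j → f i * x * f j = 0
  full : (1 : B) ∈ Submodule.span ℚ {z | ∃ i x y, z = x * f i * y}

theorem IsCompleteSystem.exists_scalar {B I : Type*} [Ring B] [Algebra ℚ B] {f : I → B}
    (hf : IsCompleteSystem f) {i : I} {x : B} (hx : x ∈ corner (f i) (f i)) :
    ∃ c : ℚ, x = c • f i := by
  obtain ⟨c, hc⟩ := hf.scalar i x
  exact ⟨c, by rw [← hc, hx.1, hx.2]⟩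

theorem IsCompleteSystem.eq_zero {B I : Type*} [Ring B] [Algebra ℚ B] {f : I → B}
    (hf : IsCompleteSystem f) {i j : I} (hij : i ≠ j) {x : B} (hx : x ∈ corner (f i) (f j)) :
    x = 0 := by
  have := hf.orth i j x hij
  rwa [hx.1, hx.2] at this

/-- By cyclicity and idempotence f_i y and f_i y f_i = c f_i have the same trace. A zero trace of
f_i would therefore put f_i in the radical of the nondegenerate trace form. -/
theorem IsCompleteSystem.unitCoeff_ne_zero {I : Type*} {f : I → MonoidAlgebra ℚ G}
    (hf : IsCompleteSystem f) (i : I) : unitCoeff (f i) ≠ 0 := by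
  intro h0
  refine hf.ne_zero i (eq_zero_of_unitCoeff _ fun y => ?_)
  obtain ⟨c, hc⟩ := hf.scalar i y
  rw [← hf.idem i, mul_assoc, unitCoeff_mul_comm, hc, map_smul, h0, smul_zero]

/-- The homomorphism of group algebras given by a homomorphism of groups. -/
abbrev algMap (j : H →* G) : MonoidAlgebra ℚ H →ₐ[ℚ] MonoidAlgebra ℚ G :=
  MonoidAlgebra.mapDomainAlgHom ℚ ℚ j

theorem algMap_single (j : H →* G) (h : H) (r : ℚ) :
    algMap j (MonoidAlgebra.single h r) = MonoidAlgebra.single (j h) r :=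
  MonoidAlgebra.mapDomain_single

/-- The part of an element of a group algebra that is supported on a subgroup. -/
def restrictCoeff (j : H →* G) (hj : Function.Injective j) :
    MonoidAlgebra ℚ G →ₗ[ℚ] MonoidAlgebra ℚ H where
  toFun := MonoidAlgebra.comapDomain j hj
  map_add' := MonoidAlgebra.comapDomain_add j hj
  map_smul' c x := by ext; simp [MonoidAlgebra.coeff_comapDomain]

variable (j : H →* G) (hj : Function.Injective j)

theorem restrictCoeff_coeff (x : MonoidAlgebra ℚ G) (h : H) :
    (restrictCoeff j hj x).coeff h = x.coeff (j h) := rfl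

theorem restrictCoeff_single (h : H) (r : ℚ) :
    restrictCoeff j hj (MonoidAlgebra.single (j h) r) = MonoidAlgebra.single h r :=
  MonoidAlgebra.comapDomain_single_map j hj h r

theorem restrictCoeff_single_of_notMem {g : G} (hg : g ∉ Set.range j) (r : ℚ) :
    restrictCoeff j hj (MonoidAlgebra.single g r) = 0 :=
  MonoidAlgebra.comapDomain_single_of_not_mem_range hg hj

theorem unitCoeff_restrictCoeff (x : MonoidAlgebra ℚ G) :
    unitCoeff (restrictCoeff j hj x) = unitCoeff x :=
  (restrictCoeff_coeff j hj x 1).trans (by rw [map_one]; rfl)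

/-- `restrictCoeff` is a conditional expectation: a map of ℚH-bimodules, by this lemma and its
mirror image, that preserves the unit coefficient. -/
theorem restrictCoeff_mul (y : MonoidAlgebra ℚ H) (x : MonoidAlgebra ℚ G) :
    restrictCoeff j hj (algMap j y * x) = y * restrictCoeff j hj x := by
  induction y using MonoidAlgebra.induction_linear with
  | zero => simp
  | add a b ha hb => simp only [map_add, add_mul, ha, hb]
  | single h r =>
    ext k
    rw [algMap_single, restrictCoeff_coeff, MonoidAlgebra.coeff_single_mul_apply,
      MonoidAlgebra.coeff_single_mul_apply, restrictCoeff_coeff, map_mul j, map_inv j]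

theorem restrictCoeff_mul' (y : MonoidAlgebra ℚ H) (x : MonoidAlgebra ℚ G) :
    restrictCoeff j hj (x * algMap j y) = restrictCoeff j hj x * y := by
  induction y using MonoidAlgebra.induction_linear with
  | zero => simp
  | add a b ha hb => simp only [map_add, mul_add, ha, hb]
  | single h r =>
    ext k
    rw [algMap_single, restrictCoeff_coeff, MonoidAlgebra.coeff_mul_single_apply,
      MonoidAlgebra.coeff_mul_single_apply, restrictCoeff_coeff, map_mul j, map_inv j]

theorem restrictCoeff_mem_corner {f f' : MonoidAlgebra ℚ H} {x : MonoidAlgebra ℚ G}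
    (hx : x ∈ corner (algMap j f) (algMap j f')) : restrictCoeff j hj x ∈ corner f f' :=
  ⟨by rw [← restrictCoeff_mul, hx.1], by rw [← restrictCoeff_mul', hx.2]⟩

/-- The decomposition of the restriction of `ℚG e` to a subgroup `H` into modules `ℚH f_i`. -/
theorem IsCompleteSystem.exists_restriction [Finite G] {I : Type*} [Fintype I]
    {f : I → MonoidAlgebra ℚ H} (hf : IsCompleteSystem f) {f' : I → MonoidAlgebra ℚ G}
    (hf' : ∀ i, algMap j (f i) = f' i) {e : MonoidAlgebra ℚ G} (he : e * e = e) :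
    ∃ (v w : ∀ i, Fin (Module.finrank ℚ (corner e (f' i))) → MonoidAlgebra ℚ G),
      (∀ i a, v i a ∈ corner (f' i) e) ∧
      (∀ i a, w i a ∈ corner e (f' i)) ∧
      (∀ i k a b, i ≠ k → restrictCoeff j hj (v i a * w k b) = 0) ∧
      (∀ i a b, restrictCoeff j hj (v i a * w i b) = if a = b then f i else 0) ∧
      ∀ x, x * e = x → ∑ i, ∑ a, algMap j (restrictCoeff j hj (x * w i a)) * v i a = x := by
  have idem : ∀ i, f' i * f' i = f' i := fun i => by
    rw [← hf', ← map_mul, hf.idem]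
  choose w v hwv hv using fun i => exists_dual_bases (cornerPairing e (f' i))
    (cornerPairing_separating he (idem i)) (cornerPairing_separating' he (idem i))
  -- The restriction of x y lies in f_i ℚH f_i = ℚ f_i. The unit coefficient determines the scalar,
  -- and cyclicity turns it into the value of the pairing at (y, x).
  have key : ∀ i (x : MonoidAlgebra ℚ G) (y : MonoidAlgebra ℚ G),
      x ∈ corner (f' i) e → y ∈ corner e (f' i) →
      restrictCoeff j hj (x * y) = (unitCoeff (y * x) / unitCoeff (f i)) • f i := by
    intro i x y hx hy
    have hxy : x * y ∈ corner (algMap j (f i)) (algMap j (f i)) :=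
      ⟨by rw [hf', ← mul_assoc, hx.1], by rw [hf', mul_assoc, hy.2]⟩
    obtain ⟨c, hc⟩ := hf.exists_scalar (restrictCoeff_mem_corner j hj hxy)
    have h1 := congrArg unitCoeff hc
    rw [unitCoeff_restrictCoeff, map_smul, smul_eq_mul, unitCoeff_mul_comm] at h1
    rw [hc, h1, mul_div_cancel_right₀ _ (hf.unitCoeff_ne_zero i)]
  have key' : ∀ i k (x : MonoidAlgebra ℚ G) (y : MonoidAlgebra ℚ G), i ≠ k →
      x ∈ corner (f' i) e → y ∈ corner e (f' k) →
      restrictCoeff j hj (x * y) = 0 := by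
    intro i k x y hik hx hy
    have hxy : x * y ∈ corner (algMap j (f i)) (algMap j (f k)) :=
      ⟨by rw [hf', ← mul_assoc, hx.1], by rw [hf', mul_assoc, hy.2]⟩
    exact hf.eq_zero hik (restrictCoeff_mem_corner j hj hxy)
  -- Rescaling v by the unit coefficient of f_i cancels the denominator in `key`.
  refine ⟨fun i a => unitCoeff (f i) • (v i a : MonoidAlgebra ℚ G), fun i a => w i a,
    fun i a => (corner _ _).smul_mem _ (v i a).2, fun i a => (w i a).2, ?_, ?_, ?_⟩
  · intro i k a b hik
    exact key' i k _ _ hik ((corner _ _).smul_mem _ (v i a).2) (w k b).2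
  · intro i a b
    have := hwv i a b
    rw [cornerPairing_apply] at this
    rw [smul_mul_assoc, map_smul, key i _ _ (v i a).2 (w i b).2, this]
    split_ifs
    · rw [smul_smul, mul_one_div_cancel (hf.unitCoeff_ne_zero i), one_smul]
    · simp
  -- When x starts with f'_i only the i-th inner sum survives, and it is the expansion of x in the
  -- dual basis.
  · have base : ∀ i x, x ∈ corner (f' i) e →
        ∑ k, ∑ a, algMap j (restrictCoeff j hj (x * w k a)) *
          (unitCoeff (f k) • (v k a : MonoidAlgebra ℚ G)) = x := by
      intro i x hx
      rw [Finset.sum_eq_single i]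
      · have h1 := congrArg Subtype.val (hv i ⟨x, hx⟩)
        rw [AddSubmonoidClass.coe_finsetSum] at h1
        conv_rhs => rw [show x = _ from h1]
        refine Finset.sum_congr rfl fun a _ => ?_
        rw [key i x _ hx (w i a).2, map_smul, hf', smul_mul_smul_comm,
          div_mul_cancel₀ _ (hf.unitCoeff_ne_zero i), (v i a).2.1]
        rfl
      · intro k _ hk
        refine Finset.sum_eq_zero fun a _ => ?_
        rw [key' i k x _ hk.symm hx (w k a).2, map_zero, zero_mul]
      · exact fun h => absurd (Finset.mem_univ i) h
    intro x hx
    -- For z = y f_i y' the base case applies to f'_i y' x, and y is pulled out by left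
    -- ℚH-linearity. Fullness of the system then allows z = 1.
    have span : ∀ z ∈ Submodule.span ℚ {z | ∃ i x y, z = x * f i * y},
        ∑ k, ∑ a, algMap j (restrictCoeff j hj (algMap j z * x * w k a)) *
          (unitCoeff (f k) • (v k a : MonoidAlgebra ℚ G)) = algMap j z * x := by
      intro z hz
      induction hz using Submodule.span_induction with
      | mem z hz =>
        obtain ⟨i, y, y', rfl⟩ := hz
        have h1 := base i (f' i * algMap j y' * x)
          ⟨by rw [← mul_assoc, ← mul_assoc, idem], by rw [mul_assoc, hx]⟩
        rw [map_mul, map_mul, hf', mul_assoc, mul_assoc, ← mul_assoc _ _ x]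
        conv_rhs => rw [← h1]
        rw [Finset.mul_sum]
        refine Finset.sum_congr rfl fun k _ => ?_
        rw [Finset.mul_sum]
        refine Finset.sum_congr rfl fun a _ => ?_
        rw [mul_assoc (algMap j y), restrictCoeff_mul, map_mul, mul_assoc]
      | zero => simp
      | add a b _ _ ha hb =>
        simp only [map_add, add_mul, Finset.sum_add_distrib, ha, hb]
      | smul c a _ ha =>
        simp only [map_smul, smul_mul_assoc, ← Finset.smul_sum, ha]
    have h1 := span 1 hf.full
    rwa [map_one, one_mul] at h1

/-- The element `x ⊗ y` of the group algebra of a product of groups. -/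
def outer (x : MonoidAlgebra ℚ G) (y : MonoidAlgebra ℚ H) : MonoidAlgebra ℚ (G × H) :=
  algMap (MonoidHom.inl G H) x * algMap (MonoidHom.inr G H) y

theorem algMap_inr_mul_inl (x : MonoidAlgebra ℚ G) (y : MonoidAlgebra ℚ H) :
    algMap (MonoidHom.inr G H) y * algMap (MonoidHom.inl G H) x = outer x y := by
  unfold outer
  induction x using MonoidAlgebra.induction_linear with
  | zero => simp
  | add a b ha hb => simp only [map_add, add_mul, mul_add, ha, hb]
  | single g r =>
    induction y using MonoidAlgebra.induction_linear with
    | zero => simp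
    | add a b ha hb => simp only [map_add, add_mul, mul_add, ha, hb]
    | single h s =>
      rw [algMap_single, algMap_single, MonoidAlgebra.single_mul_single,
        MonoidAlgebra.single_mul_single, mul_comm r s]
      simp

theorem outer_mul_outer (x x' : MonoidAlgebra ℚ G) (y y' : MonoidAlgebra ℚ H) :
    outer x y * outer x' y' = outer (x * x') (y * y') := by
  rw [outer, outer, mul_assoc, ← mul_assoc _ _ (algMap _ y'), algMap_inr_mul_inl, outer, outer,
    map_mul, map_mul]
  simp only [mul_assoc]

theorem outer_single (g : G) (h : H) (r s : ℚ) :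
    outer (MonoidAlgebra.single g r) (MonoidAlgebra.single h s) =
      MonoidAlgebra.single (g, h) (r * s) := by
  rw [outer, algMap_single, algMap_single, MonoidAlgebra.single_mul_single]
  simp

theorem add_outer (x x' : MonoidAlgebra ℚ G) (y : MonoidAlgebra ℚ H) :
    outer (x + x') y = outer x y + outer x' y := by
  rw [outer, map_add, add_mul, outer, outer]

theorem outer_add (x : MonoidAlgebra ℚ G) (y y' : MonoidAlgebra ℚ H) :
    outer x (y + y') = outer x y + outer x y' := by
  rw [outer, map_add, mul_add, outer, outer]

theorem smul_outer (r : ℚ) (x : MonoidAlgebra ℚ G) (y : MonoidAlgebra ℚ H) :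
    outer (r • x) y = r • outer x y := by
  rw [outer, map_smul, smul_mul_assoc, outer]

theorem outer_smul (r : ℚ) (x : MonoidAlgebra ℚ G) (y : MonoidAlgebra ℚ H) :
    outer x (r • y) = r • outer x y := by
  rw [outer, map_smul, mul_smul_comm, outer]

theorem zero_outer (y : MonoidAlgebra ℚ H) : outer (0 : MonoidAlgebra ℚ G) y = 0 := by
  rw [outer, map_zero, zero_mul]

theorem outer_zero (x : MonoidAlgebra ℚ G) : outer x (0 : MonoidAlgebra ℚ H) = 0 := by
  rw [outer, map_zero, mul_zero]

theorem one_outer_one : outer (1 : MonoidAlgebra ℚ G) (1 : MonoidAlgebra ℚ H) = 1 := by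
  rw [outer, map_one, map_one, one_mul]

/-- Irreducibles of a product are external tensor products. The elements `outer x y` span the group
algebra of G × H, so the conditions on corners reduce to the two factors. -/
theorem IsCompleteSystem.prod {I J : Type*} {f : I → MonoidAlgebra ℚ G} {f' : J → MonoidAlgebra ℚ H}
    (hf : IsCompleteSystem f) (hf' : IsCompleteSystem f') :
    IsCompleteSystem fun i : I × J => outer (f i.1) (f' i.2) := by
  have split : ∀ z : MonoidAlgebra ℚ (G × H), z ∈ Submodule.span ℚ
      {z | ∃ x y, z = outer x y} := by
    intro z
    induction z using MonoidAlgebra.induction_linear with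
    | zero => exact zero_mem _
    | add a b ha hb => exact add_mem ha hb
    | single g r =>
      exact Submodule.subset_span ⟨MonoidAlgebra.single g.1 1, MonoidAlgebra.single g.2 r,
        by rw [outer_single, one_mul]⟩
  have coef : ∀ (x : MonoidAlgebra ℚ G) (y : MonoidAlgebra ℚ H) (g : G) (h : H),
      (outer x y).coeff (g, h) =
        x.coeff g * y.coeff h := by
    classical
    intro x y g h
    induction x using MonoidAlgebra.induction_linear with
    | zero => simp [zero_outer]
    | add a b ha hb => simp only [add_outer, add_mul, MonoidAlgebra.coeff_add, Finsupp.add_apply, ha, hb]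
    | single g' r =>
      induction y using MonoidAlgebra.induction_linear with
      | zero => simp [outer_zero]
      | add a b ha hb =>
        simp only [outer_add, mul_add, MonoidAlgebra.coeff_add, Finsupp.add_apply, ha, hb]
      | single h' s =>
        rw [outer_single, MonoidAlgebra.coeff_single, MonoidAlgebra.coeff_single, MonoidAlgebra.coeff_single,
          Finsupp.single_apply, Finsupp.single_apply, Finsupp.single_apply]
        by_cases h1 : g' = g <;> by_cases h2 : h' = h <;> simp [h1, h2]
  refine ⟨fun i h0 => ?_, fun i => by rw [outer_mul_outer, hf.idem, hf'.idem], fun i z => ?_,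
    fun i k z hik => ?_, ?_⟩
  · obtain ⟨g, hg⟩ : ∃ g, (f i.1).coeff g ≠ 0 := by
      by_contra! h
      exact hf.ne_zero i.1 (by ext g; exact h g)
    obtain ⟨g', hg'⟩ : ∃ g, (f' i.2).coeff g ≠ 0 := by
      by_contra! h
      exact hf'.ne_zero i.2 (by ext g; exact h g)
    -- A coefficient of an outer product is a product of coefficients, so nonzero coefficients of
    -- both factors give a nonzero one.
    have := congrArg (fun z => z.coeff (g, g')) h0
    simp only [coef] at this
    exact (mul_ne_zero hg hg') this
  · induction split z using Submodule.span_induction with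
    | mem z hz =>
      obtain ⟨x, y, rfl⟩ := hz
      obtain ⟨c, hc⟩ := hf.scalar i.1 x
      obtain ⟨d, hd⟩ := hf'.scalar i.2 y
      exact ⟨c * d, by
        rw [outer_mul_outer, outer_mul_outer, hc, hd, smul_outer, outer_smul, mul_smul]⟩
    | zero => exact ⟨0, by simp⟩
    | add a b _ _ ha hb =>
      obtain ⟨c, hc⟩ := ha
      obtain ⟨d, hd⟩ := hb
      exact ⟨c + d, by rw [mul_add, add_mul, hc, hd, add_smul]⟩
    | smul r a _ ha =>
      obtain ⟨c, hc⟩ := ha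
      exact ⟨r * c, by rw [mul_smul_comm, smul_mul_assoc, hc, mul_smul]⟩
  · induction split z using Submodule.span_induction with
    | mem z hz =>
      obtain ⟨x, y, rfl⟩ := hz
      rw [outer_mul_outer, outer_mul_outer]
      by_cases h1 : i.1 = k.1
      · rw [hf'.orth _ _ _ fun h2 => hik (Prod.ext h1 h2), outer_zero]
      · rw [hf.orth _ _ _ h1, zero_outer]
    | zero => simp
    | add a b _ _ ha hb => rw [mul_add, add_mul, ha, hb, add_zero]
    | smul r a _ ha => rw [mul_smul_comm, smul_mul_assoc, ha, smul_zero]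
  · have h1 : ∀ x ∈ Submodule.span ℚ {z | ∃ i x y, z = x * f i * y},
        ∀ y ∈ Submodule.span ℚ {z | ∃ i x y, z = x * f' i * y},
        outer x y ∈ Submodule.span ℚ
          {z | ∃ (i : I × J) (x y : MonoidAlgebra ℚ (G × H)), z = x *
            outer (f i.1) (f' i.2) * y} := by
      intro x hx y hy
      induction hx using Submodule.span_induction with
      | mem x hx =>
        induction hy using Submodule.span_induction with
        | mem y hy =>
          obtain ⟨i, a, b, rfl⟩ := hx
          obtain ⟨k, c, d, rfl⟩ := hy
          exact Submodule.subset_span ⟨(i, k), outer a c, outer b d, by rw [outer_mul_outer, outer_mul_outer]⟩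
        | zero => rw [outer_zero]; exact zero_mem _
        | add a b _ _ ha hb => rw [outer_add]; exact add_mem ha hb
        | smul r a _ ha => rw [outer_smul]; exact Submodule.smul_mem _ _ ha
      | zero => rw [zero_outer]; exact zero_mem _
      | add a b _ _ ha hb => rw [add_outer]; exact add_mem ha hb
      | smul r a _ ha => rw [smul_outer]; exact Submodule.smul_mem _ _ ha
    have h2 := h1 1 hf.full 1 hf'.full
    rwa [one_outer_one] at h2

/-- The decomposition of `ℚG e` into modules `ℚG f_i`. -/
theorem IsCompleteSystem.exists_decomposition [Finite G] {I : Type*} [Fintype I]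
    {f : I → MonoidAlgebra ℚ G} (hf : IsCompleteSystem f) {e : MonoidAlgebra ℚ G}
    (he : e * e = e) :
    ∃ (v w : ∀ i, Fin (Module.finrank ℚ (corner e (f i))) → MonoidAlgebra ℚ G),
      (∀ i a, v i a ∈ corner (f i) e) ∧ (∀ i a, w i a ∈ corner e (f i)) ∧
      (∀ i k a b, i ≠ k → v i a * w k b = 0) ∧
      (∀ i a b, v i a * w i b = if a = b then f i else 0) ∧
      ∑ i, ∑ a, w i a * v i a = e := by
  have hid : ∀ x : MonoidAlgebra ℚ G, algMap (MonoidHom.id G) x = x := fun x =>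
    DFunLike.congr_fun (MonoidAlgebra.mapDomainAlgHom_id ..) x
  have hres : ∀ x : MonoidAlgebra ℚ G,
      restrictCoeff (MonoidHom.id G) Function.injective_id x = x := fun x => by
    ext g; rfl
  -- This is the case in which the subgroup is the whole group; evaluating the expansion at x = e
  -- gives the final identity.
  have h := hf.exists_restriction (MonoidHom.id G) Function.injective_id (fun i => hid (f i)) he
  simp only [hid, hres] at h
  obtain ⟨v, w, hv, hw, h1, h2, h3⟩ := h
  refine ⟨v, w, hv, hw, h1, h2, ?_⟩
  have h4 := h3 e he
  simpa only [← mul_assoc, (hw _ _).1] using h4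

end GroupAlgebra

/-! ### Counting letters by columns: the dominance inequality. -/

section ColumnCounting

variable {n : ℕ} {r r' c : Fin n → ℕ}

/-- In one column r takes distinct values, so at most k letters have r < k. The column is filled
without gaps for r', so either it contains all values of r' below k or all its letters have r' < k.
-/
theorem card_row_col_le (hinj : ∀ x y, r x = r y → c x = c y → x = y)
    (hdown : ∀ y, ∀ k < r' y, ∃ z, r' z = k ∧ c z = c y) (k m : ℕ) :
    (Finset.univ.filter fun x => r x < k ∧ c x = m).card ≤
      (Finset.univ.filter fun x => r' x < k ∧ c x = m).card := by
  by_cases h : ∃ y, c y = m ∧ k ≤ r' y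
  · obtain ⟨y, hy, hk⟩ := h
    have h1 : (Finset.univ.filter fun x => r x < k ∧ c x = m).card ≤ k := by
      rw [← Finset.card_range k]
      refine Finset.card_le_card_of_injOn r (fun x hx => ?_) fun x hx z hz hxz => ?_
      · simp only [Finset.coe_filter, Finset.mem_univ, true_and, Set.mem_ofPred_eq] at hx
        simpa using hx.1
      · simp only [Finset.coe_filter, Finset.mem_univ, true_and, Set.mem_ofPred_eq] at hx hz
        exact hinj x z hxz (hx.2.trans hz.2.symm)
    refine h1.trans ?_
    conv_lhs => rw [← Finset.card_range k]
    refine Finset.card_le_card_of_surjOn r' fun i hi => ?_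
    have hi' : i < k := by simpa using hi
    obtain ⟨z, hz, hz'⟩ := hdown y i (lt_of_lt_of_le hi' hk)
    exact ⟨z, by simp [hz, hz', hy, hi'], hz⟩
  · push Not at h
    refine Finset.card_le_card fun x hx => ?_
    simp only [Finset.mem_filter, Finset.mem_univ, true_and] at hx ⊢
    exact ⟨h x hx.2, hx.2⟩

theorem card_row_eq_sum (k : ℕ) : (Finset.univ.filter fun x => r x < k).card =
    ∑ m ∈ Finset.univ.image c, (Finset.univ.filter fun x => r x < k ∧ c x = m).card := by
  rw [Finset.card_eq_sum_card_fiberwise (f := c) (t := Finset.univ.image c) fun x _ => by simp]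
  simp only [Finset.filter_filter]

theorem card_row_le (hinj : ∀ x y, r x = r y → c x = c y → x = y)
    (hdown : ∀ y, ∀ k < r' y, ∃ z, r' z = k ∧ c z = c y) (k : ℕ) :
    (Finset.univ.filter fun x => r x < k).card ≤ (Finset.univ.filter fun x => r' x < k).card := by
  rw [card_row_eq_sum (c := c), card_row_eq_sum (c := c)]
  exact Finset.sum_le_sum fun m _ => card_row_col_le hinj hdown k m

/-- Equal totals force equality in each column separately, since each column satisfies the
inequality. -/
theorem exists_same_cell (hinj : ∀ x y, r x = r y → c x = c y → x = y)
    (hdown : ∀ y, ∀ k < r' y, ∃ z, r' z = k ∧ c z = c y)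
    (heq : ∀ k, (Finset.univ.filter fun x => r x < k).card =
      (Finset.univ.filter fun x => r' x < k).card) (x : Fin n) :
    ∃ z, r' z = r x ∧ c z = c x := by
  have hcol : ∀ k, (Finset.univ.filter fun y => r y < k ∧ c y = c x).card =
      (Finset.univ.filter fun y => r' y < k ∧ c y = c x).card := by
    intro k
    have h := heq k
    rw [card_row_eq_sum (c := c), card_row_eq_sum (c := c)] at h
    exact (Finset.sum_eq_sum_iff_of_le fun m _ => card_row_col_le hinj hdown k m).1 h (c x)
      (by simp)
  -- The letter x makes the count jump between the bounds r x and r x + 1. The count for r' must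
  -- jump as well, which produces a letter z with r' z = r x.
  have hlt : (Finset.univ.filter fun y => r y < r x ∧ c y = c x).card <
      (Finset.univ.filter fun y => r y < r x + 1 ∧ c y = c x).card := by
    refine Finset.card_lt_card ⟨fun y hy => ?_, fun h => ?_⟩
    · simp only [Finset.mem_filter, Finset.mem_univ, true_and] at hy ⊢
      exact ⟨by omega, hy.2⟩
    · have := @h x (by simp)
      simp at this
  rw [hcol, hcol] at hlt
  obtain ⟨z, hz, hz'⟩ := Finset.exists_mem_notMem_of_card_lt_card hlt
  simp only [Finset.mem_filter, Finset.mem_univ, true_and, not_and] at hz hz'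
  refine ⟨z, ?_, hz.2⟩
  by_contra h
  exact hz' (by omega) hz.2

end ColumnCounting

/-! ### Cells of the row-by-row tableau. -/

section Tableau

variable {n : ℕ} (μ : n.Partition)

theorem tableau_ext {x y : Fin n} (hr : tableauRow μ x = tableauRow μ y)
    (hc : tableauCol μ x = tableauCol μ y) : x = y := by
  refine (tableau μ).injective ?_
  unfold tableauRow tableauCol at *
  generalize tableau μ x = a at *
  generalize tableau μ y = b at *
  obtain ⟨a, a'⟩ := a
  obtain ⟨b, b'⟩ := b
  obtain rfl : a = b := Fin.ext hr
  obtain rfl : a' = b' := Fin.ext hc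
  rfl

/-- Row lengths decrease, so an earlier row is long enough to contain a cell in the same column. -/
theorem tableau_down (y : Fin n) (k : ℕ) (hk : k < tableauRow μ y) :
    ∃ z, tableauRow μ z = k ∧ tableauCol μ z = tableauCol μ y := by
  have hk' : k < (rowLengths μ).length := hk.trans (tableau μ y).1.2
  have hs : (rowLengths μ).Pairwise (· ≥ ·) := Multiset.pairwise_sort _ _
  have hle : (rowLengths μ).get (tableau μ y).1 ≤ (rowLengths μ).get ⟨k, hk'⟩ :=
    List.pairwise_iff_get.1 hs ⟨k, hk'⟩ (tableau μ y).1 hk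
  refine ⟨(tableau μ).symm ⟨⟨k, hk'⟩, ⟨(tableau μ y).2, (tableau μ y).2.2.trans_le hle⟩⟩, ?_, ?_⟩
  · rw [tableauRow, Equiv.apply_symm_apply]
  · rw [tableauCol, Equiv.apply_symm_apply]
    rfl

theorem card_tableauRow_eq (k : ℕ) :
    (Finset.univ.filter fun x => tableauRow μ x = k).card = (rowLengths μ).getD k 0 := by
  by_cases hk : k < (rowLengths μ).length
  · rw [List.getD_eq_getElem _ _ hk]
    let f : Fin ((rowLengths μ).get ⟨k, hk⟩) → Fin n := fun j => (tableau μ).symm ⟨⟨k, hk⟩, j⟩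
    have hf : Function.Injective f := fun i j hij => by
      have := (tableau μ).symm.injective hij
      simpa using this
    have h : (Finset.univ.filter fun x => tableauRow μ x = k) = Finset.univ.map ⟨f, hf⟩ := by
      ext x
      simp only [Finset.mem_filter, Finset.mem_univ, true_and, Finset.mem_map,
        Function.Embedding.coeFn_mk, f, Equiv.symm_apply_eq]
      constructor
      · intro hx
        unfold tableauRow at hx
        generalize tableau μ x = a at *
        obtain ⟨a, a'⟩ := a
        obtain rfl : a = ⟨k, hk⟩ := Fin.ext hx
        exact ⟨a', rfl⟩
      · rintro ⟨j, hj⟩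
        rw [tableauRow, ← hj]
    rw [h, Finset.card_map, Finset.card_univ, Fintype.card_fin]
    rfl
  · rw [List.getD_eq_default _ _ (not_lt.1 hk), Finset.card_eq_zero,
      Finset.filter_eq_empty_iff]
    intro x _ hx
    exact hk (hx ▸ (tableau μ x).1.2)

/-- Successive differences of the counts are the row lengths. This makes dominance antisymmetric. -/
theorem partition_ext_of_card {μ ν : n.Partition}
    (h : ∀ k, (Finset.univ.filter fun x => tableauRow μ x < k).card =
      (Finset.univ.filter fun x => tableauRow ν x < k).card) : μ = ν := by
  have split : ∀ (μ : n.Partition) k, (Finset.univ.filter fun x => tableauRow μ x < k + 1).card =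
      (Finset.univ.filter fun x => tableauRow μ x < k).card + (rowLengths μ).getD k 0 := by
    intro μ k
    rw [← card_tableauRow_eq, ← Finset.card_union_of_disjoint]
    · congr 1
      ext x
      simp only [Finset.mem_filter, Finset.mem_union, Finset.mem_univ, true_and]
      omega
    · rw [Finset.disjoint_filter]
      intro x _ hx
      omega
  have hget : ∀ k, (rowLengths μ).getD k 0 = (rowLengths ν).getD k 0 := fun k => by
    have h1 := split μ k
    have h2 := split ν k
    rw [h, h] at h1
    omega
  -- Parts are positive, so the default value 0 marks exactly the end of the list and the lengths
  -- can be compared.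
  have hpos : ∀ (μ : n.Partition) k (hk : k < (rowLengths μ).length),
      0 < (rowLengths μ).getD k 0 := by
    intro μ k hk
    rw [List.getD_eq_getElem _ _ hk]
    refine μ.parts_pos ?_
    rw [← Multiset.mem_sort (r := (· ≥ ·))]
    exact List.getElem_mem hk
  have hlen : ∀ (μ ν : n.Partition), (∀ k, (rowLengths μ).getD k 0 = (rowLengths ν).getD k 0) →
      (rowLengths μ).length ≤ (rowLengths ν).length := by
    intro μ ν hget
    by_contra hlt
    have := hpos μ _ (not_le.1 hlt)
    rw [hget, List.getD_eq_default _ _ le_rfl] at this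
    exact this.false
  have hrow : rowLengths μ = rowLengths ν := by
    refine List.ext_getElem (le_antisymm (hlen μ ν hget) (hlen ν μ fun k => (hget k).symm)) ?_
    intro k h1 h2
    rw [← List.getD_eq_getElem _ 0 h1, hget, List.getD_eq_getElem _ 0 h2]
  refine Nat.Partition.ext ?_
  rw [← Multiset.sort_eq μ.parts (· ≥ ·), ← Multiset.sort_eq ν.parts (· ≥ ·)]
  exact congrArg _ hrow

end Tableau

/-! ### Products of row symmetrizers and column antisymmetrizers. -/

section YoungSymmetrizer

variable {n : ℕ}

theorem perm_apply_inv {α : Type*} (g : Equiv.Perm α) (x : α) : g (g⁻¹ x) = x :=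
  g.apply_symm_apply x

theorem perm_inv_apply {α : Type*} (g : Equiv.Perm α) (x : α) : g⁻¹ (g x) = x :=
  g.symm_apply_apply x

theorem rowSymmetrizer_mul (μ : n.Partition) (p : Equiv.Perm (Fin n))
    (hp : ∀ x, tableauRow μ (p x) = tableauRow μ x) :
    rowSymmetrizer μ * MonoidAlgebra.single p 1 = rowSymmetrizer μ := by
  classical
  rw [rowSymmetrizer, Finset.sum_mul]
  refine Finset.sum_bij (fun σ _ => σ * p) (fun σ hσ => ?_) (fun σ _ τ _ h => mul_right_cancel h)
    (fun σ hσ => ⟨σ * p⁻¹, ?_, by simp⟩) (fun σ _ => by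
      rw [MonoidAlgebra.single_mul_single, one_mul])
  · simp only [Finset.mem_filter, Finset.mem_univ, true_and, Equiv.Perm.mul_apply] at hσ ⊢
    intro x
    rw [hσ, hp]
  · simp only [Finset.mem_filter, Finset.mem_univ, true_and, Equiv.Perm.mul_apply] at hσ ⊢
    intro x
    rw [hσ, ← hp, perm_apply_inv]

theorem mul_colAntisymmetrizer (μ : n.Partition) (q : Equiv.Perm (Fin n))
    (hq : ∀ x, tableauCol μ (q x) = tableauCol μ x) :
    MonoidAlgebra.single q 1 * colAntisymmetrizer μ =
      ((Equiv.Perm.sign q : ℤ) : ℚ) • colAntisymmetrizer μ := by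
  classical
  rw [colAntisymmetrizer, Finset.mul_sum, Finset.smul_sum]
  have hs : ((Equiv.Perm.sign q : ℤ) : ℚ) * ((Equiv.Perm.sign q : ℤ) : ℚ) = 1 := by
    exact_mod_cast Int.units_coe_mul_self (Equiv.Perm.sign q)
  refine Finset.sum_bij (fun σ _ => q * σ) (fun σ hσ => ?_) (fun σ _ τ _ h => mul_left_cancel h)
    (fun σ hσ => ⟨q⁻¹ * σ, ?_, by simp⟩) (fun σ _ => ?_)
  · simp only [Finset.mem_filter, Finset.mem_univ, true_and, Equiv.Perm.mul_apply] at hσ ⊢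
    intro x
    rw [hq, hσ]
  · simp only [Finset.mem_filter, Finset.mem_univ, true_and, Equiv.Perm.mul_apply] at hσ ⊢
    intro x
    rw [← hσ x, ← hq, perm_apply_inv]
  · rw [MonoidAlgebra.single_mul_single, one_mul, MonoidAlgebra.smul_single', map_mul,
      Units.val_mul, Int.cast_mul, ← mul_assoc, hs, one_mul]

/-- The transposition of x and y is absorbed by the row symmetrizer; moved past g, it becomes a
transposition in the column group of ν and contributes the sign −1. The product equals its own
negative. -/
theorem row_mul_single_mul_col_eq_zero (μ ν : n.Partition) (g : Equiv.Perm (Fin n)) {x y : Fin n}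
    (hxy : x ≠ y) (hr : tableauRow μ x = tableauRow μ y)
    (hc : tableauCol ν (g⁻¹ x) = tableauCol ν (g⁻¹ y)) :
    rowSymmetrizer μ * MonoidAlgebra.single g 1 * colAntisymmetrizer ν = 0 := by
  have h1 := rowSymmetrizer_mul μ (Equiv.swap x y) fun z => by
    rw [Equiv.swap_apply_def]
    split_ifs with h h <;> simp [h, hr]
  have h2 := mul_colAntisymmetrizer ν (Equiv.swap (g⁻¹ x) (g⁻¹ y)) fun z => by
    rw [Equiv.swap_apply_def]
    split_ifs with h h
    · rw [h, hc]
    · rw [h, hc]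
    · rfl
  rw [Equiv.Perm.sign_swap (g⁻¹.injective.ne hxy)] at h2
  have h3 : Equiv.swap x y * g = g * Equiv.swap (g⁻¹ x) (g⁻¹ y) := by
    rw [Equiv.mul_swap_eq_swap_mul, perm_apply_inv, perm_apply_inv]
  have h4 : rowSymmetrizer μ * MonoidAlgebra.single g 1 * colAntisymmetrizer ν =
      -(rowSymmetrizer μ * MonoidAlgebra.single g 1 * colAntisymmetrizer ν) := by
    conv_lhs => rw [← h1]
    rw [mul_assoc (rowSymmetrizer μ), MonoidAlgebra.single_mul_single, h3, mul_one,
      ← one_mul (1 : ℚ), ← MonoidAlgebra.single_mul_single, ← mul_assoc (rowSymmetrizer μ),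
      one_mul, mul_assoc, h2]
    simp
  have h5 := eq_neg_iff_add_eq_zero.1 h4
  rw [← two_smul ℚ] at h5
  have h6 := congrArg (fun z => (2⁻¹ : ℚ) • z) h5
  simpa [smul_smul] using h6

/-- If the product survives, no two letters share a row for μ and a column of the g-translate of the
tableau of ν. The counting lemma then applies to these rows and columns. -/
theorem rowLengths_le_of_mul_ne_zero (μ ν : n.Partition) (g : Equiv.Perm (Fin n))
    (h : rowSymmetrizer μ * MonoidAlgebra.single g 1 * colAntisymmetrizer ν ≠ 0) (k : ℕ) :
    (Finset.univ.filter fun x => tableauRow μ x < k).card ≤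
      (Finset.univ.filter fun x => tableauRow ν x < k).card := by
  have h1 := card_row_le (r := tableauRow μ) (r' := fun x => tableauRow ν (g⁻¹ x))
    (c := fun x => tableauCol ν (g⁻¹ x))
    (fun x y hr hc => by
      by_contra hxy
      exact h (row_mul_single_mul_col_eq_zero μ ν g hxy hr hc))
    (fun y k hk => by
      obtain ⟨z, hz, hz'⟩ := tableau_down ν (g⁻¹ y) k hk
      exact ⟨g z, by simpa using hz, by simpa using hz'⟩) k
  refine h1.trans (le_of_eq ?_)
  refine Finset.card_bij (fun x _ => g⁻¹ x) (fun x hx => ?_) (fun x _ y _ hxy => g⁻¹.injective hxy)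
    (fun y hy => ⟨g y, ?_, by simp⟩)
  · simpa using hx
  · simpa using hy

/-- If the product is nonzero, g factors as p⁻¹ (p g) with p preserving rows and p g preserving
columns. The first factor is absorbed and the second contributes its sign. -/
theorem exists_row_mul_single_mul_col (μ : n.Partition) (g : Equiv.Perm (Fin n)) :
    ∃ s : ℚ, rowSymmetrizer μ * MonoidAlgebra.single g 1 * colAntisymmetrizer μ =
      s • youngSymmetrizer μ := by
  by_cases h : rowSymmetrizer μ * MonoidAlgebra.single g 1 * colAntisymmetrizer μ = 0
  · exact ⟨0, by rw [h, zero_smul]⟩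
  have hinj : ∀ x y, tableauRow μ x = tableauRow μ y →
      tableauCol μ (g⁻¹ x) = tableauCol μ (g⁻¹ y) → x = y := fun x y hr hc => by
    by_contra hxy
    exact h (row_mul_single_mul_col_eq_zero μ μ g hxy hr hc)
  -- The tableau and its translate have the same shape, so the counts agree. Each x thus has a
  -- letter z x in its column of the translated tableau whose translated row is the row of x; p
  -- sends x to g⁻¹ (z x).
  have key := exists_same_cell (r := tableauRow μ) (r' := fun x => tableauRow μ (g⁻¹ x))
    (c := fun x => tableauCol μ (g⁻¹ x)) hinj
    (fun y k hk => by
      obtain ⟨z, hz, hz'⟩ := tableau_down μ (g⁻¹ y) k hk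
      exact ⟨g z, by simpa using hz, by simpa using hz'⟩)
    (fun k => Finset.card_bij (fun x _ => g x) (fun x hx => by simpa using hx)
      (fun x _ y _ hxy => g.injective hxy) (fun y hy => ⟨g⁻¹ y, by simpa using hy, by simp⟩))
  choose z hz hz' using key
  have pinj : Function.Injective fun x => g⁻¹ (z x) := fun x y hxy => by
    refine hinj x y ?_ ?_
    · rw [← hz x, ← hz y]; exact congrArg _ hxy
    · rw [← hz' x, ← hz' y]; exact congrArg _ hxy
  let p : Equiv.Perm (Fin n) := Equiv.ofBijective _ (Finite.injective_iff_bijective.1 pinj)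
  have hp : ∀ x, p x = g⁻¹ (z x) := fun _ => rfl
  have h1 := rowSymmetrizer_mul μ p fun x => hz x
  have h2 := mul_colAntisymmetrizer μ (p * g) fun x => by
    rw [Equiv.Perm.mul_apply, hp]
    refine (hz' (g x)).trans ?_
    rw [perm_inv_apply]
  refine ⟨((Equiv.Perm.sign (p * g) : ℤ) : ℚ), ?_⟩
  conv_lhs => rw [← h1]
  rw [mul_assoc (rowSymmetrizer μ), MonoidAlgebra.single_mul_single, one_mul, mul_assoc, h2,
    mul_smul_comm, youngSymmetrizer]

theorem exists_row_mul_mul_col (μ : n.Partition) (x : PermAlg n) :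
    ∃ s : ℚ, rowSymmetrizer μ * x * colAntisymmetrizer μ = s • youngSymmetrizer μ := by
  induction x using MonoidAlgebra.induction_linear with
  | zero => exact ⟨0, by simp⟩
  | add a b ha hb =>
    obtain ⟨s, hs⟩ := ha
    obtain ⟨t, ht⟩ := hb
    exact ⟨s + t, by rw [mul_add, add_mul, hs, ht, add_smul]⟩
  | single g r =>
    obtain ⟨s, hs⟩ := exists_row_mul_single_mul_col μ g
    refine ⟨r * s, ?_⟩
    rw [mul_smul, ← hs, ← mul_one r, ← MonoidAlgebra.smul_single', mul_smul_comm, smul_mul_assoc,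
      mul_one]

theorem row_mul_mul_col_eq_zero (μ ν : n.Partition)
    (h : ∀ g, rowSymmetrizer μ * MonoidAlgebra.single g 1 * colAntisymmetrizer ν = 0)
    (x : PermAlg n) : rowSymmetrizer μ * x * colAntisymmetrizer ν = 0 := by
  induction x using MonoidAlgebra.induction_linear with
  | zero => simp
  | add a b ha hb => rw [mul_add, add_mul, ha, hb, add_zero]
  | single g r =>
    rw [← mul_one r, ← MonoidAlgebra.smul_single', mul_smul_comm, smul_mul_assoc, h, smul_zero]

/-- If neither family vanished, μ and ν would dominate each other and be equal. The combinatorics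
gives vanishing in only one of the two orders. -/
theorem row_mul_mul_col_eq_zero_or (μ ν : n.Partition) (h : μ ≠ ν) :
    (∀ x, rowSymmetrizer μ * x * colAntisymmetrizer ν = 0) ∨
      ∀ x, rowSymmetrizer ν * x * colAntisymmetrizer μ = 0 := by
  by_contra! hcon
  obtain ⟨⟨x, hx⟩, y, hy⟩ := hcon
  obtain ⟨g, hg⟩ := not_forall.1 fun h => hx (row_mul_mul_col_eq_zero μ ν h x)
  obtain ⟨g', hg'⟩ := not_forall.1 fun h => hy (row_mul_mul_col_eq_zero ν μ h y)
  exact h (partition_ext_of_card fun k => le_antisymm (rowLengths_le_of_mul_ne_zero μ ν g hg k)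
    (rowLengths_le_of_mul_ne_zero ν μ g' hg' k))

/-- The row and column groups meet only in the identity, so the coefficient at the unit is 1. -/
theorem youngSymmetrizer_ne_zero (μ : n.Partition) : youngSymmetrizer μ ≠ 0 := by
  classical
  intro h0
  have h1 : unitCoeff (youngSymmetrizer μ) = 1 := by
    rw [youngSymmetrizer, rowSymmetrizer, colAntisymmetrizer, Finset.sum_mul, map_sum,
      Finset.sum_eq_single 1]
    · rw [← MonoidAlgebra.one_def, one_mul, map_sum, Finset.sum_eq_single 1]
      · simp [unitCoeff_single]
      · intro τ _ hτ
        rw [unitCoeff_single, if_neg hτ]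
      · intro h
        exact absurd h (by simp)
    · intro σ hσ hσ1
      rw [Finset.mul_sum, map_sum]
      refine Finset.sum_eq_zero fun τ hτ => ?_
      rw [MonoidAlgebra.single_mul_single, unitCoeff_single, if_neg]
      intro hστ
      simp only [Finset.mem_filter, Finset.mem_univ, true_and] at hσ hτ
      refine hσ1 (Equiv.ext fun x => tableau_ext μ (hσ x) ?_)
      rw [eq_inv_of_mul_eq_one_right hστ] at hτ
      rw [← hτ (σ x), perm_inv_apply]
      rfl
    · intro h
      exact absurd h (by simp)
  rw [h0, map_zero] at h1
  exact zero_ne_one h1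

end YoungSymmetrizer

/-! ### Trace functionals and completeness of the Young idempotents. -/

section TraceFunctionals

variable {n : ℕ}

/-- The linear functionals on `ℚ Σ_n` that are invariant under cyclic permutation of products. -/
def traceFunctionals (n : ℕ) : Submodule ℚ (Module.Dual ℚ (PermAlg n)) where
  carrier := {τ | ∀ x y, τ (x * y) = τ (y * x)}
  add_mem' hσ hτ x y := by rw [LinearMap.add_apply, LinearMap.add_apply, hσ, hτ]
  zero_mem' _ _ := rfl
  smul_mem' c τ hτ x y := by rw [LinearMap.smul_apply, LinearMap.smul_apply, hτ]

/-- A trace functional is constant on conjugacy classes, and in a symmetric group the cycle type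
determines the class. -/
theorem finrank_traceFunctionals_le :
    Module.finrank ℚ (traceFunctionals n) ≤ Fintype.card n.Partition := by
  classical
  -- The default 1 for a partition without representative is harmless, since only injectivity of
  -- evaluation at representatives is used.
  let rep : (Fintype.card (Fin n)).Partition → Equiv.Perm (Fin n) := fun π =>
    if h : ∃ σ : Equiv.Perm (Fin n), σ.partition = π then h.choose else 1
  have hrep : ∀ σ : Equiv.Perm (Fin n), IsConj (rep σ.partition) σ := fun σ => by
    have h : ∃ σ' : Equiv.Perm (Fin n), σ'.partition = σ.partition := ⟨σ, rfl⟩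
    rw [Equiv.Perm.partition_eq_of_isConj]
    simp only [rep, dif_pos h]
    exact h.choose_spec
  let F : traceFunctionals n →ₗ[ℚ] (Fintype.card (Fin n)).Partition → ℚ :=
    { toFun := fun τ π => τ.1 (MonoidAlgebra.single (rep π) 1)
      map_add' := fun _ _ => rfl
      map_smul' := fun _ _ => rfl }
  have hF : Function.Injective F := by
    refine (injective_iff_map_eq_zero F).2 fun τ hτ => Subtype.ext (LinearMap.ext fun x => ?_)
    induction x using MonoidAlgebra.induction_linear with
    | zero => simp
    | add a b ha hb => rw [map_add, ha, hb, map_add]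
    | single σ r =>
      obtain ⟨g, hg⟩ := isConj_iff.1 (hrep σ)
      have h1 := τ.2 (MonoidAlgebra.single (g * rep σ.partition) 1) (MonoidAlgebra.single g⁻¹ 1)
      rw [MonoidAlgebra.single_mul_single, MonoidAlgebra.single_mul_single, hg,
        inv_mul_cancel_left, one_mul] at h1
      rw [← mul_one r, ← MonoidAlgebra.smul_single', map_smul, h1]
      have h2 : τ.1 (MonoidAlgebra.single (rep σ.partition) 1) = 0 := congrFun hτ σ.partition
      rw [h2, smul_zero]
      rfl
  have h := LinearMap.finrank_le_finrank_of_injective hF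
  rwa [Module.finrank_fintype_fun_eq_card, Fintype.card_fin] at h

/-- With enough pairwise orthogonal idempotents, a trace functional is determined by its values on
them. The character of the quotient by the ideal J they generate vanishes on all of them, so the
quotient has dimension 0. -/
theorem mem_span_of_card {I : Type*} [Fintype I] (hI : Fintype.card n.Partition ≤ Fintype.card I)
    {e : I → PermAlg n} (ne : ∀ i, e i ≠ 0) (idem : ∀ i, e i * e i = e i)
    (orth : ∀ i k x, i ≠ k → e i * x * e k = 0) :
    (1 : PermAlg n) ∈ Submodule.span ℚ {z | ∃ i x y, z = x * e i * y} := by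
  classical
  let Ev : traceFunctionals n →ₗ[ℚ] I → ℚ :=
    { toFun := fun τ i => τ.1 (e i)
      map_add' := fun _ _ => rfl
      map_smul' := fun _ _ => rfl }
  let L : PermAlg n →ₗ[ℚ] PermAlg n →ₗ[ℚ] PermAlg n := LinearMap.mul ℚ (PermAlg n)
  have hsurj : Function.Surjective Ev := by
    -- θ_i sends x to the trace of z ↦ x z e_i, the character of the left ideal generated by e_i. At
    -- e_k with k ≠ i the map is zero by orthogonality; at e_i it projects onto a nonzero corner.
    let θ : I → traceFunctionals n := fun i =>
      ⟨LinearMap.trace ℚ (PermAlg n) ∘ₗ L.compr₂ (L.flip (e i)), fun x y => by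
        have h1 : ∀ x y, (L.compr₂ (L.flip (e i))) (x * y) =
            L x * (L.compr₂ (L.flip (e i))) y := fun x y => LinearMap.ext fun z => by
          simp [L, mul_assoc]
        have h2 : ∀ x y, (L.compr₂ (L.flip (e i))) (x * y) =
            (L.compr₂ (L.flip (e i))) x * L y := fun x y => LinearMap.ext fun z => by
          simp [L, mul_assoc]
        rw [LinearMap.comp_apply, LinearMap.comp_apply, h1, h2, LinearMap.trace_mul_comm]⟩
    have hθ : ∀ i k, (θ i).1 (e k) = LinearMap.trace ℚ (PermAlg n)
        (L.compr₂ (L.flip (e i)) (e k)) := fun _ _ => rfl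
    have happ : ∀ i k x, L.compr₂ (L.flip (e i)) (e k) x = e k * x * e i := fun _ _ _ => rfl
    have hoff : ∀ i k, i ≠ k → (θ i).1 (e k) = 0 := fun i k hik => by
      rw [hθ, show L.compr₂ (L.flip (e i)) (e k) = 0 from LinearMap.ext fun x => by
        rw [happ, orth _ _ _ hik.symm]; rfl, map_zero]
    have hdiag : ∀ i, (θ i).1 (e i) ≠ 0 := fun i => by
      have hp : LinearMap.IsProj (corner (e i) (e i)) (L.compr₂ (L.flip (e i)) (e i)) :=
        ⟨fun x => mul_mul_mem_corner (idem i) (idem i) x, fun x hx => by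
          rw [happ, hx.1, hx.2]⟩
      rw [hθ, hp.trace, Nat.cast_ne_zero, ← Nat.pos_iff_ne_zero, Module.finrank_pos_iff]
      exact ⟨⟨e i, idem i, idem i⟩, 0, fun h => ne i (congrArg Subtype.val h)⟩
    intro f
    refine ⟨∑ i, (f i / (θ i).1 (e i)) • θ i, funext fun k => ?_⟩
    rw [map_sum, Finset.sum_apply, Finset.sum_eq_single k]
    · rw [map_smul, Pi.smul_apply, smul_eq_mul]
      exact div_mul_cancel₀ _ (hdiag k)
    · intro i _ hik
      rw [map_smul, Pi.smul_apply]
      refine (congrArg _ (hoff i k hik)).trans (smul_zero _)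
    · exact fun h => absurd (Finset.mem_univ k) h
  -- Surjectivity and the bound by the number of partitions force equal dimensions.
  have hinj : Function.Injective Ev := by
    have h1 := LinearMap.finrank_le_finrank_of_surjective hsurj
    rw [Module.finrank_fintype_fun_eq_card] at h1
    refine (LinearMap.injective_iff_surjective_of_finrank_eq_finrank ?_).2 hsurj
    rw [Module.finrank_fintype_fun_eq_card]
    exact le_antisymm (finrank_traceFunctionals_le.trans hI) h1
  let J : Submodule ℚ (PermAlg n) := Submodule.span ℚ {z | ∃ i x y, z = x * e i * y}
  have hJ : ∀ x, J ≤ J.comap (L x) := fun x => by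
    refine Submodule.span_le.2 ?_
    rintro _ ⟨i, a, b, rfl⟩
    exact Submodule.subset_span ⟨i, x * a, b, by simp [L, mul_assoc]⟩
  -- T is the character of the quotient by J; since e_i z lies in J, it vanishes at every e_i.
  let T : traceFunctionals n :=
    ⟨{ toFun := fun x => LinearMap.trace ℚ _ (J.mapQ J (L x) (hJ x))
       map_add' := fun x y => by
        rw [← map_add]
        congr 1
        refine Submodule.linearMap_qext _ (LinearMap.ext fun z => ?_)
        simp
       map_smul' := fun c x => by
        rw [RingHom.id_apply, ← map_smul]
        congr 1
        refine Submodule.linearMap_qext _ (LinearMap.ext fun z => ?_)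
        simp }, fun x y => by
      have h1 : ∀ x y, J.mapQ J (L (x * y)) (hJ (x * y)) =
          J.mapQ J (L x) (hJ x) * J.mapQ J (L y) (hJ y) := fun x y => by
        refine Submodule.linearMap_qext _ (LinearMap.ext fun z => ?_)
        simp [L, mul_assoc]
      change LinearMap.trace ℚ _ (J.mapQ J (L (x * y)) _) =
        LinearMap.trace ℚ _ (J.mapQ J (L (y * x)) _)
      rw [h1, h1, LinearMap.trace_mul_comm]⟩
  have hT : ∀ x, T.1 x = LinearMap.trace ℚ _ (J.mapQ J (L x) (hJ x)) := fun _ => rfl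
  have hT0 : T = 0 := hinj (by
    rw [map_zero]
    funext i
    change T.1 (e i) = 0
    rw [hT, show J.mapQ J (L (e i)) (hJ (e i)) = 0 from ?_, map_zero]
    refine Submodule.linearMap_qext _ (LinearMap.ext fun z => ?_)
    change Submodule.Quotient.mk (e i * z) = 0
    rw [Submodule.Quotient.mk_eq_zero]
    exact Submodule.subset_span ⟨i, 1, z, by rw [one_mul]⟩)
  by_contra hcon
  have h1 := hT 1
  rw [hT0, show J.mapQ J (L 1) (hJ 1) = LinearMap.id from ?_, LinearMap.trace_id] at h1
  · have h2 : Module.finrank ℚ (PermAlg n ⧸ J) = 0 :=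
      Nat.cast_eq_zero.1 (h1.symm : (_ : ℚ) = 0)
    rw [Module.finrank_zero_iff] at h2
    refine hcon ((Submodule.Quotient.mk_eq_zero J).1 (Subsingleton.elim _ _))
  · refine Submodule.linearMap_qext _ (LinearMap.ext fun z => ?_)
    simp [L]

/-- Each e_μ is a left multiple of the Young symmetrizer, so e_μ x e_ν contains a row symmetrizer of
μ, a middle term and a column antisymmetrizer of ν. The lemmas on such products give orthogonality
and the scalar property; fullness follows by counting. -/
theorem isCompleteSystem_schurIdempotent (n : ℕ) :
    IsCompleteSystem (schurIdempotent : n.Partition → PermAlg n) := by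
  have hmem : ∀ μ : n.Partition, ∃ y, y * youngSymmetrizer μ = schurIdempotent μ := fun μ => by
    have h : schurIdempotent μ ∈ spechtIdeal μ := by
      rw [spechtIdeal_eq]
      exact Ideal.mem_span_singleton_self _
    exact Ideal.mem_span_singleton'.1 h
  have ne : ∀ μ : n.Partition, schurIdempotent μ ≠ 0 := fun μ h0 => by
    have h : youngSymmetrizer μ ∈ spechtIdeal μ := Ideal.mem_span_singleton_self _
    rw [spechtIdeal_eq, h0] at h
    obtain ⟨y, hy⟩ := Ideal.mem_span_singleton'.1 h
    exact youngSymmetrizer_ne_zero μ (by rw [← hy, mul_zero])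
  have van : ∀ (μ ν : n.Partition), (∀ x, rowSymmetrizer μ * x * colAntisymmetrizer ν = 0) →
      ∀ x, schurIdempotent μ * x * schurIdempotent ν = 0 := by
    intro μ ν h x
    obtain ⟨y, hy⟩ := hmem μ
    obtain ⟨z, hz⟩ := hmem ν
    rw [← hy, ← hz, youngSymmetrizer, youngSymmetrizer]
    have := h (colAntisymmetrizer μ * x * z * rowSymmetrizer ν)
    simp only [mul_assoc] at this ⊢
    rw [this, mul_zero]
  have orth : ∀ (μ ν : n.Partition) x, μ ≠ ν →
      schurIdempotent μ * x * schurIdempotent ν = 0 := by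
    intro μ ν x hμν
    rcases row_mul_mul_col_eq_zero_or μ ν hμν with h | h
    · exact van μ ν h x
    -- Here the combinatorics gives vanishing only in the opposite order; equality of the dimensions
    -- of opposite corners transfers it.
    · have h1 : corner (schurIdempotent ν) (schurIdempotent μ) = ⊥ := by
        refine (Submodule.eq_bot_iff _).2 fun z hz => ?_
        have := van ν μ h z
        rwa [hz.1, hz.2] at this
      have h2 := finrank_corner_comm (schurIdempotent_mul_self μ) (schurIdempotent_mul_self ν)
      rw [h1, finrank_bot, Submodule.finrank_eq_zero] at h2
      have h3 := mul_mul_mem_corner (schurIdempotent_mul_self μ) (schurIdempotent_mul_self ν) x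
      rw [h2] at h3
      exact (Submodule.mem_bot ℚ).1 h3
  refine ⟨ne, schurIdempotent_mul_self, fun μ x => ?_, orth,
    mem_span_of_card le_rfl ne schurIdempotent_mul_self orth⟩
  obtain ⟨y, hy⟩ := hmem μ
  obtain ⟨s, hs⟩ := exists_row_mul_mul_col μ (colAntisymmetrizer μ * x * y * rowSymmetrizer μ)
  refine ⟨s, ?_⟩
  have h1 : schurIdempotent μ * x * schurIdempotent μ =
      y * (rowSymmetrizer μ * (colAntisymmetrizer μ * x * y * rowSymmetrizer μ) *
        colAntisymmetrizer μ) := by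
    conv_lhs => rw [← hy, youngSymmetrizer]
    simp only [mul_assoc]
  rw [h1, hs, mul_smul_comm, hy]

end TraceFunctionals

/-! ### Recognizing a direct sum from inclusions and projections. -/

section Biproducts

variable {C : Type u} [Category.{v} C] [Preadditive C] [HasFiniteBiproducts C]

open Classical in
/-- An object with the inclusions and projections of a direct sum is the direct sum. -/
def isoBiproductOf {J : Type} [Fintype J] {S : C} (F : J → C) (i : ∀ j, F j ⟶ S)
    (p : ∀ j, S ⟶ F j) (h₁ : ∀ j, i j ≫ p j = 𝟙 _) (h₂ : ∀ j k, j ≠ k → i j ≫ p k = 0)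
    (h₃ : ∑ j, p j ≫ i j = 𝟙 S) : S ≅ ⨁ F where
  hom := biproduct.lift p
  inv := biproduct.desc i
  hom_inv_id := by rw [biproduct.lift_desc, h₃]
  inv_hom_id := by
    refine biproduct.hom_ext' _ _ fun j => biproduct.hom_ext _ _ fun k => ?_
    rw [Category.comp_id, biproduct.ι_desc_assoc, Category.assoc, biproduct.lift_π,
      biproduct.ι_π]
    split_ifs with h
    · subst h
      rw [h₁, eqToHom_refl]
    · exact h₂ j k h

end Biproducts

/-! ### Representations given by left ideals, and their morphisms as corners. -/

section IdealRepresentations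

variable {n : ℕ}

theorem mem_span_idem {e : PermAlg n} (he : e * e = e) {y : PermAlg n} :
    y ∈ Ideal.span {e} ↔ y * e = y := by
  rw [Ideal.mem_span_singleton']
  constructor
  · rintro ⟨a, rfl⟩
    rw [mul_assoc, he]
  · exact fun h => ⟨y, h⟩

theorem mem_spechtIdeal {μ : n.Partition} {y : PermAlg n} :
    y ∈ spechtIdeal μ ↔ y * schurIdempotent μ = y := by
  rw [spechtIdeal_eq, mem_span_idem (schurIdempotent_mul_self μ)]

/-- A left ideal as an object of the category of representations. -/
abbrev idealObj (I : Ideal (PermAlg n)) : FDRep ℚ (Equiv.Perm (Fin n)) := FDRep.of (idealRep I)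

/-- The morphism of representations given by right multiplication. -/
def idealHom {I J : Ideal (PermAlg n)} (x : PermAlg n) (hx : ∀ y ∈ I, y * x ∈ J) :
    idealObj I ⟶ idealObj J :=
  repHom (V := idealObj I) (W := idealObj J)
    ({ toFun := fun y => ⟨(y : PermAlg n) * x, hx y y.2⟩
       map_add' := fun _ _ => Subtype.ext (add_mul _ _ _)
       map_smul' := fun _ _ => Subtype.ext (smul_mul_assoc _ _ _) } : I →ₗ[ℚ] J)
    fun g y => Subtype.ext (mul_assoc (MonoidAlgebra.single g 1) ((y : I) : PermAlg n) x)

theorem repLin_idealHom {I J : Ideal (PermAlg n)} (x : PermAlg n) (hx : ∀ y ∈ I, y * x ∈ J)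
    (y : I) : ((repLin (idealHom x hx) y : J) : PermAlg n) = (y : PermAlg n) * x := rfl

theorem idealHom_ext {I J : Ideal (PermAlg n)} {f g : idealObj I ⟶ idealObj J}
    (h : ∀ y : I, ((repLin f y : J) : PermAlg n) = ((repLin g y : J) : PermAlg n)) : f = g :=
  rep_ext (LinearMap.ext fun y => Subtype.ext (h y))

/-- The action of the group algebra on a representation. -/
abbrev algAct (V : FDRep ℚ (Equiv.Perm (Fin n))) : PermAlg n →ₐ[ℚ] Module.End ℚ V :=
  MonoidAlgebra.lift ℚ (Module.End ℚ V) (Equiv.Perm (Fin n)) V.ρ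

theorem algAct_single (V : FDRep ℚ (Equiv.Perm (Fin n))) (g : Equiv.Perm (Fin n)) (r : ℚ) (v : V) :
    algAct V (MonoidAlgebra.single g r) v = r • V.ρ g v := by
  rw [algAct, MonoidAlgebra.lift_single, LinearMap.smul_apply]

theorem repLin_algAct {V W : FDRep ℚ (Equiv.Perm (Fin n))} (f : V ⟶ W) (x : PermAlg n) (v : V) :
    repLin f (algAct V x v) = algAct W x (repLin f v) := by
  induction x using MonoidAlgebra.induction_linear with
  | zero => simp
  | add a b ha hb => simp only [map_add, LinearMap.add_apply, ha, hb]
  | single g r => rw [algAct_single, algAct_single, map_smul, repLin_equivariant]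

theorem algAct_idealObj (I : Ideal (PermAlg n)) (x : PermAlg n) (y : I) :
    ((algAct (idealObj I) x y : I) : PermAlg n) = x * y := by
  induction x using MonoidAlgebra.induction_linear with
  | zero => rw [map_zero, zero_mul]; rfl
  | add a b ha hb =>
    rw [map_add, add_mul, ← ha, ← hb]
    rfl
  | single g r =>
    refine (congrArg Subtype.val (algAct_single (idealObj I) g r y)).trans ?_
    change r • (MonoidAlgebra.single g 1 * (y : PermAlg n)) = _
    rw [← smul_mul_assoc, MonoidAlgebra.smul_single', mul_one]

/-- Morphisms between representations that are left ideals generated by idempotents. -/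
def idealHomEquiv {I J : Ideal (PermAlg n)} {e f : PermAlg n} (he : e * e = e)
    (hI : ∀ y, y ∈ I ↔ y * e = y) (hJ : ∀ y, y ∈ J ↔ y * f = y) :
    (idealObj I ⟶ idealObj J) ≃ₗ[ℚ] corner e f where
  -- A morphism is determined by the image of the generator e, and e = e · e forces that image to be
  -- fixed by e on the left.
  toFun F := ⟨(repLin F (⟨e, (hI e).2 he⟩ : I) : J), by
      have h1 := repLin_algAct F e (⟨e, (hI e).2 he⟩ : I)
      have h2 : algAct (idealObj I) e (⟨e, (hI e).2 he⟩ : I) = (⟨e, (hI e).2 he⟩ : I) :=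
        Subtype.ext ((algAct_idealObj I e _).trans he)
      rw [h2] at h1
      exact (algAct_idealObj J e _).symm.trans (congrArg Subtype.val h1.symm),
    (hJ _).1 (repLin F (⟨e, (hI e).2 he⟩ : I) : J).2⟩
  map_add' _ _ := rfl
  map_smul' _ _ := rfl
  invFun x := idealHom x fun y _ => (hJ _).2 (by rw [mul_assoc, x.2.2])
  left_inv F := idealHom_ext fun y => by
    rw [repLin_idealHom]
    have h1 := repLin_algAct F y (⟨e, (hI e).2 he⟩ : I)
    have h2 : algAct (idealObj I) (y : PermAlg n) (⟨e, (hI e).2 he⟩ : I) = y :=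
      Subtype.ext ((algAct_idealObj I y _).trans ((hI y).1 y.2))
    rw [h2] at h1
    exact (algAct_idealObj J y _).symm.trans (congrArg Subtype.val h1.symm)
  right_inv x := Subtype.ext x.2.1

end IdealRepresentations

/-! ### Induced representations as left ideals; the second claim. -/

section Induction

variable {p q n : ℕ} (h : p + q = n)

theorem youngEmb_injective : Function.Injective (youngEmb h) := by
  intro x y hxy
  refine Prod.ext (Equiv.ext fun i => ?_) (Equiv.ext fun i => ?_)
  · have h1 := DFunLike.congr_fun hxy (blockL h i)
    rw [← Prod.mk.eta (p := x), ← Prod.mk.eta (p := y), youngEmb_blockL, youngEmb_blockL] at h1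
    have h2 := congrArg Fin.val h1
    exact Fin.ext h2
  · have h1 := DFunLike.congr_fun hxy (blockR h i)
    rw [← Prod.mk.eta (p := x), ← Prod.mk.eta (p := y), youngEmb_blockR, youngEmb_blockR] at h1
    have h2 := congrArg Fin.val h1
    exact Fin.ext (Nat.add_left_cancel h2)

theorem algAct_indι (V : FDRep ℚ (Equiv.Perm (Fin p))) (W : FDRep ℚ (Equiv.Perm (Fin q)))
    (x : PermAlg p) (y : PermAlg q) (v : V) (w : W) :
    algAct (indProd h V W) (algMap (youngEmb h) (outer x y)) (indι h V W v w) =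
      indι h V W (algAct V x v) (algAct W y w) := by
  induction x using MonoidAlgebra.induction_linear with
  | zero => simp [zero_outer]
  | add a b ha hb =>
    rw [add_outer, map_add, map_add, LinearMap.add_apply, ha, hb, map_add, LinearMap.add_apply,
      map_add, LinearMap.add_apply]
  | single g r =>
    induction y using MonoidAlgebra.induction_linear with
    | zero => simp [outer_zero]
    | add a b ha hb =>
      rw [outer_add, map_add, map_add, LinearMap.add_apply, ha, hb, map_add (algAct W),
        LinearMap.add_apply, map_add]
    | single g' s =>
      rw [outer_single, algMap_single, algAct_single, algAct_single, algAct_single, rho_indι,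
        map_smul, map_smul, LinearMap.smul_apply, smul_smul, mul_comm]

/-- The idempotent that generates the representation induced from `V_μ ⊗ V_η`. -/
def indIdempotent (μ : p.Partition) (η : q.Partition) : PermAlg n :=
  algMap (youngEmb h) (outer (schurIdempotent μ) (schurIdempotent η))

theorem indIdempotent_mul_self (μ : p.Partition) (η : q.Partition) :
    indIdempotent h μ η * indIdempotent h μ η = indIdempotent h μ η := by
  rw [indIdempotent, ← map_mul, outer_mul_outer, schurIdempotent_mul_self, schurIdempotent_mul_self]

/-- The representation induced from `V_μ ⊗ V_η` is a left ideal of the group algebra. -/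
theorem nonempty_indProd_iso (μ : p.Partition) (η : q.Partition) :
    Nonempty (indProd h (specht μ) (specht η) ≅
      idealObj (Ideal.span {indIdempotent h μ η})) := by
  let e : spechtIdeal μ := ⟨schurIdempotent μ, mem_spechtIdeal.2 (schurIdempotent_mul_self μ)⟩
  let e' : spechtIdeal η := ⟨schurIdempotent η, mem_spechtIdeal.2 (schurIdempotent_mul_self η)⟩
  let J := Ideal.span {indIdempotent h μ η}
  have hJ : ∀ y, y ∈ J ↔ y * indIdempotent h μ η = y := fun y =>
    mem_span_idem (indIdempotent_mul_self h μ η)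
  let β : spechtIdeal μ →ₗ[ℚ] spechtIdeal η →ₗ[ℚ] J :=
    LinearMap.mk₂ ℚ (fun v w => ⟨algMap (youngEmb h) (outer (v : PermAlg p) (w : PermAlg q)),
      (hJ _).2 (by
        rw [indIdempotent, ← map_mul, outer_mul_outer, mem_spechtIdeal.1 v.2,
          mem_spechtIdeal.1 w.2])⟩)
      (fun v v' w => Subtype.ext (by
        refine (congrArg (algMap (youngEmb h)) (add_outer _ _ _)).trans ?_
        rw [map_add]; rfl))
      (fun c v w => Subtype.ext (by
        refine (congrArg (algMap (youngEmb h)) (smul_outer _ _ _)).trans ?_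
        rw [map_smul]; rfl))
      (fun v w w' => Subtype.ext (by
        refine (congrArg (algMap (youngEmb h)) (outer_add _ _ _)).trans ?_
        rw [map_add]; rfl))
      (fun c v w => Subtype.ext (by
        refine (congrArg (algMap (youngEmb h)) (outer_smul _ _ _)).trans ?_
        rw [map_smul]; rfl))
  have hβ : ∀ v w, ((β v w : J) : PermAlg n) =
    algMap (youngEmb h) (outer (v : PermAlg p) (w : PermAlg q)) := fun _ _ => rfl
  have hβ' : ∀ a b (v : spechtIdeal μ) (w : spechtIdeal η),
      β (idealRep _ a v) (idealRep _ b w) = idealRep J (youngEmb h (a, b)) (β v w) := by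
    intro a b v w
    refine Subtype.ext ((hβ _ _).trans ?_)
    change algMap (youngEmb h) (outer (MonoidAlgebra.single a 1 * (v : PermAlg p))
      (MonoidAlgebra.single b 1 * (w : PermAlg q))) =
      MonoidAlgebra.single (youngEmb h (a, b)) 1 *
        algMap (youngEmb h) (outer (v : PermAlg p) (w : PermAlg q))
    rw [← outer_mul_outer, map_mul, outer_single, algMap_single, one_mul]
  obtain ⟨F, hF⟩ := exists_indProd_lift h (V := specht μ) (W := specht η) (T := idealObj J) β hβ'
  let T := indProd h (specht μ) (specht η)
  let t : T := indι h (specht μ) (specht η) e e'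
  -- The inverse sends y to y · t, where t is the class of the pair of generating idempotents.
  let γ : J →ₗ[ℚ] T :=
    { toFun := fun y => algAct T (y : PermAlg n) t
      map_add' := fun y z => by
        rw [Submodule.coe_add, map_add]; rfl
      map_smul' := fun c y => by
        refine (congrArg (fun z => algAct T z t) (rfl : _ = c • (y : PermAlg n))).trans ?_
        rw [map_smul]; rfl }
  have hγ : ∀ y : J, γ y = algAct T (y : PermAlg n) t := fun _ => rfl
  let G : idealObj J ⟶ T := repHom (V := idealObj J) γ fun g y => by
    change algAct T (MonoidAlgebra.single g 1 * ((y : J) : PermAlg n)) t = T.ρ g (γ y)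
    rw [map_mul, Module.End.mul_apply, algAct_single, one_smul, hγ]
  have hG : ∀ y : J, repLin G y = algAct T (y : PermAlg n) t := fun _ => rfl
  have hGF : ∀ (v : spechtIdeal μ) (w : spechtIdeal η),
      algAct T (algMap (youngEmb h) (outer (v : PermAlg p) (w : PermAlg q))) t =
        indι h (specht μ) (specht η) v w := by
    intro v w
    have h1 : algAct (specht μ) (v : PermAlg p) e = v :=
      Subtype.ext ((algAct_idealObj _ _ e).trans (mem_spechtIdeal.1 v.2))
    have h2 : algAct (specht η) (w : PermAlg q) e' = w :=
      Subtype.ext ((algAct_idealObj _ _ e').trans (mem_spechtIdeal.1 w.2))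
    refine (algAct_indι h (specht μ) (specht η) _ _ e e').trans ?_
    rw [h1, h2]
  refine ⟨⟨F, G, indProd_hom_ext h fun v w => ?_, idealHom_ext fun y => ?_⟩⟩
  · rw [repLin_comp, hF]
    exact (hG _).trans ((congrArg (fun z => algAct T z t) (hβ v w)).trans (hGF v w))
  · rw [repLin_comp, hG, repLin_algAct]
    refine (algAct_idealObj J _ _).trans ?_
    have h1 : repLin F t = β e e' := hF e e'
    rw [h1, hβ]
    exact (hJ y).1 y.2

/-- Both representations are left ideals generated by idempotents, so their Hom space is a corner.
This makes bases of corners available as families indexed by the Littlewood–Richardson multiplicity.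
-/
theorem lrCoeff_eq (μ : p.Partition) (η : q.Partition) (π : n.Partition) :
    lrCoeff h μ η π = Module.finrank ℚ (corner (schurIdempotent π) (indIdempotent h μ η)) := by
  obtain ⟨i⟩ := nonempty_indProd_iso h μ η
  refine ((Linear.homCongr ℚ (Iso.refl (specht π)) i).finrank_eq).trans ?_
  exact (idealHomEquiv (I := spechtIdeal π) (schurIdempotent_mul_self π)
    (fun y => mem_spechtIdeal)
    (fun y => mem_span_idem (indIdempotent_mul_self h μ η))).finrank_eq

/-- Right multiplication by the elements v and w of the decomposition of the generating idempotent
gives the inclusions and projections. -/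
theorem nonempty_indProd_specht_iso (μ : p.Partition) (η : q.Partition) :
    Nonempty (indProd h (specht μ) (specht η) ≅
      ⨁ fun π : n.Partition => ⨁ fun _ : Fin (lrCoeff h μ η π) => specht π) := by
  obtain ⟨i⟩ := nonempty_indProd_iso h μ η
  obtain ⟨v, w, hv, hw, hvw, hvw', hwv⟩ :=
    (isCompleteSystem_schurIdempotent n).exists_decomposition (indIdempotent_mul_self h μ η)
  -- The coefficient counts morphisms out of V_π, whereas the decomposition is indexed by the
  -- opposite corner. The whole function is rewritten because it occurs in the index types.
  have hd : (fun π : n.Partition => lrCoeff h μ η π) = fun π : n.Partition =>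
      Module.finrank ℚ (corner (indIdempotent h μ η) (schurIdempotent π)) := funext fun π => by
    rw [lrCoeff_eq, finrank_corner_comm (schurIdempotent_mul_self π) (indIdempotent_mul_self h μ η)]
  change Nonempty (_ ≅ ⨁ fun π : n.Partition =>
    ⨁ fun _ : Fin ((fun π : n.Partition => lrCoeff h μ η π) π) => specht π)
  rw [hd]
  refine ⟨i ≪≫ isoBiproductOf (J := Σ π : n.Partition,
      Fin (Module.finrank ℚ (corner (indIdempotent h μ η) (schurIdempotent π))))
    (fun s => specht s.1)
    (fun s => idealHom (I := spechtIdeal s.1) (v s.1 s.2) fun y _ =>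
      (mem_span_idem (indIdempotent_mul_self h μ η)).2 (by rw [mul_assoc, (hv _ _).2]))
    (fun s => idealHom (J := spechtIdeal s.1) (w s.1 s.2) fun y _ =>
      mem_spechtIdeal.2 (by rw [mul_assoc, (hw _ _).2]))
    (fun s => idealHom_ext fun y => ?_) (fun s s' hs => idealHom_ext fun y => ?_)
    (idealHom_ext fun y => ?_) ≪≫ (biproductBiproductIso _ fun π _ => specht π).symm⟩
  · refine (mul_assoc (y : PermAlg n) (v s.1 s.2) (w s.1 s.2)).trans ?_
    rw [hvw', if_pos rfl]
    exact mem_spechtIdeal.1 y.2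
  · refine (mul_assoc (y : PermAlg n) (v s.1 s.2) (w s'.1 s'.2)).trans ?_
    obtain ⟨π, a⟩ := s
    obtain ⟨π', a'⟩ := s'
    by_cases hπ : π = π'
    · subst hπ
      rw [hvw', if_neg fun h => hs (congrArg (Sigma.mk π) h), mul_zero]
      rfl
    · rw [hvw _ _ _ _ hπ, mul_zero]
      rfl
  · have hsum : ∀ (J : Ideal (PermAlg n)) {S : Type} [Fintype S]
        (φ : S → (idealObj J ⟶ idealObj J)) (x : S → PermAlg n)
        (hx : ∀ s (y : J), ((repLin (φ s) y : J) : PermAlg n) = (y : PermAlg n) * x s) (y : J),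
        ((repLin (∑ s, φ s) y : J) : PermAlg n) = (y : PermAlg n) * ∑ s, x s := by
      intro J S _ φ x hx y
      let ev : (idealObj J ⟶ idealObj J) →+ PermAlg n :=
        { toFun := fun f => ((repLin f y : J) : PermAlg n)
          map_zero' := rfl
          map_add' := fun _ _ => rfl }
      refine (map_sum ev φ Finset.univ).trans ?_
      rw [Finset.mul_sum]
      exact Finset.sum_congr rfl fun s _ => hx s y
    refine Eq.trans (hsum (Ideal.span {indIdempotent h μ η}) _ (fun s : (Σ π : n.Partition,
      Fin (Module.finrank ℚ (corner (indIdempotent h μ η) (schurIdempotent π)))) =>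
      w s.1 s.2 * v s.1 s.2) (fun s y => ?_) y) ?_
    · exact mul_assoc (y : PermAlg n) _ _
    rw [Fintype.sum_sigma, hwv]
    exact (mem_span_idem (indIdempotent_mul_self h μ η)).1 y.2

end Induction

/-! ### Naturality of the symmetric group action and its compatibility with concatenation. -/

section TensorFamilies

variable {A : Type u} [Category.{v} A] [MonoidalCategory A] [SymmetricCategory A]

/-- The tensor product of a family of morphisms. -/
def tensorFam {X Z : A} : ∀ {n : ℕ}, (Fin n → (X ⟶ Z)) → (tensorPow X n ⟶ tensorPow Z n)
  | 0, _ => 𝟙 _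
  | _ + 1, f => f 0 ⊗ₘ tensorFam fun i => f i.succ

theorem tensorFam_succ {X Z : A} {n : ℕ} (f : Fin (n + 1) → (X ⟶ Z)) :
    tensorFam f = f 0 ⊗ₘ tensorFam fun i => f i.succ := rfl

theorem tensorFam_comp {X Y Z : A} {n : ℕ} (f : Fin n → (X ⟶ Y)) (g : Fin n → (Y ⟶ Z)) :
    tensorFam f ≫ tensorFam g = tensorFam fun i => f i ≫ g i := by
  induction n with
  | zero => exact Category.comp_id _
  | succ n ih =>
    rw [tensorFam_succ, tensorFam_succ, tensorFam_succ, ← ih]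
    exact (tensorHom_comp_tensorHom _ _ _ _)

theorem tensorFam_id (X : A) (n : ℕ) : (tensorFam fun _ : Fin n => 𝟙 X) = 𝟙 (tensorPow X n) := by
  induction n with
  | zero => rfl
  | succ n ih =>
    rw [tensorFam_succ, ih]
    exact id_tensorHom_id _ _

/-- Multiplication in `End` is composition in the order opposite to `≫`; hence the reversal here and
in every later translation from algebra to morphisms. -/
theorem tensorPowAction_mul (X : A) {n : ℕ} (σ τ : Equiv.Perm (Fin n)) :
    tensorPowAction X n (σ * τ) = tensorPowAction X n τ ≫ tensorPowAction X n σ := map_mul _ _ _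

theorem towerAct_permLift {M : ℕ → Type*} [∀ n, Monoid (M n)] (L : ∀ n, M n →* M (n + 1))
    (t : ∀ n, M (n + 2)) (n : ℕ) (τ : Equiv.Perm (Fin n)) :
    towerAct L t (n + 1) (permLift n τ) = L n (towerAct L t n τ) := by
  have h := towerAct_cycle_mul_lift L t n 0 τ
  rwa [towerCycle_zero, towerCycle_zero, one_mul, one_mul] at h

theorem tensorPowAction_permLift (X : A) {n : ℕ} (τ : Equiv.Perm (Fin n)) :
    tensorPowAction X (n + 1) (permLift n τ) = X ◁ tensorPowAction X n τ :=
  towerAct_permLift (M := fun n => End (tensorPow X n))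
    (fun n => whiskerLeftEnd X (tensorPow X n)) (fun n => swapFirst X (tensorPow X n)) n τ

theorem tensorPowAction_swap (X : A) (n : ℕ) :
    tensorPowAction X (n + 2) (Equiv.swap 0 1) = swapFirst X (tensorPow X n) :=
  towerHom_swap (M := fun n => End (tensorPow X n)) (fun n => whiskerLeftEnd X (tensorPow X n))
    (fun n => swapFirst X (tensorPow X n)) (fun n => swapFirst_sq X (tensorPow X n))
    (fun _ f => swapFirst_natural X f) (fun n => swapFirst_braid X (tensorPow X n)) (n + 2) 0

/-- Induction on permutations: products of lifts of adjacent transpositions. -/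
theorem perm_induction {P : ∀ n, Equiv.Perm (Fin n) → Prop} (one : ∀ n, P n 1)
    (mul : ∀ n σ τ, P n σ → P n τ → P n (σ * τ)) (swap : ∀ n, P (n + 2) (Equiv.swap 0 1))
    (lift : ∀ n σ, P n σ → P (n + 1) (permLift n σ)) (n : ℕ) (σ : Equiv.Perm (Fin n)) : P n σ := by
  have gen : ∀ n i, P n (towerSwap permLift (fun _ => Equiv.swap 0 1) n i) := by
    intro n
    induction n with
    | zero => intro i; exact one 0
    | succ n ih =>
      intro i
      cases i with
      | zero =>
        cases n with
        | zero => exact one 1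
        | succ n => exact swap n
      | succ i =>
        rw [towerSwap_succ]
        exact lift _ _ (ih i)
  have : σ ∈ Submonoid.closure (Set.range (towerSwap permLift (fun _ => Equiv.swap 0 1) n)) :=
    permSwap_closure n ▸ Submonoid.mem_top σ
  induction this using Submonoid.closure_induction with
  | mem x hx =>
    obtain ⟨i, rfl⟩ := hx
    exact gen n i
  | one => exact one n
  | mul x y _ _ hx hy => exact mul n x y hx hy

theorem swapFirst_comp {X Z P Q : A} (f g : X ⟶ Z) (k : P ⟶ Q) :
    swapFirst X P ≫ (f ⊗ₘ (g ⊗ₘ k)) = (g ⊗ₘ (f ⊗ₘ k)) ≫ swapFirst Z Q := by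
  have h : (β_ X X).hom ▷ P ≫ ((f ⊗ₘ g) ⊗ₘ k) = ((g ⊗ₘ f) ⊗ₘ k) ≫ (β_ Z Z).hom ▷ Q := by
    rw [← tensorHom_id, ← tensorHom_id, tensorHom_comp_tensorHom, tensorHom_comp_tensorHom,
      BraidedCategory.braiding_naturality, Category.id_comp, Category.comp_id]
  rw [swapFirst, swapFirst, Category.assoc, Category.assoc, ← associator_naturality,
    reassoc_of% h, associator_inv_naturality_assoc]

/-- By `perm_induction` it suffices to treat the first transposition, where this is naturality of
the braiding, and lifts, where one factor is split off. -/
theorem tensorPowAction_comp_tensorFam {X Z : A} {n : ℕ} (σ : Equiv.Perm (Fin n))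
    (f : Fin n → (X ⟶ Z)) :
    tensorPowAction X n σ ≫ tensorFam f =
      (tensorFam fun i => f (σ i)) ≫ tensorPowAction Z n σ := by
  induction n, σ using perm_induction with
  | one n =>
    rw [map_one, map_one]
    exact (Category.id_comp _).trans (Category.comp_id _).symm
  | mul n σ τ hσ hτ =>
    rw [tensorPowAction_mul, tensorPowAction_mul, Category.assoc, hσ, ← Category.assoc, hτ,
      Category.assoc]
    rfl
  | swap n =>
    rw [tensorPowAction_swap, tensorPowAction_swap, tensorFam_succ, tensorFam_succ, tensorFam_succ,
      tensorFam_succ]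
    refine (swapFirst_comp _ _ _).trans ?_
    have h : ∀ i : Fin n, Equiv.swap (0 : Fin (n + 2)) 1 i.succ.succ = i.succ.succ := fun i =>
      Equiv.swap_apply_of_ne_of_ne (Fin.succ_ne_zero _) fun h =>
        Fin.succ_ne_zero i (Fin.succ_injective _ h)
    simp only [h, Equiv.swap_apply_left]
    rw [show Equiv.swap (0 : Fin (n + 2)) 1 (Fin.succ 0) = 0 from Equiv.swap_apply_right _ _]
    rfl
  | lift n σ hσ =>
    rw [tensorPowAction_permLift, tensorPowAction_permLift, tensorFam_succ, tensorFam_succ]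
    simp only [permLift_zero, permLift_succ]
    rw [← id_tensorHom, ← id_tensorHom]
    refine (tensorHom_comp_tensorHom _ _ _ _).trans ((?_ : _ = _).trans
      (tensorHom_comp_tensorHom _ _ _ _).symm)
    rw [Category.id_comp, Category.comp_id, hσ]

/-- The isomorphism `Z^{⊗ p} ⊗ Z^{⊗ q} ≅ Z^{⊗ n}` for `p + q = n`. -/
def catIso (Z : A) : ∀ {p q n : ℕ}, p + q = n → (tensorPow Z p ⊗ tensorPow Z q ≅ tensorPow Z n)
  | 0, _, _, h => λ_ _ ≪≫ eqToIso (congrArg (tensorPow Z) ((Nat.zero_add _).symm.trans h))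
  | p + 1, q, 0, h => absurd h (by omega)
  | p + 1, q, n + 1, h => α_ _ _ _ ≪≫ whiskerLeftIso Z (catIso Z (show p + q = n by omega))

theorem catIso_zero (Z : A) (q : ℕ) : catIso Z (Nat.zero_add q) = λ_ _ := by
  rw [catIso, eqToIso_refl]
  exact Iso.trans_refl _

/-- This is the common inductive step for moving morphisms through `catIso`, which is built by
adding one factor on the left. -/
theorem tensorHom_associator_whiskerLeft {X Z P Q N P' Q' N' : A} (f : X ⟶ Z) (a : P ⟶ P')
    (b : Q ⟶ Q') (m : N ⟶ N') (k : P ⊗ Q ⟶ N) (k' : P' ⊗ Q' ⟶ N')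
    (h : (a ⊗ₘ b) ≫ k' = k ≫ m) :
    ((f ⊗ₘ a) ⊗ₘ b) ≫ ((α_ Z P' Q').hom ≫ Z ◁ k') = ((α_ X P Q).hom ≫ X ◁ k) ≫ (f ⊗ₘ m) := by
  rw [associator_naturality_assoc, Category.assoc, ← id_tensorHom, ← id_tensorHom,
    tensorHom_comp_tensorHom, tensorHom_comp_tensorHom, h, Category.id_comp, Category.comp_id]

theorem leftUnitor_comp {Q Q' : A} (b : Q ⟶ Q') :
    (𝟙 (𝟙_ A) ⊗ₘ b) ≫ (λ_ Q').hom = (λ_ Q).hom ≫ b := by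
  rw [id_tensorHom, leftUnitor_naturality]

/-- The swap touches only the first two factors, so it commutes with k by naturality; the rest is
coherence. -/
theorem swapFirst_associator_whiskerLeft (Z : A) {P Q N : A} (k : P ⊗ Q ⟶ N) :
    (swapFirst Z P ⊗ₘ 𝟙 Q) ≫ ((α_ Z (Z ⊗ P) Q).hom ≫ Z ◁ ((α_ Z P Q).hom ≫ Z ◁ k)) =
      ((α_ Z (Z ⊗ P) Q).hom ≫ Z ◁ ((α_ Z P Q).hom ≫ Z ◁ k)) ≫ swapFirst Z N := by
  rw [MonoidalCategory.whiskerLeft_comp, Category.assoc, Category.assoc, swapFirst_natural,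
    tensorHom_id]
  simp only [← Category.assoc]
  congr 1
  simp only [swapFirst]
  simp

theorem tensorFam_catIso {X Z : A} {p q n : ℕ} (h : p + q = n) (f : Fin n → (X ⟶ Z)) :
    (tensorFam (fun i => f (blockL h i)) ⊗ₘ tensorFam fun i => f (blockR h i)) ≫
      (catIso Z h).hom = (catIso X h).hom ≫ tensorFam f := by
  induction p generalizing n with
  | zero =>
    obtain rfl : q = n := by omega
    have hR : ∀ i, blockR h i = i := fun i => by ext; simp [blockR]
    simp only [hR]
    rw [catIso_zero, catIso_zero]
    exact leftUnitor_comp (tensorFam f)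
  | succ p ih =>
    obtain ⟨n, rfl⟩ : ∃ m, n = m + 1 := ⟨n - 1, by omega⟩
    have h' : p + q = n := by omega
    have hR : ∀ i, blockR h i = (blockR h' i).succ := fun i => by
      ext; simp only [blockR, Fin.val_succ]; omega
    simp only [hR]
    exact tensorHom_associator_whiskerLeft (f 0) _ _ _ _ _ (ih h' fun i => f i.succ)

theorem youngEmb_permLift {p q n : ℕ} (h : p + q = n) (h' : p + 1 + q = n + 1)
    (a : Equiv.Perm (Fin p)) (b : Equiv.Perm (Fin q)) :
    youngEmb h' (permLift p a, b) = permLift n (youngEmb h (a, b)) := by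
  have hL0 : blockL h' 0 = 0 := rfl
  have hL : ∀ i, blockL h' (Fin.succ i) = (blockL h i).succ := fun i => rfl
  have hR : ∀ i, blockR h' i = (blockR h i).succ := fun i => by
    ext; simp only [blockR, Fin.val_succ]; omega
  ext1 x
  rcases block_cases h' x with ⟨y, rfl⟩ | ⟨z, rfl⟩
  · rw [youngEmb_blockL]
    induction y using Fin.cases with
    | zero => rfl
    | succ y => rw [permLift_succ, hL, hL, permLift_succ, youngEmb_blockL]
  · rw [youngEmb_blockR, hR, hR, permLift_succ, youngEmb_blockR]

theorem youngEmb_swap {p q n : ℕ} (h : p + 2 + q = n + 2) :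
    youngEmb h (Equiv.swap 0 1, 1) = Equiv.swap 0 1 := by
  have hL : Function.Injective (blockL h) := fun x y hxy => by
    have h2 := congrArg Fin.val hxy
    exact Fin.ext h2
  ext1 x
  rcases block_cases h x with ⟨y, rfl⟩ | ⟨z, rfl⟩
  · rw [youngEmb_blockL, ← hL.swap_apply]
    rfl
  · rw [youngEmb_blockR, Equiv.Perm.one_apply, Equiv.swap_apply_of_ne_of_ne]
    · exact fun h0 => by have := congrArg Fin.val h0; simp [blockR] at this
    · exact fun h0 => by
        have := congrArg Fin.val h0
        simp [blockR] at this
        omega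

/-- The first block is inert, so induction on its length strips off one factor at a time. -/
theorem id_tensorHom_catIso (Z : A) {p q n : ℕ} (h : p + q = n) (b : Equiv.Perm (Fin q)) :
    (𝟙 (tensorPow Z p) ⊗ₘ tensorPowAction Z q b) ≫ (catIso Z h).hom =
      (catIso Z h).hom ≫ tensorPowAction Z n (youngEmb h (1, b)) := by
  induction p generalizing n with
  | zero =>
    obtain rfl : q = n := by omega
    rw [youngEmb_zero, catIso_zero]
    exact leftUnitor_comp (tensorPowAction Z q b)
  | succ p ih =>
    obtain ⟨n, rfl⟩ : ∃ m, n = m + 1 := ⟨n - 1, by omega⟩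
    have h' : p + q = n := by omega
    have h1 := tensorHom_associator_whiskerLeft (𝟙 Z) _ _ _ _ _ (ih h')
    rw [id_tensorHom_id, id_tensorHom Z (tensorPowAction Z n (youngEmb h' (1, b)))] at h1
    rw [← map_one (permLift p), youngEmb_permLift h' h, tensorPowAction_permLift]
    exact h1

/-- Here the induction runs over the permutation itself. The sizes q and n are quantified afterwards
because the lifting step changes p and n. -/
theorem tensorHom_id_catIso (Z : A) {p : ℕ} (a : Equiv.Perm (Fin p)) :
    ∀ {q n : ℕ} (h : p + q = n),
    (tensorPowAction Z p a ⊗ₘ 𝟙 (tensorPow Z q)) ≫ (catIso Z h).hom =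
      (catIso Z h).hom ≫ tensorPowAction Z n (youngEmb h (a, 1)) := by
  induction p, a using perm_induction with
  | one p =>
    intro q n h
    rw [← Prod.one_eq_mk, map_one, map_one, map_one]
    refine Eq.trans ?_ (Category.comp_id _).symm
    refine Eq.trans ?_ (Category.id_comp _)
    congr 1
    exact id_tensorHom_id _ _
  | mul p σ τ hσ hτ =>
    intro q n h
    have : ((σ * τ, 1) : Equiv.Perm (Fin p) × Equiv.Perm (Fin q)) = (σ, 1) * (τ, 1) := by simp
    rw [this, map_mul (youngEmb h), tensorPowAction_mul, tensorPowAction_mul,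
      ← Category.comp_id (𝟙 (tensorPow Z q)), ← tensorHom_comp_tensorHom, Category.assoc, hσ,
      reassoc_of% (hτ h)]
  | swap p =>
    intro q n h
    obtain ⟨n, rfl⟩ : ∃ m, n = m + 2 := ⟨n - 2, by omega⟩
    rw [youngEmb_swap, tensorPowAction_swap, tensorPowAction_swap]
    exact swapFirst_associator_whiskerLeft Z (catIso Z (show p + q = n by omega)).hom
  | lift p σ hσ =>
    intro q n h
    obtain ⟨n, rfl⟩ : ∃ m, n = m + 1 := ⟨n - 1, by omega⟩
    have h' : p + q = n := by omega
    have h1 := tensorHom_associator_whiskerLeft (𝟙 Z) _ _ _ _ _ (hσ h')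
    rw [id_tensorHom, id_tensorHom] at h1
    rw [youngEmb_permLift h' h, tensorPowAction_permLift, tensorPowAction_permLift]
    exact h1

theorem tensorHom_catIso (Z : A) {p q n : ℕ} (h : p + q = n) (a : Equiv.Perm (Fin p))
    (b : Equiv.Perm (Fin q)) :
    (tensorPowAction Z p a ⊗ₘ tensorPowAction Z q b) ≫ (catIso Z h).hom =
      (catIso Z h).hom ≫ tensorPowAction Z n (youngEmb h (a, b)) := by
  have h1 : ((a, b) : Equiv.Perm (Fin p) × Equiv.Perm (Fin q)) = (1, b) * (a, 1) := by simp
  have h2 : tensorPowAction Z p a ⊗ₘ tensorPowAction Z q b =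
      (tensorPowAction Z p a ⊗ₘ 𝟙 _) ≫ (𝟙 _ ⊗ₘ tensorPowAction Z q b) := by
    rw [tensorHom_comp_tensorHom, Category.comp_id, Category.id_comp]
  rw [h1, map_mul (youngEmb h), tensorPowAction_mul, h2, Category.assoc, id_tensorHom_catIso,
    ← Category.assoc, tensorHom_id_catIso, Category.assoc]

end TensorFamilies

/-! ### Young subgroups and words in two letters. -/

section Blocks

variable {p q n : ℕ} (h : p + q = n)

/-- The Young subgroup is the stabilizer of the first block. -/
theorem mem_range_youngEmb (g : Equiv.Perm (Fin n))
    (hg : ∀ i, (g i : ℕ) < p ↔ (i : ℕ) < p) : g ∈ Set.range (youngEmb h) := by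
  let e : Fin p ⊕ Fin q ≃ Fin n := finSumFinEquiv.trans (finCongr h)
  have hL : ∀ i, e (Sum.inl i) = blockL h i := fun i => by ext; simp [e, blockL]
  have hR : ∀ i, e (Sum.inr i) = blockR h i := fun i => by ext; simp [e, blockR]
  let τ : Equiv.Perm (Fin p ⊕ Fin q) := e.symm.permCongr g
  have hτ : ∀ x, e (τ x) = g (e x) := fun x => by simp [τ, Equiv.permCongr_apply]
  have hmem : τ ∈ (Equiv.Perm.sumCongrHom (Fin p) (Fin q)).range := by
    refine Equiv.Perm.mem_sumCongrHom_range_of_perm_mapsTo_inl ?_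
    rintro _ ⟨i, rfl⟩
    have h1 := hτ (Sum.inl i)
    have h2 : ((g (blockL h i) : Fin n) : ℕ) < p := (hg _).2 i.2
    rw [← hL, ← h1] at h2
    rcases hx : τ (Sum.inl i) with j | j
    · exact ⟨j, rfl⟩
    · rw [hx, hR] at h2
      simp [blockR] at h2
  obtain ⟨ab, hab⟩ := hmem
  refine ⟨ab, Equiv.ext fun x => ?_⟩
  have h1 : youngEmb h ab x = e (Equiv.Perm.sumCongrHom _ _ ab (e.symm x)) := rfl
  rw [h1, hab, hτ, Equiv.apply_symm_apply]

/-- The word whose first `p` letters are `true` and whose other letters are `false`. -/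
def blockWord (p n : ℕ) (i : Fin n) : Bool := decide ((i : ℕ) < p)

theorem exists_blockWord (w : Fin n → Bool) :
    ∃ (p q : ℕ) (_ : p + q = n) (g : Equiv.Perm (Fin n)), ∀ i, w i = blockWord p n (g i) := by
  classical
  -- The block length is the number of letters `true`; a bijection between the two sets of positions
  -- extends to a permutation of all letters.
  let p := (Finset.univ.filter fun i => w i = true).card
  have hp : p ≤ n := (Finset.card_le_univ _).trans (Fintype.card_fin n).le
  have hc : Fintype.card {i // w i = true} = Fintype.card {i : Fin n // (i : ℕ) < p} := by
    rw [Fintype.card_subtype, Fintype.card_subtype, Fin.card_filter_val_lt, min_eq_right hp]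
  let e := Fintype.equivOfCardEq hc
  refine ⟨p, n - p, by omega, e.extendSubtype, fun i => ?_⟩
  by_cases hi : w i = true
  · rw [hi, blockWord]
    exact (decide_eq_true (e.extendSubtype_mem i hi)).symm
  · rw [Bool.eq_false_of_not_eq_true hi, blockWord]
    exact (decide_eq_false (e.extendSubtype_not_mem i hi)).symm

theorem eq_of_blockWord {p' q' : ℕ} (h : p + q = n) (h' : p' + q' = n) (g : Equiv.Perm (Fin n))
    (hg : ∀ i, blockWord p n i = blockWord p' n (g i)) : p = p' := by
  have h1 : (Finset.univ.filter fun i : Fin n => (i : ℕ) < p).card =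
      (Finset.univ.filter fun i : Fin n => (i : ℕ) < p').card := by
    have hg' : ∀ i : Fin n, (i : ℕ) < p ↔ (g i : ℕ) < p' := fun i => by
      have := hg i
      simpa [blockWord] using this
    refine Finset.card_bij (fun i _ => g i) (fun i hi => ?_) (fun i _ k _ hik => g.injective hik)
      (fun i hi => ⟨g⁻¹ i, ?_, perm_apply_inv g i⟩)
    · simpa [← hg'] using hi
    · simp only [Finset.mem_filter, Finset.mem_univ, true_and] at hi ⊢
      rwa [hg', perm_apply_inv]
  rw [Fin.card_filter_val_lt, Fin.card_filter_val_lt] at h1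
  omega

end Blocks

/-! ### Splitting the tensor powers of a direct sum. -/

section PowersOfSums

variable {A : Type u} [Category.{v} A] [Preadditive A] [HasFiniteBiproducts A]
  [MonoidalCategory A] [MonoidalPreadditive A] [SymmetricCategory A]

theorem tensorFam_eq_zero {X Z : A} {n : ℕ} (f : Fin n → (X ⟶ Z)) (i : Fin n) (hi : f i = 0) :
    tensorFam f = 0 := by
  induction n with
  | zero => exact i.elim0
  | succ n ih =>
    rw [tensorFam_succ]
    induction i using Fin.cases with
    | zero =>
      rw [hi]
      exact MonoidalPreadditive.zero_tensor _
    | succ i =>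
      rw [ih (fun i => f i.succ) i hi]
      exact MonoidalPreadditive.tensor_zero _

/-- This is the distributive law: a tensor power of a sum of two morphisms expands over words. -/
theorem sum_tensorFam {X Z : A} (f : Bool → (X ⟶ Z)) (n : ℕ) :
    ∑ w : Fin n → Bool, tensorFam (fun i => f (w i)) = tensorFam fun _ : Fin n => ∑ b, f b := by
  induction n with
  | zero =>
    rw [Fintype.sum_unique]
    rfl
  | succ n ih =>
    rw [tensorFam_succ, ← ih, ← (Fin.consEquiv fun _ => Bool).sum_comp, Fintype.sum_prod_type]
    refine Eq.trans ?_ (sum_tensor _ _ _).symm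
    refine Finset.sum_congr rfl fun b _ => ?_
    refine Eq.trans ?_ (tensor_sum _ _ _).symm
    rfl

variable (X Y : A)

/-- The idempotents of the two summands of `X ⊕ Y`. -/
def summand : Bool → (X ⊞ Y ⟶ X ⊞ Y)
  | true => biprod.fst ≫ biprod.inl
  | false => biprod.snd ≫ biprod.inr

theorem summand_comp_of_ne {b c : Bool} (h : b ≠ c) : summand X Y b ≫ summand X Y c = 0 := by
  cases b <;> cases c <;> simp_all [summand]

theorem sum_summand : ∑ b, summand X Y b = 𝟙 (X ⊞ Y) := by
  rw [Fintype.sum_bool]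
  exact biprod.total

variable {p q n : ℕ} (h : p + q = n)

/-- The inclusion of `X^{⊗ p} ⊗ Y^{⊗ q}` into `(X ⊕ Y)^{⊗ n}`. -/
def blockIncl : tensorPow X p ⊗ tensorPow Y q ⟶ tensorPow (X ⊞ Y) n :=
  (tensorFam (fun _ => biprod.inl) ⊗ₘ tensorFam fun _ => biprod.inr) ≫ (catIso (X ⊞ Y) h).hom

/-- The projection of `(X ⊕ Y)^{⊗ n}` to `X^{⊗ p} ⊗ Y^{⊗ q}`. -/
def blockProj : tensorPow (X ⊞ Y) n ⟶ tensorPow X p ⊗ tensorPow Y q :=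
  (catIso (X ⊞ Y) h).inv ≫ (tensorFam (fun _ => biprod.fst) ⊗ₘ tensorFam fun _ => biprod.snd)

theorem blockIncl_blockProj : blockIncl X Y h ≫ blockProj X Y h = 𝟙 _ := by
  rw [blockIncl, blockProj, Category.assoc, Iso.hom_inv_id_assoc, tensorHom_comp_tensorHom,
    tensorFam_comp, tensorFam_comp]
  simp only [biprod.inl_fst, biprod.inr_snd, tensorFam_id, id_tensorHom_id]

/-- The idempotent on `(X ⊕ Y)^{⊗ n}` that belongs to a word in the letters `X` and `Y`. -/
def wordIdem (w : Fin n → Bool) : tensorPow (X ⊞ Y) n ⟶ tensorPow (X ⊞ Y) n :=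
  tensorFam fun i => summand X Y (w i)

theorem blockProj_blockIncl :
    blockProj X Y h ≫ blockIncl X Y h = wordIdem X Y (blockWord p n) := by
  rw [blockIncl, blockProj, Category.assoc, reassoc_of% (tensorHom_comp_tensorHom
    (tensorFam (n := p) fun _ => (biprod.fst : X ⊞ Y ⟶ X))
    (tensorFam (n := q) fun _ => (biprod.snd : X ⊞ Y ⟶ Y))
    (tensorFam (n := p) fun _ => biprod.inl) (tensorFam (n := q) fun _ => biprod.inr)),
    tensorFam_comp, tensorFam_comp, Iso.inv_comp_eq, wordIdem, ← tensorFam_catIso h]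
  have hL : ∀ i, blockWord p n (blockL h i) = true := fun i => by simp [blockWord, blockL]
  have hR : ∀ i, blockWord p n (blockR h i) = false := fun i => by simp [blockWord, blockR]
  simp only [hL, hR]
  rfl

theorem wordIdem_comp_of_ne {w w' : Fin n → Bool} (hw : w ≠ w') :
    wordIdem X Y w ≫ wordIdem X Y w' = 0 := by
  obtain ⟨i, hi⟩ := Function.ne_iff.1 hw
  rw [wordIdem, wordIdem, tensorFam_comp]
  exact tensorFam_eq_zero _ i (summand_comp_of_ne X Y hi)

theorem sum_wordIdem : ∑ w : Fin n → Bool, wordIdem X Y w = 𝟙 (tensorPow (X ⊞ Y) n) := by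
  simp only [wordIdem]
  rw [sum_tensorFam, sum_summand, tensorFam_id]

theorem action_wordIdem (g : Equiv.Perm (Fin n)) (w : Fin n → Bool) :
    tensorPowAction (X ⊞ Y) n g ≫ wordIdem X Y w =
      wordIdem X Y (w ∘ g) ≫ tensorPowAction (X ⊞ Y) n g :=
  tensorPowAction_comp_tensorFam g fun i => summand X Y (w i)

/-- Word idempotents can be inserted at both ends. Moving g past one of them permutes its word, and
idempotents of different words compose to zero. -/
theorem blockIncl_action_blockProj_eq_zero {p' q' : ℕ} (h' : p' + q' = n)
    (g : Equiv.Perm (Fin n)) (hg : blockWord p n ≠ blockWord p' n ∘ g) :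
    blockIncl X Y h ≫ tensorPowAction (X ⊞ Y) n g ≫ blockProj X Y h' = 0 := by
  rw [← Category.id_comp (blockIncl X Y h), ← Category.comp_id (blockProj X Y h'),
    ← blockIncl_blockProj X Y h, ← blockIncl_blockProj X Y h', Category.assoc, Category.assoc,
    reassoc_of% (blockProj_blockIncl X Y h), reassoc_of% (blockProj_blockIncl X Y h'),
    reassoc_of% (action_wordIdem X Y g (blockWord p' n)),
    reassoc_of% (wordIdem_comp_of_ne X Y hg), zero_comp, comp_zero]

theorem blockIncl_action_blockProj_of_ne {p' q' : ℕ} (h' : p' + q' = n) (hp : p ≠ p')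
    (g : Equiv.Perm (Fin n)) :
    blockIncl X Y h ≫ tensorPowAction (X ⊞ Y) n g ≫ blockProj X Y h' = 0 :=
  blockIncl_action_blockProj_eq_zero X Y h h' g fun hg =>
    hp (eq_of_blockWord h h' g fun i => congrFun hg i)

theorem blockIncl_action_blockProj_of_notMem (g : Equiv.Perm (Fin n))
    (hg : g ∉ Set.range (youngEmb h)) :
    blockIncl X Y h ≫ tensorPowAction (X ⊞ Y) n g ≫ blockProj X Y h = 0 :=
  blockIncl_action_blockProj_eq_zero X Y h h g fun h1 => hg (mem_range_youngEmb h g fun i => by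
    have := congrFun h1 i
    simp only [blockWord, Function.comp_apply, decide_eq_decide] at this
    exact this.symm)

/-- The identity is the sum of the word idempotents, and each word is a permuted block word. Hence
block projections preceded by permutations detect all morphisms into the tensor power. -/
theorem eq_zero_of_blockProj {S : A} (f : S ⟶ tensorPow (X ⊞ Y) n)
    (hf : ∀ (p q : ℕ) (h : p + q = n) (g : Equiv.Perm (Fin n)),
      f ≫ tensorPowAction (X ⊞ Y) n g ≫ blockProj X Y h = 0) : f = 0 := by
  rw [← Category.comp_id f, ← sum_wordIdem, Preadditive.comp_sum]
  refine Finset.sum_eq_zero fun w _ => ?_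
  obtain ⟨p, q, h, g, hg⟩ := exists_blockWord w
  have hw : w = blockWord p n ∘ g := funext hg
  have h1 : tensorPowAction (X ⊞ Y) n g ≫ tensorPowAction (X ⊞ Y) n g⁻¹ = 𝟙 _ := by
    rw [← tensorPowAction_mul, inv_mul_cancel, map_one]
    rfl
  rw [hw, ← Category.comp_id (wordIdem X Y _), ← h1, ← Category.assoc (wordIdem X Y _),
    ← action_wordIdem, ← blockProj_blockIncl X Y h]
  simp only [Category.assoc]
  have h2 := hf p q h g
  rw [← Category.assoc] at h2
  rw [reassoc_of% h2, zero_comp]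

theorem action_blockIncl (a : Equiv.Perm (Fin p)) (b : Equiv.Perm (Fin q)) :
    (tensorPowAction X p a ⊗ₘ tensorPowAction Y q b) ≫ blockIncl X Y h =
      blockIncl X Y h ≫ tensorPowAction (X ⊞ Y) n (youngEmb h (a, b)) := by
  rw [blockIncl, Category.assoc, ← tensorHom_catIso, ← Category.assoc, ← Category.assoc,
    tensorHom_comp_tensorHom, tensorHom_comp_tensorHom, tensorPowAction_comp_tensorFam,
    tensorPowAction_comp_tensorFam]

theorem action_blockProj (a : Equiv.Perm (Fin p)) (b : Equiv.Perm (Fin q)) :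
    tensorPowAction (X ⊞ Y) n (youngEmb h (a, b)) ≫ blockProj X Y h =
      blockProj X Y h ≫ (tensorPowAction X p a ⊗ₘ tensorPowAction Y q b) := by
  have h1 : tensorPowAction (X ⊞ Y) n (youngEmb h (a, b)) ≫ (catIso (X ⊞ Y) h).inv =
      (catIso (X ⊞ Y) h).inv ≫
        (tensorPowAction (X ⊞ Y) p a ⊗ₘ tensorPowAction (X ⊞ Y) q b) := by
    rw [Iso.comp_inv_eq, Category.assoc, tensorHom_catIso, Iso.inv_hom_id_assoc]
  rw [blockProj, reassoc_of% h1, Category.assoc, tensorHom_comp_tensorHom,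
    tensorHom_comp_tensorHom, tensorPowAction_comp_tensorFam, tensorPowAction_comp_tensorFam]

end PowersOfSums

/-- Passing the multiplicities as a separate function c lets the index types be `Fin (lrCoeff ..)`
without casts. -/
theorem IsCompleteSystem.exists_restriction_card {G H : Type*} [Group G] [Group H] (j : H →* G)
    (hj : Function.Injective j) [Finite G] {I : Type*} [Fintype I]
    {f : I → MonoidAlgebra ℚ H} (hf : IsCompleteSystem f) {f' : I → MonoidAlgebra ℚ G}
    (hf' : ∀ i, algMap j (f i) = f' i) {e : MonoidAlgebra ℚ G} (he : e * e = e)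
    (c : I → ℕ) (hc : ∀ i, c i = Module.finrank ℚ (corner e (f' i))) :
    ∃ (v w : ∀ i, Fin (c i) → MonoidAlgebra ℚ G),
      (∀ i a, v i a ∈ corner (f' i) e) ∧
      (∀ i a, w i a ∈ corner e (f' i)) ∧
      (∀ i k a b, i ≠ k → restrictCoeff j hj (v i a * w k b) = 0) ∧
      (∀ i a b, restrictCoeff j hj (v i a * w i b) = if a = b then f i else 0) ∧
      ∀ x, x * e = x → ∑ i, ∑ a, algMap j (restrictCoeff j hj (x * w i a)) * v i a = x := by
  obtain rfl := funext hc
  exact hf.exists_restriction j hj hf' he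

/-! ### Restricting irreducibles to Young subgroups. -/

section LittlewoodRichardson

variable {p q n : ℕ} (h : p + q = n)

/-- Elements of `ℚ Σ_n` that decompose the restriction of `V_π` to `Σ_p × Σ_q` into the
representations `V_μ ⊗ V_η`. -/
theorem exists_lrFamily (π : n.Partition) :
    ∃ (v w : ∀ (μ : p.Partition) (η : q.Partition), Fin (lrCoeff h μ η π) → PermAlg n),
      (∀ μ η a, w μ η a ∈ corner (schurIdempotent π) (indIdempotent h μ η)) ∧
      (∀ μ η a, v μ η a ∈ corner (indIdempotent h μ η) (schurIdempotent π)) ∧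
      (∀ μ η μ' η' a b, (μ, η) ≠ (μ', η') →
        restrictCoeff (youngEmb h) (youngEmb_injective h) (v μ η a * w μ' η' b) = 0) ∧
      (∀ μ η a b, restrictCoeff (youngEmb h) (youngEmb_injective h) (v μ η a * w μ η b) =
        if a = b then outer (schurIdempotent μ) (schurIdempotent η) else 0) ∧
      ∀ x, x * schurIdempotent π = x → ∑ μ, ∑ η, ∑ a, algMap (youngEmb h)
        (restrictCoeff (youngEmb h) (youngEmb_injective h) (x * w μ η a)) * v μ η a = x := by
  have hf' : ∀ i : p.Partition × q.Partition, algMap (youngEmb h)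
      (outer (schurIdempotent i.1) (schurIdempotent i.2)) = indIdempotent h i.1 i.2 :=
    fun i => by rw [indIdempotent]
  -- Since the coefficient is the dimension of this corner, restriction has the same multiplicities
  -- as induction: Frobenius reciprocity in terms of idempotents.
  obtain ⟨v, w, hv, hw, h1, h2, h3⟩ := ((isCompleteSystem_schurIdempotent p).prod
    (isCompleteSystem_schurIdempotent q)).exists_restriction_card (youngEmb h) (youngEmb_injective h)
    hf' (schurIdempotent_mul_self π) (fun i => lrCoeff h i.1 i.2 π)
      (fun i => lrCoeff_eq h i.1 i.2 π)
  refine ⟨fun μ η a => v (μ, η) a, fun μ η a => w (μ, η) a, fun μ η a => hw (μ, η) a,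
    fun μ η a => hv (μ, η) a, fun μ η μ' η' a b hne => h1 (μ, η) (μ', η') a b hne, fun μ η a b => h2 (μ, η) a b,
    fun x hx => ?_⟩
  rw [← Fintype.sum_prod_type' (f := fun μ η => ∑ a, algMap (youngEmb h)
    (restrictCoeff (youngEmb h) (youngEmb_injective h) (x * w (μ, η) a)) * v (μ, η) a)]
  exact h3 x hx

end LittlewoodRichardson

/-! ### Schur functors of a direct sum; the third claim. -/

section SchurFunctorOfSum

variable {A : Type u} [Category.{v} A] [Preadditive A] [Linear ℚ A] [HasFiniteBiproducts A]
  [IsIdempotentComplete A] [MonoidalCategory A] [MonoidalPreadditive A]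
  [MonoidalLinear ℚ A] [SymmetricCategory A]

/-- The action of the group algebra on a tensor power. -/
abbrev powAct (X : A) (n : ℕ) : PermAlg n →ₐ[ℚ] End (tensorPow X n) :=
  permAlgAction (tensorPowAction X n)

theorem powAct_single (X : A) {n : ℕ} (g : Equiv.Perm (Fin n)) (r : ℚ) :
    powAct X n (MonoidAlgebra.single g r) = r • tensorPowAction X n g :=
  MonoidAlgebra.lift_single _ _ _

theorem powAct_mul (X : A) {n : ℕ} (x y : PermAlg n) :
    powAct X n (x * y) = powAct X n y ≫ powAct X n x := map_mul _ _ _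

theorem schurObj_spec (X : A) {n : ℕ} (μ : n.Partition) :
    ∃ (i : schurObj μ X ⟶ tensorPow X n) (e : tensorPow X n ⟶ schurObj μ X),
      i ≫ e = 𝟙 (schurObj μ X) ∧ e ≫ i = powAct X n (schurIdempotent μ) :=
  schurImage_spec _ μ

variable (X Y : A) {p q n : ℕ}

/-- The action of the group algebra of `Σ_p × Σ_q` on `X^{⊗ p} ⊗ Y^{⊗ q}`. -/
def blockAct (p q : ℕ) : MonoidAlgebra ℚ (Equiv.Perm (Fin p) × Equiv.Perm (Fin q)) →ₐ[ℚ]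
    End (tensorPow X p ⊗ tensorPow Y q) :=
  MonoidAlgebra.lift ℚ (End (tensorPow X p ⊗ tensorPow Y q)) _
    { toFun := fun g => tensorPowAction X p g.1 ⊗ₘ tensorPowAction Y q g.2
      map_one' := by
        rw [Prod.fst_one, Prod.snd_one, map_one, map_one]
        exact id_tensorHom_id _ _
      map_mul' := fun g g' => by
        rw [Prod.fst_mul, Prod.snd_mul, tensorPowAction_mul, tensorPowAction_mul,
          ← tensorHom_comp_tensorHom]
        rfl }

theorem blockAct_single (a : Equiv.Perm (Fin p)) (b : Equiv.Perm (Fin q)) (r : ℚ) :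
    blockAct X Y p q (MonoidAlgebra.single (a, b) r) =
      r • (tensorPowAction X p a ⊗ₘ tensorPowAction Y q b) :=
  MonoidAlgebra.lift_single _ _ _

theorem blockAct_outer (x : PermAlg p) (y : PermAlg q) :
    blockAct X Y p q (outer x y) = powAct X p x ⊗ₘ powAct Y q y := by
  induction x using MonoidAlgebra.induction_linear with
  | zero =>
    rw [zero_outer, map_zero, map_zero]
    exact (MonoidalPreadditive.zero_tensor _).symm
  | add a b ha hb =>
    rw [add_outer, map_add, map_add, ha, hb]
    exact (MonoidalPreadditive.add_tensor _ _ _).symm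
  | single g r =>
    induction y using MonoidAlgebra.induction_linear with
    | zero =>
      rw [outer_zero, map_zero, map_zero]
      exact (MonoidalPreadditive.tensor_zero _).symm
    | add a b ha hb =>
      rw [outer_add, map_add, ha, hb, map_add]
      exact (MonoidalPreadditive.tensor_add _ _ _).symm
    | single g' s =>
      rw [outer_single, blockAct_single, powAct_single, powAct_single,
        MonoidalCategory.tensorHom_def, MonoidalCategory.tensorHom_def]
      erw [MonoidalLinear.smul_whiskerRight, MonoidalLinear.whiskerLeft_smul]
      rw [Linear.smul_comp, Linear.comp_smul, smul_smul]

variable (h : p + q = n)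

theorem blockAct_blockIncl (y : MonoidAlgebra ℚ (Equiv.Perm (Fin p) × Equiv.Perm (Fin q))) :
    blockAct X Y p q y ≫ blockIncl X Y h =
      blockIncl X Y h ≫ powAct (X ⊞ Y) n (algMap (youngEmb h) y) := by
  induction y using MonoidAlgebra.induction_linear with
  | zero =>
    rw [map_zero, map_zero, map_zero]
    exact zero_comp.trans comp_zero.symm
  | add a b ha hb =>
    rw [map_add, map_add, map_add]
    exact (Preadditive.add_comp _ _ _ _ _ _).trans
      ((congrArg₂ (· + ·) ha hb).trans (Preadditive.comp_add _ _ _ _ _ _).symm)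
  | single g r =>
    rw [algMap_single, powAct_single, ← Prod.mk.eta (p := g), blockAct_single, Linear.smul_comp,
      Linear.comp_smul, action_blockIncl]

theorem powAct_blockProj (y : MonoidAlgebra ℚ (Equiv.Perm (Fin p) × Equiv.Perm (Fin q))) :
    powAct (X ⊞ Y) n (algMap (youngEmb h) y) ≫ blockProj X Y h =
      blockProj X Y h ≫ blockAct X Y p q y := by
  induction y using MonoidAlgebra.induction_linear with
  | zero =>
    rw [map_zero, map_zero, map_zero]
    exact zero_comp.trans comp_zero.symm
  | add a b ha hb =>
    rw [map_add, map_add, map_add]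
    exact (Preadditive.add_comp _ _ _ _ _ _).trans
      ((congrArg₂ (· + ·) ha hb).trans (Preadditive.comp_add _ _ _ _ _ _).symm)
  | single g r =>
    rw [algMap_single, powAct_single, ← Prod.mk.eta (p := g), blockAct_single, Linear.smul_comp,
      Linear.comp_smul, action_blockProj]

/-- This is the bridge between algebra and category: permutations outside the Young subgroup are
killed, and those inside act block by block. -/
theorem blockIncl_powAct_blockProj (x : PermAlg n) :
    blockIncl X Y h ≫ powAct (X ⊞ Y) n x ≫ blockProj X Y h =
      blockAct X Y p q (restrictCoeff (youngEmb h) (youngEmb_injective h) x) := by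
  induction x using MonoidAlgebra.induction_linear with
  | zero =>
    rw [map_zero, map_zero, map_zero]
    exact (congrArg _ zero_comp).trans comp_zero
  | add a b ha hb =>
    rw [map_add, map_add, map_add, ← ha, ← hb, ← Preadditive.comp_add]
    exact congrArg _ (Preadditive.add_comp _ _ _ _ _ _)
  | single g r =>
    rw [powAct_single, Linear.smul_comp, Linear.comp_smul]
    by_cases hg : g ∈ Set.range (youngEmb h)
    · obtain ⟨⟨a, b⟩, rfl⟩ := hg
      rw [restrictCoeff_single, blockAct_single, action_blockProj,
        reassoc_of% (blockIncl_blockProj X Y h)]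
    · rw [restrictCoeff_single_of_notMem _ _ hg, blockIncl_action_blockProj_of_notMem X Y h g hg,
        smul_zero, map_zero]

theorem blockIncl_powAct_blockProj_of_ne {p' q' : ℕ} (h' : p' + q' = n) (hp : p ≠ p')
    (x : PermAlg n) : blockIncl X Y h ≫ powAct (X ⊞ Y) n x ≫ blockProj X Y h' = 0 := by
  induction x using MonoidAlgebra.induction_linear with
  | zero =>
    rw [map_zero]
    exact (congrArg _ zero_comp).trans comp_zero
  | add a b ha hb =>
    rw [map_add]
    refine (congrArg _ (Preadditive.add_comp _ _ _ _ _ _)).trans ?_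
    rw [Preadditive.comp_add, ha, hb, add_zero]
  | single g r =>
    rw [powAct_single, Linear.smul_comp, Linear.comp_smul,
      blockIncl_action_blockProj_of_ne X Y h h' hp, smul_zero]

theorem powAct_comp_powAct {X : A} {x y z : PermAlg n} (hxy : y * x = z) :
    powAct X n x ≫ powAct X n y = powAct X n z := by
  rw [← hxy, powAct_mul]

theorem powAct_sum (X : A) {S : Type*} [Fintype S] (x : S → PermAlg n) :
    powAct X n (∑ s, x s) = ∑ s, powAct X n (x s) := map_sum _ _ _

/-- The idempotent of `π` on `(X ⊕ Y)^{⊗ n}` as a sum over the summands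
`X^{⊗ p} ⊗ Y^{⊗ q}`. -/
theorem powAct_eq_sum {D : Type*} [Fintype D] (P Q : D → ℕ) (hPQ : ∀ d, P d + Q d = n)
    (hP : Function.Injective P) (hP' : ∀ p ≤ n, ∃ d, P d = p)
    {S : D → Type*} [∀ d, Fintype (S d)] (e : PermAlg n) (v w : ∀ d, S d → PermAlg n)
    (he : e * e = e) (hw : ∀ d s, e * w d s = w d s)
    (hsum : ∀ d x, x * e = x → ∑ s, algMap (youngEmb (hPQ d))
      (restrictCoeff (youngEmb (hPQ d)) (youngEmb_injective (hPQ d)) (x * w d s)) * v d s = x) :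
    powAct (X ⊞ Y) n e = ∑ d, ∑ s, powAct (X ⊞ Y) n (v d s) ≫ blockProj X Y (hPQ d) ≫
      blockIncl X Y (hPQ d) ≫ powAct (X ⊞ Y) n (w d s) := by
  -- The difference is tested against g followed by a block projection. Only the summand with the
  -- same block length can contribute.
  refine sub_eq_zero.1 (eq_zero_of_blockProj X Y _ fun p q h g => ?_)
  obtain ⟨d, rfl⟩ := hP' p (by omega)
  obtain rfl : q = Q d := by have := hPQ d; omega
  have hg : tensorPowAction (X ⊞ Y) n g = powAct (X ⊞ Y) n (MonoidAlgebra.single g 1) := by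
    rw [powAct_single, one_smul]
  rw [hg, Preadditive.sub_comp, sub_eq_zero, Preadditive.sum_comp]
  have hx : MonoidAlgebra.single g 1 * e * e = MonoidAlgebra.single g 1 * e := by
    rw [mul_assoc, he]
  rw [Finset.sum_eq_single d]
  · rw [← Category.assoc, ← powAct_mul]
    -- The reconstruction formula is applied to g e, the element acting after `powAct_mul`; then e w
    -- = w removes e inside the restriction.
    conv_lhs => rw [← hsum d _ hx, powAct_sum, Preadditive.sum_comp]
    rw [Preadditive.sum_comp]
    refine Finset.sum_congr rfl fun s _ => ?_
    rw [powAct_mul, Category.assoc, powAct_blockProj, mul_assoc, hw,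
      ← blockIncl_powAct_blockProj, powAct_mul]
    simp only [Category.assoc]
  · intro d' _ hd
    rw [Preadditive.sum_comp]
    refine Finset.sum_eq_zero fun s _ => ?_
    simp only [Category.assoc]
    have h1 := blockIncl_powAct_blockProj_of_ne X Y (hPQ d') h (fun h => hd (hP h))
      (MonoidAlgebra.single g 1 * w d' s)
    rw [powAct_mul, Category.assoc] at h1
    rw [h1, comp_zero, comp_zero]
  · exact fun h => absurd (Finset.mem_univ d) h

/-- The inclusions are built from w and the projections from v. Their composites are block
compressions of products v w, so the identities in `exists_lrFamily` and `powAct_eq_sum` say exactly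
that these maps form a direct sum. -/
theorem nonempty_schurObj_biprod_iso (π : n.Partition) :
    Nonempty (schurObj π (X ⊞ Y) ≅
      ⨁ fun d : Finset.HasAntidiagonal.antidiagonal n =>
        ⨁ fun μ : d.1.1.Partition => ⨁ fun η : d.1.2.Partition =>
          ⨁ fun _ : Fin (lrCoeff (Finset.HasAntidiagonal.mem_antidiagonal.mp d.2) μ η π) =>
            schurObj μ X ⊗ schurObj η Y) := by
  let D := Finset.HasAntidiagonal.antidiagonal n
  have hPQ : ∀ d : D, d.1.1 + d.1.2 = n := fun d => Finset.HasAntidiagonal.mem_antidiagonal.mp d.2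
  have hP : ∀ d d' : D, d.1.1 = d'.1.1 → d = d' := fun d d' hd => by
    have h1 := hPQ d
    have h2 := hPQ d'
    exact Subtype.ext (Prod.ext hd (by omega))
  choose v w hw hv hvw hvw' hsum using fun d : D => exists_lrFamily (hPQ d) π
  obtain ⟨i, e, hie, hei⟩ := schurObj_spec (X ⊞ Y) π
  choose iX eX hX hX' using fun (d : D) (μ : d.1.1.Partition) =>
    schurObj_spec X μ
  choose iY eY hY hY' using fun (d : D) (η : d.1.2.Partition) =>
    schurObj_spec Y η
  let I : ∀ (d : D) (μ : d.1.1.Partition) (η : d.1.2.Partition),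
    schurObj μ X ⊗ schurObj η Y ⟶ tensorPow X d.1.1 ⊗ tensorPow Y d.1.2 :=
    fun d μ η => iX d μ ⊗ₘ iY d η
  let E : ∀ (d : D) (μ : d.1.1.Partition) (η : d.1.2.Partition),
    tensorPow X d.1.1 ⊗ tensorPow Y d.1.2 ⟶ schurObj μ X ⊗ schurObj η Y :=
    fun d μ η => eX d μ ⊗ₘ eY d η
  have hIE : ∀ d μ η, I d μ η ≫ E d μ η = 𝟙 _ := fun d μ η => by
    refine (tensorHom_comp_tensorHom _ _ _ _).trans ?_
    rw [hX, hY]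
    exact id_tensorHom_id _ _
  have hEI : ∀ d μ η, E d μ η ≫ I d μ η =
      blockAct X Y d.1.1 d.1.2 (outer (schurIdempotent μ) (schurIdempotent η)) := fun d μ η => by
    refine (tensorHom_comp_tensorHom _ _ _ _).trans ?_
    rw [hX', hY', blockAct_outer]
  let inc : ∀ (d : D) (μ : d.1.1.Partition) (η : d.1.2.Partition) (_ : Fin (lrCoeff (hPQ d) μ η π)),
      (schurObj μ X ⊗ schurObj η Y ⟶ schurObj π (X ⊞ Y)) := fun d μ η a =>
    I d μ η ≫ blockIncl X Y (hPQ d) ≫ powAct (X ⊞ Y) n (w d μ η a) ≫ e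
  let pro : ∀ (d : D) (μ : d.1.1.Partition) (η : d.1.2.Partition) (_ : Fin (lrCoeff (hPQ d) μ η π)),
      (schurObj π (X ⊞ Y) ⟶ schurObj μ X ⊗ schurObj η Y) := fun d μ η a =>
    i ≫ powAct (X ⊞ Y) n (v d μ η a) ≫ blockProj X Y (hPQ d) ≫ E d μ η
  -- Passing through S_π leaves the idempotent of π in the middle, and w absorbs it.
  have hip : ∀ d μ η a d' μ' η' a', inc d μ η a ≫ pro d' μ' η' a' = I d μ η ≫
      (blockIncl X Y (hPQ d) ≫ powAct (X ⊞ Y) n (v d' μ' η' a' * w d μ η a) ≫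
        blockProj X Y (hPQ d')) ≫ E d' μ' η' := by
    intro d μ η a d' μ' η' a'
    have h1 : powAct (X ⊞ Y) n (w d μ η a) ≫ e ≫ i ≫ powAct (X ⊞ Y) n (v d' μ' η' a') =
        powAct (X ⊞ Y) n (v d' μ' η' a' * w d μ η a) := by
      rw [reassoc_of% hei, ← Category.assoc]
      refine (congrArg (· ≫ _) (powAct_comp_powAct (hw d μ η a).1)).trans ?_
      exact (powAct_mul _ _ _).symm
    simp only [inc, pro, Category.assoc]
    rw [← h1]
    simp only [Category.assoc]
  -- The direct sum is formed over one sigma type and then regrouped into the nested sums.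
  refine ⟨isoBiproductOf (J := Σ (d : D) (μ : d.1.1.Partition) (η : d.1.2.Partition),
      Fin (lrCoeff (hPQ d) μ η π)) (fun s => schurObj s.2.1 X ⊗ schurObj s.2.2.1 Y)
      (fun s => inc s.1 s.2.1 s.2.2.1 s.2.2.2) (fun s => pro s.1 s.2.1 s.2.2.1 s.2.2.2) ?_ ?_ ?_ ≪≫
    (biproductBiproductIso _ fun (d : D) (s : Σ (μ : d.1.1.Partition) (η : d.1.2.Partition),
      Fin (lrCoeff (hPQ d) μ η π)) => schurObj s.1 X ⊗ schurObj s.2.1 Y).symm ≪≫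
    biproduct.mapIso fun d => (biproductBiproductIso _ fun (μ : d.1.1.Partition)
      (s : Σ (η : d.1.2.Partition), Fin (lrCoeff (hPQ d) μ η π)) =>
        schurObj μ X ⊗ schurObj s.1 Y).symm ≪≫
    biproduct.mapIso fun μ => (biproductBiproductIso _ fun (η : d.1.2.Partition)
      (_ : Fin (lrCoeff (hPQ d) μ η π)) => schurObj μ X ⊗ schurObj η Y).symm⟩
  · rintro ⟨d, μ, η, a⟩
    dsimp only
    rw [hip, blockIncl_powAct_blockProj, hvw', if_pos rfl, ← hEI, Category.assoc, hIE,
      Category.comp_id, hIE]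
  · rintro ⟨d, μ, η, a⟩ ⟨d', μ', η', a'⟩ hne
    dsimp only
    rw [hip]
    by_cases hd : d = d'
    · subst hd
      rw [blockIncl_powAct_blockProj]
      by_cases hμη : (μ', η') = (μ, η)
      · obtain ⟨rfl, rfl⟩ := Prod.mk.inj hμη
        rw [hvw', if_neg fun ha => hne (by rw [ha]), map_zero]
        exact (congrArg _ zero_comp).trans comp_zero
      · rw [hvw _ _ _ _ _ _ _ hμη, map_zero]
        exact (congrArg _ zero_comp).trans comp_zero
    · rw [blockIncl_powAct_blockProj_of_ne X Y (hPQ d) (hPQ d') fun h => hd (hP _ _ h), zero_comp,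
        comp_zero]
  -- The middle composite is the action of e_μ ⊗ e_η; pushed through the block inclusion it is
  -- absorbed on the right of w.
  · have hpi : ∀ d μ η a, pro d μ η a ≫ inc d μ η a = i ≫ (powAct (X ⊞ Y) n (v d μ η a) ≫
        blockProj X Y (hPQ d) ≫ blockIncl X Y (hPQ d) ≫ powAct (X ⊞ Y) n (w d μ η a)) ≫ e := by
      intro d μ η a
      simp only [inc, pro, Category.assoc]
      rw [reassoc_of% hEI, reassoc_of% (blockAct_blockIncl X Y (hPQ d)), ← indIdempotent,
        reassoc_of% (powAct_comp_powAct (X := X ⊞ Y) (hw d μ η a).2)]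
    have h1 := powAct_eq_sum X Y (fun d : D => d.1.1) (fun d => d.1.2) hPQ (fun d d' => hP d d')
      (fun p hp => ⟨⟨(p, n - p), Finset.HasAntidiagonal.mem_antidiagonal.mpr (by
        exact Nat.add_sub_cancel' hp)⟩, rfl⟩)
      (S := fun d => Σ (μ : d.1.1.Partition) (η : d.1.2.Partition), Fin (lrCoeff (hPQ d) μ η π))
      (schurIdempotent π) (fun d s => v d s.1 s.2.1 s.2.2) (fun d s => w d s.1 s.2.1 s.2.2)
      (schurIdempotent_mul_self π) (fun d s => (hw _ _ _ _).1)
      (fun d x hx => by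
        rw [Fintype.sum_sigma]
        simp only [Fintype.sum_sigma]
        exact hsum d x hx)
    simp only [hpi]
    rw [← Preadditive.comp_sum, ← Preadditive.sum_comp, Fintype.sum_sigma, ← h1]
    have h2 : i ≫ (e ≫ i) ≫ e = 𝟙 _ := by
      rw [Category.assoc, hie, Category.comp_id, hie]
    rw [hei] at h2
    exact h2

end SchurFunctorOfSum

/-! ### Classes of finite direct sums. -/

section Biproducts

variable {C : Type u} [Category.{v} C] [Preadditive C] [HasFiniteBiproducts C]

/-- The direct sum over `Option J`. -/
def biproductOptionIso {J : Type} [Fintype J] (F : Option J → C) :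
    ⨁ F ≅ F none ⊞ ⨁ fun j => F (some j) where
  hom := biprod.lift (biproduct.π F none) (biproduct.lift fun j => biproduct.π F (some j))
  inv := biprod.desc (biproduct.ι F none) (biproduct.desc fun j => biproduct.ι F (some j))
  hom_inv_id := by
    rw [biprod.lift_desc, biproduct.lift_desc, ← Fintype.sum_option fun j =>
      biproduct.π F j ≫ biproduct.ι F j, biproduct.total]
  inv_hom_id := by
    refine biprod.hom_ext' _ _ (biprod.hom_ext _ _ ?_ (biproduct.hom_ext _ _ fun k => ?_))
      (biproduct.hom_ext' _ _ fun j => biprod.hom_ext _ _ ?_ (biproduct.hom_ext _ _ fun k => ?_))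
    · simp
    · simp
    · simp
    · classical
      by_cases h : j = k
      · subst h; simp
      · have h' : (some j : Option J) ≠ some k := fun e => h (Option.some_injective _ e)
        simp [biproduct.ι_π_ne _ h, biproduct.ι_π_ne _ h']

theorem cl_biproduct {J : Type} [Fintype J] (F : J → C) : cl (⨁ F) = ∑ j, cl (F j) := by
  refine Fintype.induction_empty_option
    (P := fun J _ => ∀ F : J → C, cl (⨁ F) = ∑ j, cl (F j)) ?_ ?_ ?_ J F
  · intro α β _ e ih F
    let _ : Fintype α := Fintype.ofEquiv β e.symm
    rw [← e.sum_comp, ← ih fun a => F (e a)]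
    exact (cl_eq_of_iso (biproduct.reindex e F)).symm
  · intro F
    rw [Fintype.sum_empty]
    -- The empty sum is a zero object, hence isomorphic to two copies of itself, so its class is 0.
    have h : cl (⨁ F) = cl (⨁ F) + cl (⨁ F) := cl_of_iso_biprod
      { hom := 0
        inv := 0
        hom_inv_id := biproduct.hom_ext _ _ fun j => j.elim
        inv_hom_id := biprod.hom_ext _ _ (biproduct.hom_ext _ _ fun j => j.elim)
          (biproduct.hom_ext _ _ fun j => j.elim) }
    exact left_eq_add.1 h
  · intro α _ ih F
    rw [cl_of_iso_biprod (biproductOptionIso F), ih, Fintype.sum_option]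

end Biproducts

/-! ### Products in R, the dimension homomorphism, and symmetric groups with one element. -/

section Dimension

theorem repCl_biproduct {n : ℕ} {J : Type} [Fintype J]
    (F : J → FDRep ℚ (Equiv.Perm (Fin n))) : repCl (⨁ F) = ∑ j, repCl (F j) := by
  rw [repCl, cl_biproduct, map_sum]
  rfl

theorem repCl_eq_of_iso {n : ℕ} {V W : FDRep ℚ (Equiv.Perm (Fin n))} (e : V ≅ W) :
    repCl V = repCl W := congrArg (RepRing.of n) (cl_eq_of_iso e)

theorem repCl_specht_mul {p q n : ℕ} (h : p + q = n) (μ : p.Partition) (η : q.Partition) :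
    repCl (specht μ) * repCl (specht η) =
      ∑ π : n.Partition, ∑ _ : Fin (lrCoeff h μ η π), repCl (specht π) := by
  obtain ⟨e⟩ := nonempty_indProd_specht_iso h μ η
  rw [repCl_mul_repCl h, repCl_eq_of_iso e, repCl_biproduct]
  exact Finset.sum_congr rfl fun π _ => repCl_biproduct _

theorem finrank_of_iso_biprod {n : ℕ} {X Y Z : FDRep ℚ (Equiv.Perm (Fin n))} (e : Z ≅ X ⊞ Y) :
    Module.finrank ℚ Z = Module.finrank ℚ X + Module.finrank ℚ Y := by
  have hz : ∀ z, repLin (biprod.inl ≫ e.inv) (repLin (e.hom ≫ biprod.fst) z) +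
      repLin (biprod.inr ≫ e.inv) (repLin (e.hom ≫ biprod.snd) z) = z := fun z => by
    rw [← repLin_comp, ← repLin_comp, ← LinearMap.add_apply, ← repLin_add]
    have : (e.hom ≫ biprod.fst) ≫ biprod.inl ≫ e.inv + (e.hom ≫ biprod.snd) ≫ biprod.inr ≫ e.inv =
        𝟙 Z := by
      have h := congrArg (fun f => e.hom ≫ f ≫ e.inv) (biprod.total (X := X) (Y := Y))
      simp only [Preadditive.add_comp, Preadditive.comp_add, Category.assoc, Category.id_comp,
        e.hom_inv_id] at h
      simpa only [Category.assoc] using h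
    rw [this]
    rfl
  have comp : ∀ {U V W : FDRep ℚ (Equiv.Perm (Fin n))} (f : U ⟶ V) (g : V ⟶ W) (k : U ⟶ W) (u : U),
      f ≫ g = k → repLin g (repLin f u) = repLin k u := fun f g k u h => by rw [← h, repLin_comp]
  rw [← Module.finrank_prod]
  refine LinearEquiv.finrank_eq (LinearEquiv.ofLinearMap
    ((repLin (e.hom ≫ biprod.fst)).prod (repLin (e.hom ≫ biprod.snd)))
    ((repLin (biprod.inl ≫ e.inv)).coprod (repLin (biprod.inr ≫ e.inv))) ?_
    (LinearMap.ext hz))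
  refine LinearMap.ext fun ⟨x, y⟩ => Prod.ext ?_ ?_
  · refine (map_add (repLin (e.hom ≫ biprod.fst)) _ _).trans ?_
    refine (congrArg₂ (· + ·) (comp (biprod.inl ≫ e.inv) (e.hom ≫ biprod.fst) (𝟙 X) x (by simp))
      (comp (biprod.inr ≫ e.inv) (e.hom ≫ biprod.fst) 0 y (by simp))).trans ?_
    exact add_zero _
  · refine (map_add (repLin (e.hom ≫ biprod.snd)) _ _).trans ?_
    refine (congrArg₂ (· + ·) (comp (biprod.inl ≫ e.inv) (e.hom ≫ biprod.snd) 0 x (by simp))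
      (comp (biprod.inr ≫ e.inv) (e.hom ≫ biprod.snd) (𝟙 Y) y (by simp))).trans ?_
    exact zero_add _

/-- The dimension, as a homomorphism on `R`. -/
def repDim : RepRing →+ ℤ :=
  RepRing.lift fun n => K0.lift (fun V => (Module.finrank ℚ V : ℤ)) fun X Y Z ⟨e⟩ => by
    rw [finrank_of_iso_biprod e, Nat.cast_add]

theorem repDim_repCl {n : ℕ} (V : FDRep ℚ (Equiv.Perm (Fin n))) :
    repDim (repCl V) = Module.finrank ℚ V := by
  rw [repCl, repDim, RepRing.lift_of, K0.lift_cl]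

variable {n : ℕ} [Subsingleton (Equiv.Perm (Fin n))]

theorem eq_single_unitCoeff (x : PermAlg n) : x = MonoidAlgebra.single 1 (unitCoeff x) := by
  induction x using MonoidAlgebra.induction_linear with
  | zero => rw [map_zero, MonoidAlgebra.single_zero]
  | add a b ha hb => rw [map_add, MonoidAlgebra.single_add, ← ha, ← hb]
  | single g r =>
    classical
    obtain rfl := Subsingleton.elim g 1
    rw [unitCoeff_single, if_pos rfl]

/-- The group algebra of the trivial group is ℚ, whose only nonzero idempotent is 1. The cases n = 0
and n = 1 give the constant and linear coefficients of λ_Σ. -/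
theorem schurIdempotent_eq_one (μ : n.Partition) : schurIdempotent μ = 1 := by
  classical
  have h1 := schurIdempotent_mul_self μ
  have h0 := (isCompleteSystem_schurIdempotent n).unitCoeff_ne_zero μ
  rw [eq_single_unitCoeff (schurIdempotent μ), MonoidAlgebra.single_mul_single, one_mul] at h1
  have h2 := congrArg unitCoeff h1
  rw [unitCoeff_single, if_pos rfl, unitCoeff_single, if_pos rfl] at h2
  rw [eq_single_unitCoeff (schurIdempotent μ), mul_left_cancel₀ h0 (h2.trans (mul_one _).symm)]
  rfl

theorem nonempty_specht_iso_trivial (μ : n.Partition) :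
    Nonempty (specht μ ≅ FDRep.of (Representation.trivial ℚ (Equiv.Perm (Fin n)) ℚ)) := by
  classical
  let T := FDRep.of (Representation.trivial ℚ (Equiv.Perm (Fin n)) ℚ)
  have hmem : ∀ y : PermAlg n, y ∈ spechtIdeal μ := fun y => by
    rw [mem_spechtIdeal, schurIdempotent_eq_one, mul_one]
  let f : spechtIdeal μ →ₗ[ℚ] ℚ :=
    { toFun := fun y => unitCoeff (y : PermAlg n)
      map_add' := fun y z => map_add unitCoeff (y : PermAlg n) z
      map_smul' := fun r y => map_smul unitCoeff r (y : PermAlg n) }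
  let k : ℚ →ₗ[ℚ] spechtIdeal μ :=
    { toFun := fun r => ⟨MonoidAlgebra.single 1 r, hmem _⟩
      map_add' := fun r s => Subtype.ext (MonoidAlgebra.single_add _ _ _)
      map_smul' := fun r s => Subtype.ext (MonoidAlgebra.smul_single _ _ _).symm }
  have hspecht : ∀ (g : Equiv.Perm (Fin n)) (y : specht μ), (specht μ).ρ g y = y := fun g y => by
    rw [Subsingleton.elim g 1, map_one]
    rfl
  have htriv : ∀ (g : Equiv.Perm (Fin n)) (r : T), T.ρ g r = r := fun g r => by
    rw [Subsingleton.elim g 1, map_one]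
    rfl
  refine ⟨⟨repHom (V := specht μ) (W := T) f fun g y => ?_,
    repHom (V := T) (W := specht μ) k fun g r => ?_,
    rep_ext (LinearMap.ext fun y => ?_), rep_ext (LinearMap.ext fun r => ?_)⟩⟩
  · rw [hspecht, htriv]
  · rw [hspecht, htriv]
  · exact Subtype.ext (eq_single_unitCoeff _).symm
  · change unitCoeff (MonoidAlgebra.single (1 : Equiv.Perm (Fin n)) (r : ℚ)) = r
    rw [unitCoeff_single, if_pos rfl]

end Dimension

/-! ### Multiplicativity and injectivity of λ_Σ. -/

section LambdaSigma

variable {A : Type u} [Category.{v} A] [Preadditive A] [Linear ℚ A] [HasFiniteBiproducts A]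
  [IsIdempotentComplete A] [MonoidalCategory A] [MonoidalPreadditive A]
  [MonoidalLinear ℚ A] [SymmetricCategory A]

theorem powAct_comp_tensorFam {X Z : A} {n : ℕ} (x : PermAlg n) (f : X ⟶ Z) :
    powAct X n x ≫ (tensorFam fun _ => f) = (tensorFam fun _ => f) ≫ powAct Z n x := by
  induction x using MonoidAlgebra.induction_linear with
  | zero =>
    rw [map_zero, map_zero]
    exact zero_comp.trans comp_zero.symm
  | add a b ha hb =>
    rw [map_add, map_add]
    exact (Preadditive.add_comp _ _ _ _ _ _).trans
      ((congrArg₂ (· + ·) ha hb).trans (Preadditive.comp_add _ _ _ _ _ _).symm)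
  | single g r =>
    rw [powAct_single, powAct_single, Linear.smul_comp, Linear.comp_smul,
      tensorPowAction_comp_tensorFam]

/-- The relations of `K0` involve any Z isomorphic to X ⊞ Y, so invariance under isomorphism is
needed. The action commutes with tensor powers of morphisms, so these pass to the images. -/
theorem nonempty_schurObj_iso {X Z : A} (f : X ≅ Z) {n : ℕ} (μ : n.Partition) :
    Nonempty (schurObj μ X ≅ schurObj μ Z) := by
  -- The statement covers all isomorphisms so that f and `f.symm` give the two inverse laws.
  have key : ∀ {X Z : A} (f : X ≅ Z) (i : schurObj μ X ⟶ tensorPow X n)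
      (e : tensorPow X n ⟶ schurObj μ X) (i' : schurObj μ Z ⟶ tensorPow Z n)
      (e' : tensorPow Z n ⟶ schurObj μ Z), i ≫ e = 𝟙 (schurObj μ X) →
      e ≫ i = powAct X n (schurIdempotent μ) → e' ≫ i' = powAct Z n (schurIdempotent μ) →
      (i ≫ (tensorFam fun _ => f.hom) ≫ e') ≫ i' ≫ (tensorFam fun _ => f.inv) ≫ e =
        𝟙 (schurObj μ X) := by
    intro X Z f i e i' e' h1 h2 h3
    have h4 : i ≫ powAct X n (schurIdempotent μ) = i := by
      rw [← h2, reassoc_of% h1]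
    simp only [Category.assoc]
    rw [reassoc_of% h3, ← reassoc_of% (powAct_comp_tensorFam (schurIdempotent μ) f.hom),
      reassoc_of% h4]
    have h5 := tensorFam_comp (fun _ : Fin n => f.hom) (fun _ => f.inv)
    simp only [f.hom_inv_id, tensorFam_id] at h5
    rw [reassoc_of% h5, h1]
  obtain ⟨i, e, h1, h2⟩ := schurObj_spec X μ
  obtain ⟨i', e', h1', h2'⟩ := schurObj_spec Z μ
  exact ⟨⟨_, _, key f i e i' e' h1 h2 h2', key f.symm i' e' i e h1' h2' h2⟩⟩

theorem cl_schurObj_biprod {X Y Z : A} (f : Z ≅ X ⊞ Y) {n : ℕ} (π : n.Partition) :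
    cl (schurObj π Z) = ∑ d : Finset.HasAntidiagonal.antidiagonal n,
      ∑ μ : d.1.1.Partition, ∑ η : d.1.2.Partition,
        ∑ _ : Fin (lrCoeff (Finset.HasAntidiagonal.mem_antidiagonal.mp d.2) μ η π),
          cl (schurObj μ X) * cl (schurObj η Y) := by
  obtain ⟨e⟩ := nonempty_schurObj_iso f π
  obtain ⟨e'⟩ := nonempty_schurObj_biprod_iso X Y π
  rw [cl_eq_of_iso (e ≪≫ e')]
  simp only [cl_biproduct, K0.cl_mul_cl]

/-- The same coefficients c^π_{μη} expand S_π(X ⊞ Y) and the product cl(V_μ) cl(V_η), so both sides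
become the same sum over μ, η and π. -/
theorem lambdaSigma_of_iso_biprod {X Y Z : A} (f : Z ≅ X ⊞ Y) :
    lambdaSigma Z = lambdaSigma X * lambdaSigma Y := by
  refine PowerSeries.ext fun n => ?_
  rw [PowerSeries.coeff_mul, ← Finset.sum_coe_sort]
  simp only [lambdaSigma, PowerSeries.coeff_mk]
  have hl : ∀ π : n.Partition, cl (schurObj π Z) ⊗ₜ[ℤ] repCl (specht π) =
      ∑ d : Finset.HasAntidiagonal.antidiagonal n, ∑ μ : d.1.1.Partition, ∑ η : d.1.2.Partition,
        ∑ _ : Fin (lrCoeff (Finset.HasAntidiagonal.mem_antidiagonal.mp d.2) μ η π),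
          (cl (schurObj μ X) * cl (schurObj η Y)) ⊗ₜ[ℤ] repCl (specht π) := fun π => by
    rw [cl_schurObj_biprod f]
    simp only [TensorProduct.sum_tmul]
  rw [Finset.sum_congr rfl fun π _ => hl π, Finset.sum_comm]
  refine Finset.sum_congr rfl fun d _ => ?_
  rw [Finset.sum_comm, Finset.sum_mul]
  refine Finset.sum_congr rfl fun μ _ => ?_
  rw [Finset.sum_comm, Finset.mul_sum]
  refine Finset.sum_congr rfl fun η _ => ?_
  rw [Algebra.TensorProduct.tmul_mul_tmul,
    repCl_specht_mul (Finset.HasAntidiagonal.mem_antidiagonal.mp d.2) μ η]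
  simp only [TensorProduct.tmul_sum]

theorem cl_schurObj_of_subsingleton {n : ℕ} [Subsingleton (Equiv.Perm (Fin n))] (μ : n.Partition)
    (X : A) : cl (schurObj μ X) = cl (tensorPow X n) := by
  obtain ⟨i, e, h1, h2⟩ := schurObj_spec X μ
  rw [schurIdempotent_eq_one, map_one] at h2
  exact cl_eq_of_iso ⟨i, e, h1, h2⟩

theorem constantCoeff_lambdaSigma (X : A) :
    PowerSeries.constantCoeff (R := K0 A ⊗[ℤ] RepRing) (lambdaSigma X) = 1 := by
  rw [← PowerSeries.coeff_zero_eq_constantCoeff_apply, lambdaSigma, PowerSeries.coeff_mk,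
    Fintype.sum_unique, cl_schurObj_of_subsingleton]
  obtain ⟨e⟩ := nonempty_specht_iso_trivial (default : Nat.Partition 0)
  rw [repCl_eq_of_iso e, ← RepRing.one_def]
  rfl

/-- `x ⊗ r ↦ dim(r) x`. -/
def dimContract : K0 A ⊗[ℤ] RepRing →+ K0 A :=
  (TensorProduct.rid ℤ (K0 A)).toAddEquiv.toAddMonoidHom.comp
    (LinearMap.lTensor (K0 A) repDim.toIntLinearMap).toAddMonoidHom

theorem dimContract_tmul (x : K0 A) (r : RepRing) : dimContract (x ⊗ₜ[ℤ] r) = repDim r • x :=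
  TensorProduct.rid_tmul _ _

theorem dimContract_coeff_one_lambdaSigma (X : A) :
    dimContract (PowerSeries.coeff 1 (lambdaSigma X)) = cl X := by
  rw [lambdaSigma, PowerSeries.coeff_mk, Fintype.sum_unique, cl_schurObj_of_subsingleton]
  obtain ⟨e⟩ := nonempty_specht_iso_trivial (default : Nat.Partition 1)
  rw [repCl_eq_of_iso e, dimContract_tmul]
  have h1 : repDim (repCl (FDRep.of (Representation.trivial ℚ (Equiv.Perm (Fin 1)) ℚ))) = 1 := by
    rw [repDim_repCl]
    exact congrArg Nat.cast (Module.finrank_self ℚ)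
  rw [h1, one_smul]
  -- `tensorPow X 1` is X ⊗ 𝟙, not X itself.
  exact cl_eq_of_iso (ρ_ X)

/-- The coefficient of `t`, as a homomorphism on `1 + t S[[t]]`. -/
def oneUnitsCoeff (S : Type*) [CommRing S] : Additive (oneUnits S) →+ S where
  toFun u := PowerSeries.coeff 1 ((u.toMul : (PowerSeries S)ˣ) : PowerSeries S)
  map_zero' := by
    change PowerSeries.coeff 1 (1 : PowerSeries S) = 0
    rw [PowerSeries.coeff_one, if_neg one_ne_zero]
  map_add' u v := by
    have hu : ∀ u : Additive (oneUnits S),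
        PowerSeries.constantCoeff ((u.toMul : (PowerSeries S)ˣ) : PowerSeries S) = 1 := fun u =>
      congrArg Units.val (MonoidHom.mem_ker.1 u.toMul.2)
    change PowerSeries.coeff 1 (((u.toMul : (PowerSeries S)ˣ) : PowerSeries S) *
      ((v.toMul : (PowerSeries S)ˣ) : PowerSeries S)) = _
    rw [PowerSeries.coeff_one_mul, hu, hu, mul_one, mul_one, add_comm]

variable (A)

/-- Injectivity comes from a left inverse: on series with constant term 1 the linear coefficient
turns products into sums, and contracting R by dimension returns cl(X). -/
theorem exists_lambdaSigma_hom : ∃ φ : K0 A →+ Additive (oneUnits (K0 A ⊗[ℤ] RepRing)),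
    (∀ X : A, (((φ (cl X)).toMul : (PowerSeries (K0 A ⊗[ℤ] RepRing))ˣ) :
      PowerSeries (K0 A ⊗[ℤ] RepRing)) = lambdaSigma X) ∧ Function.Injective φ := by
  have hu : ∀ X : A, ∃ u : oneUnits (K0 A ⊗[ℤ] RepRing),
      ((u : (PowerSeries (K0 A ⊗[ℤ] RepRing))ˣ) : PowerSeries (K0 A ⊗[ℤ] RepRing)) =
        lambdaSigma X := fun X => by
    have h1 : IsUnit (lambdaSigma X) := PowerSeries.isUnit_iff_constantCoeff.2 (by
      rw [constantCoeff_lambdaSigma]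
      exact isUnit_one)
    obtain ⟨u, hu⟩ := h1
    refine ⟨⟨u, MonoidHom.mem_ker.2 (Units.ext ?_)⟩, hu⟩
    exact (congrArg _ hu).trans (constantCoeff_lambdaSigma X)
  choose U hU using hu
  let φ : K0 A →+ Additive (oneUnits (K0 A ⊗[ℤ] RepRing)) :=
    K0.lift (fun X => Additive.ofMul (U X)) fun X Y Z ⟨e⟩ => by
      rw [← ofMul_mul]
      refine congrArg _ (Subtype.ext (Units.ext ?_))
      rw [hU, lambdaSigma_of_iso_biprod e, ← hU, ← hU]
      rfl
  have hφ : ∀ X : A, (((φ (cl X)).toMul : (PowerSeries (K0 A ⊗[ℤ] RepRing))ˣ) :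
      PowerSeries (K0 A ⊗[ℤ] RepRing)) = lambdaSigma X := fun X => by
    simp only [φ, K0.lift_cl]
    exact hU X
  refine ⟨φ, hφ, ?_⟩
  -- Both sides are additive, so comparing them on classes of objects covers all virtual classes.
  have hinv : (dimContract.comp (oneUnitsCoeff _)).comp φ = AddMonoidHom.id (K0 A) :=
    K0.hom_ext fun X => (congrArg (fun s => dimContract (PowerSeries.coeff 1 s)) (hφ X)).trans
      (dimContract_coeff_one_lambdaSigma X)
  exact Function.LeftInverse.injective (g := dimContract.comp (oneUnitsCoeff _)) fun x =>
    DFunLike.congr_fun hinv x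

end LambdaSigma

end

end GLR

theorem mainTheorem8 {A : Type u} [Category.{v} A] [Preadditive A] [Linear ℚ A]
    [HasFiniteBiproducts A] [IsIdempotentComplete A] [MonoidalCategory A] [MonoidalPreadditive A]
    [MonoidalLinear ℚ A] [SymmetricCategory A] :
    (∃ φ : GLR.K0 A →+ Additive (GLR.oneUnits (GLR.K0 A ⊗[ℤ] GLR.RepRing)),
      (∀ X : A, (((φ (GLR.cl X)).toMul : (PowerSeries (GLR.K0 A ⊗[ℤ] GLR.RepRing))ˣ) :
        PowerSeries (GLR.K0 A ⊗[ℤ] GLR.RepRing)) = GLR.lambdaSigma X) ∧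
      Function.Injective φ) ∧
    (∀ (p q n : ℕ) (h : p + q = n) (μ : p.Partition) (η : q.Partition),
      Nonempty (GLR.indProd h (GLR.specht μ) (GLR.specht η) ≅
        ⨁ fun π : n.Partition => ⨁ fun _ : Fin (GLR.lrCoeff h μ η π) => GLR.specht π)) ∧
    (∀ (n : ℕ) (π : n.Partition) (X Y : A),
      Nonempty (GLR.schurObj π (X ⊞ Y) ≅
        ⨁ fun d : Finset.HasAntidiagonal.antidiagonal n =>
          ⨁ fun μ : d.1.1.Partition => ⨁ fun η : d.1.2.Partition =>
            ⨁ fun _ : Fin (GLR.lrCoeff (Finset.HasAntidiagonal.mem_antidiagonal.mp d.2) μ η π) =>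
              GLR.schurObj μ X ⊗ GLR.schurObj η Y)) := by
  exact ⟨GLR.exists_lambdaSigma_hom A, fun _ _ _ h μ η => GLR.nonempty_indProd_specht_iso h μ η,
    fun _ π X Y => GLR.nonempty_schurObj_biprod_iso X Y π⟩
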